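/- Let $X,Z$ be topological spaces (for instance connected CW-complexes), $Y\subset Z$ a subspace, and $p\ge 0$ an integer. For a map $f:X\to Z$ put $C=f^{-1}(Y)$. A singular $p$-manifold in $C$ is a continuous map $s:N\to C$ from a closed oriented smooth $p$-manifold $N$ (possibly empty); let $M_p(C)$ be the class of all of them. A bordism between $N_0$ and $N_1$ is a compact oriented smooth $(p+1)$-manifold $W$ with $\partial W=N_0\sqcup -N_1$. Two singular $p$-manifolds $s_i:N_i\to C$ $(i=0,1)$ are Nielsen equivalent, $s_0\sim_N s_1$, if there are a bordism $W$ between $N_0$ and $N_1$, a map $H:W\to X$ extending $s_0\sqcup s_1$, and a map $G:W\to Y$ extending $fs_0\sqcup fs_1$, such that $fH$ and $G$ are homotopic, as maps to $Z$, relative to $\partial W$. Write $S'_p(f)=M_p(C)/\sim_N$. A homotopy $F:I\times X\to Z$ from $f_0$ to $f_1$ has its own set of classes $S'_p(F)$, and the inclusions $i_t:X\to I\times X$, $x\mapsto(t,x)$, induce maps $i'_{t*}:S'_p(f_t)\to S'_p(F)$, $[s]\mapsto[i_ts]$, for $t=0,1$. Put $M_p^F=\operatorname{Im}i'_{0*}\cap\operatorname{Im}i'_{1*}$.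 The topologically essential classes of $f$ are $$S_p(f)=\bigcap\{(i'_{0*})^{-1}(M_p^F): F \text{ a homotopy with } F|_{\{0\}\times X}=f\}\subset S'_p(f).$$ Theorem. The relation $\sim_N$ is an equivalence relation, disjoint union makes $S'_p(f)$ an abelian group, and $S_p(f)$ is a subgroup of it. The group $S_p(f)$ is invariant under homotopy of $f$: for every homotopy $F$ from $f$ to $g$ there is an isomorphism $e:S_p(f)\to S_p(g)$ with $i'_{1*}(e(a))=i'_{0*}(a)$ for all $a$. Moreover, for every such $F$ there is a monomorphism $\varphi:S_p(f)\to S'_p(g)$ with $i'_{1*}(\varphi(a))=i'_{0*}(a)$ for all $a$. -/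

import Mathlib

open scoped Manifold ContDiff

noncomputable section

/-- The model `ℝ^p × [0, ∞)` of smooth `(p+1)`-manifolds with boundary. -/
abbrev collarModel (p : ℕ) :
    ModelWithCorners ℝ (EuclideanSpace ℝ (Fin p) × EuclideanSpace ℝ (Fin 1))
      (ModelProd (EuclideanSpace ℝ (Fin p)) (EuclideanHalfSpace 1)) :=
  (𝓡 p).prod (𝓡∂ 1)

/-- An orientation of a smooth manifold `M`: a continuous choice of orientations of the tangent
spaces. The sign at `x` compares the chosen orientation of the tangent space at `x` with the one
which the preferred chart at `x` pulls back from the model vector space; continuity says that, in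
the preferred chart at `x₀`, the orientations at the points near `x₀` agree with the one at `x₀`.
In dimension `0` this is an arbitrary choice of a sign at each point. -/
structure ManifoldOrientation {E H : Type*} [NormedAddCommGroup E] [NormedSpace ℝ E]
    [TopologicalSpace H] (I : ModelWithCorners ℝ E H) (M : Type*) [TopologicalSpace M]
    [ChartedSpace H M] [IsManifold I 1 M] where
  sign : M → ℤˣ
  locally_constant : ∀ x₀ : M, ∀ᶠ x in nhds x₀,
    0 < ((sign x : ℤ) : ℝ) * ((sign x₀ : ℤ) : ℝ) * (tangentCoordChange I x x₀ x).det

/-- The orientation of a disjoint union. -/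
def ManifoldOrientation.sum {E H : Type*} [NormedAddCommGroup E] [NormedSpace ℝ E]
    [TopologicalSpace H] {I : ModelWithCorners ℝ E H} {M N : Type*}
    [TopologicalSpace M] [ChartedSpace H M] [IsManifold I 1 M]
    [TopologicalSpace N] [ChartedSpace H N] [IsManifold I 1 N]
    (o : ManifoldOrientation I M) (o' : ManifoldOrientation I N) :
    ManifoldOrientation I (M ⊕ N) where
  sign := Sum.elim o.sign o'.sign
  locally_constant := by
    rintro (x₀ | x₀)
    · rw [nhds_inl, Filter.eventually_map]
      filter_upwards [o.locally_constant x₀] with x hx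
      have h : tangentCoordChange I (Sum.inl x : M ⊕ N) (Sum.inl x₀) (Sum.inl x)
          = tangentCoordChange I x x₀ x := by
        rw [tangentCoordChange_def, tangentCoordChange_def]
        simp only [extChartAt, ChartedSpace.sum_chartAt_inl]
        congr 1
        · ext e
          simp [Sum.inl_injective.extend_apply]
        · simp [Sum.inl_injective.extend_apply]
      rw [h]
      simpa using hx
    · rw [nhds_inr, Filter.eventually_map]
      filter_upwards [o'.locally_constant x₀] with x hx
      have h : tangentCoordChange I (Sum.inr x : M ⊕ N) (Sum.inr x₀) (Sum.inr x)
          = tangentCoordChange I x x₀ x := by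
        rw [tangentCoordChange_def, tangentCoordChange_def]
        simp only [extChartAt, ChartedSpace.sum_chartAt_inr]
        congr 1
        · ext e
          simp [Sum.inr_injective.extend_apply]
        · simp [Sum.inr_injective.extend_apply]
      rw [h]
      simpa using hx

/-- A singular `p`-manifold in `A`: a continuous map to `A` from a closed (compact, without
boundary) Hausdorff oriented smooth `p`-manifold. -/
structure OrientedSingularManifold (p : ℕ) (A : Type*) [TopologicalSpace A]
    extends SingularManifold.{0} A ∞ (𝓡 p) where
  [t2Space : T2Space M]
  orientation : ManifoldOrientation (𝓡 p) M

namespace OrientedSingularManifold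

variable {p : ℕ} {A B : Type*} [TopologicalSpace A] [TopologicalSpace B]

instance (s : OrientedSingularManifold p A) : T2Space s.M := s.t2Space

/-- The disjoint union of singular manifolds. -/
def sum (s t : OrientedSingularManifold p A) : OrientedSingularManifold p A where
  toSingularManifold := s.toSingularManifold.sum t.toSingularManifold
  t2Space := inferInstanceAs (T2Space (s.M ⊕ t.M))
  orientation := s.orientation.sum t.orientation

/-- The composition of a singular manifold with a continuous map. -/
def map (φ : C(A, B)) (s : OrientedSingularManifold p A) : OrientedSingularManifold p B where
  toSingularManifold := s.toSingularManifold.map φ.continuous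
  t2Space := s.t2Space
  orientation := s.orientation

end OrientedSingularManifold

/-- `N × [0, 1)`, as a subset of `N × [0, ∞)`. -/
def collarDomain (N : Type*) : Set (N × EuclideanHalfSpace 1) := {q | q.2.1 0 < 1}

/-- A collar in `W` of a closed `p`-manifold `N`: a diffeomorphism of `N × [0, 1)` onto an open
subset of `W`, i.e. an injective local diffeomorphism. (The values of `toFun` outside
`N × [0, 1)` are irrelevant.) -/
structure BoundaryCollar (p : ℕ) (N W : Type*)
    [TopologicalSpace N] [ChartedSpace (EuclideanSpace ℝ (Fin p)) N]
    [TopologicalSpace W]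
    [ChartedSpace (ModelProd (EuclideanSpace ℝ (Fin p)) (EuclideanHalfSpace 1)) W] where
  toFun : N × EuclideanHalfSpace 1 → W
  injOn : Set.InjOn toFun (collarDomain N)
  isLocalDiffeomorphOn :
    IsLocalDiffeomorphOn (collarModel p) (collarModel p) ∞ toFun (collarDomain N)

namespace BoundaryCollar

variable {p : ℕ} {N W : Type*}
  [TopologicalSpace N] [ChartedSpace (EuclideanSpace ℝ (Fin p)) N]
  [TopologicalSpace W]
  [ChartedSpace (ModelProd (EuclideanSpace ℝ (Fin p)) (EuclideanHalfSpace 1)) W]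

/-- The restriction of the collar to `N × {0}`. -/
def base (θ : BoundaryCollar p N W) (x : N) : W := θ.toFun (x, ⟨0, le_rfl⟩)

/-- The Jacobian determinant of the collar at `q`, computed in the preferred charts and corrected
by the signs of the orientations: it is positive iff the collar preserves, and negative iff it
reverses, the orientation at `q`, for the product orientation of `N × [0, 1)`. -/
def orientedJacobian [IsManifold (𝓡 p) 1 N] [IsManifold (collarModel p) 1 W]
    (oN : ManifoldOrientation (𝓡 p) N) (oW : ManifoldOrientation (collarModel p) W)
    (θ : BoundaryCollar p N W) (q : N × EuclideanHalfSpace 1) : ℝ :=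
  let D : EuclideanSpace ℝ (Fin p) × EuclideanSpace ℝ (Fin 1) →L[ℝ]
      EuclideanSpace ℝ (Fin p) × EuclideanSpace ℝ (Fin 1) :=
    mfderiv (collarModel p) (collarModel p) θ.toFun q
  ((oN.sign q.1 : ℤ) : ℝ) * ((oW.sign (θ.toFun q) : ℤ) : ℝ) * D.det

end BoundaryCollar

/-- An oriented bordism between the closed oriented `p`-manifolds `N₀` and `N₁`: a compact
Hausdorff oriented smooth `(p+1)`-manifold `W` with boundary `∂W = N₀ ⊔ -N₁`. The identification
of the boundary is given, as usual, by disjoint collars `N₀ × [0, 1) → W` and `N₁ × [0, 1) → W`,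
of which the first preserves and the second reverses the orientation. -/
structure OrientedBordism (p : ℕ) (N₀ N₁ : Type*)
    [TopologicalSpace N₀] [ChartedSpace (EuclideanSpace ℝ (Fin p)) N₀] [IsManifold (𝓡 p) 1 N₀]
    [TopologicalSpace N₁] [ChartedSpace (EuclideanSpace ℝ (Fin p)) N₁] [IsManifold (𝓡 p) 1 N₁]
    (o₀ : ManifoldOrientation (𝓡 p) N₀) (o₁ : ManifoldOrientation (𝓡 p) N₁) where
  W : Type
  [topW : TopologicalSpace W]
  [chartedW : ChartedSpace (ModelProd (EuclideanSpace ℝ (Fin p)) (EuclideanHalfSpace 1)) W]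
  [isManifoldW : IsManifold (collarModel p) ∞ W]
  [compactW : CompactSpace W]
  [t2W : T2Space W]
  orientation : ManifoldOrientation (collarModel p) W
  collar₀ : BoundaryCollar p N₀ W
  collar₁ : BoundaryCollar p N₁ W
  disjoint_collars :
    Disjoint (collar₀.toFun '' collarDomain N₀) (collar₁.toFun '' collarDomain N₁)
  boundary_eq : (collarModel p).boundary W = Set.range collar₀.base ∪ Set.range collar₁.base
  preserves₀ : ∀ q ∈ collarDomain N₀, 0 < collar₀.orientedJacobian o₀ orientation q
  reverses₁ : ∀ q ∈ collarDomain N₁, collar₁.orientedJacobian o₁ orientation q < 0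

instance {p : ℕ} {N₀ N₁ : Type*}
    [TopologicalSpace N₀] [ChartedSpace (EuclideanSpace ℝ (Fin p)) N₀] [IsManifold (𝓡 p) 1 N₀]
    [TopologicalSpace N₁] [ChartedSpace (EuclideanSpace ℝ (Fin p)) N₁] [IsManifold (𝓡 p) 1 N₁]
    {o₀ : ManifoldOrientation (𝓡 p) N₀} {o₁ : ManifoldOrientation (𝓡 p) N₁}
    (b : OrientedBordism p N₀ N₁ o₀ o₁) : TopologicalSpace b.W := b.topW

instance {p : ℕ} {N₀ N₁ : Type*}
    [TopologicalSpace N₀] [ChartedSpace (EuclideanSpace ℝ (Fin p)) N₀] [IsManifold (𝓡 p) 1 N₀]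
    [TopologicalSpace N₁] [ChartedSpace (EuclideanSpace ℝ (Fin p)) N₁] [IsManifold (𝓡 p) 1 N₁]
    {o₀ : ManifoldOrientation (𝓡 p) N₀} {o₁ : ManifoldOrientation (𝓡 p) N₁}
    (b : OrientedBordism p N₀ N₁ o₀ o₁) :
    ChartedSpace (ModelProd (EuclideanSpace ℝ (Fin p)) (EuclideanHalfSpace 1)) b.W := b.chartedW

section Nielsen

variable {X X' Z : Type*} [TopologicalSpace X] [TopologicalSpace X'] [TopologicalSpace Z]

/-- Nielsen equivalence of singular `p`-manifolds in `C = f⁻¹(Y)`: there are a bordism `W` between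
them and maps `h : W → X` and `k : W → Y` extending `s₀ ⊔ s₁` and `f s₀ ⊔ f s₁`, such that `f h`
and `k` are homotopic as maps to `Z` relative to the boundary of `W`. -/
def NielsenEquiv {p : ℕ} (f : C(X, Z)) (Y : Set Z)
    (s₀ s₁ : OrientedSingularManifold p (f ⁻¹' Y)) : Prop :=
  ∃ (b : OrientedBordism p s₀.M s₁.M s₀.orientation s₁.orientation)
    (h : C(b.W, X)) (k : C(b.W, Y)),
    (∀ x, h (b.collar₀.base x) = s₀.f x) ∧ (∀ x, h (b.collar₁.base x) = s₁.f x) ∧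
    (∀ x, (k (b.collar₀.base x) : Z) = f (s₀.f x)) ∧
    (∀ x, (k (b.collar₁.base x) : Z) = f (s₁.f x)) ∧
    (f.comp h).HomotopicRel ((⟨Subtype.val, continuous_subtype_val⟩ : C(Y, Z)).comp k)
      ((collarModel p).boundary b.W)

/-- The set `S'_p(f, Y)` of Nielsen classes of order `p`. -/
def NielsenClass (p : ℕ) (f : C(X, Z)) (Y : Set Z) :=
  Quot (NielsenEquiv (p := p) f Y)

/-- The Nielsen class of a singular manifold. -/
def NielsenClass.mk {p : ℕ} (f : C(X, Z)) (Y : Set Z)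
    (s : OrientedSingularManifold p (f ⁻¹' Y)) : NielsenClass p f Y :=
  Quot.mk _ s

/-- The map of preimage sets `f⁻¹(Y) → f'⁻¹(Y)` given by `k : X → X'` with `f' k = f`. -/
def preimageMap {f : C(X, Z)} {f' : C(X', Z)} (Y : Set Z) (k : C(X, X')) (hk : f'.comp k = f) :
    C(f ⁻¹' Y, f' ⁻¹' Y) where
  toFun x := ⟨k x.1, by
    have h : f' (k x.1) = f x.1 := DFunLike.congr_fun hk x.1
    rw [Set.mem_preimage, h]
    exact x.2⟩
  continuous_toFun := by fun_prop

/-- The map `S'_p(f, Y) → S'_p(f', Y)`, `[s] ↦ [k s]`, induced by `k : X → X'` with `f' k = f`. -/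
def NielsenClass.map {p : ℕ} {f : C(X, Z)} {f' : C(X', Z)} (Y : Set Z) (k : C(X, X'))
    (hk : f'.comp k = f) : NielsenClass p f Y → NielsenClass p f' Y :=
  Quot.map (OrientedSingularManifold.map (preimageMap Y k hk)) (by
    subst hk
    rintro s₀ s₁ ⟨b, h, l, h₀, h₁, l₀, l₁, e⟩
    exact ⟨b, k.comp h, l, fun x => congrArg k (h₀ x), fun x => congrArg k (h₁ x), l₀, l₁, e⟩)

/-- The inclusion `i_t : X → I × X`, `x ↦ (t, x)`. -/
def sliceInclusion (X : Type*) [TopologicalSpace X] (t : unitInterval) : C(X, unitInterval × X) where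
  toFun x := (t, x)
  continuous_toFun := by fun_prop

variable {f g : C(X, Z)}

/-- For a homotopy `F` from `f` to `g`, the map `i'_{0*} : S'_p(f, Y) → S'_p(F, Y)`. -/
def nielsenStart (p : ℕ) (Y : Set Z) (F : f.Homotopy g) :
    NielsenClass p f Y → NielsenClass p F.toContinuousMap Y :=
  NielsenClass.map Y (sliceInclusion X 0) (by ext x; exact F.apply_zero x)

/-- For a homotopy `F` from `f` to `g`, the map `i'_{1*} : S'_p(g, Y) → S'_p(F, Y)`. -/
def nielsenEnd (p : ℕ) (Y : Set Z) (F : f.Homotopy g) :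
    NielsenClass p g Y → NielsenClass p F.toContinuousMap Y :=
  NielsenClass.map Y (sliceInclusion X 1) (by ext x; exact F.apply_one x)

/-- `M_p^F = Im i'_{0*} ∩ Im i'_{1*}`, inside `S'_p(F, Y)`. -/
def preservedClasses (p : ℕ) (Y : Set Z) (F : f.Homotopy g) :
    Set (NielsenClass p F.toContinuousMap Y) :=
  Set.range (nielsenStart p Y F) ∩ Set.range (nielsenEnd p Y F)

/-- `S_p(f, Y)`: the intersection, over all homotopies `F` of `f`, of the sets `M_p^F`, viewed
inside `S'_p(f, Y)` through the maps `i'_{0*}`. -/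
def essentialClasses (p : ℕ) (f : C(X, Z)) (Y : Set Z) : Set (NielsenClass p f Y) :=
  ⋂ (g : C(X, Z)) (F : f.Homotopy g), nielsenStart p Y F ⁻¹' preservedClasses p Y F

end Nielsen

end

/-! The data of a Nielsen equivalence, a bordism `W` with maps to `X` and `Y` and a homotopy between
their images in `Z`, amount to one map from `W` to the space of triples (`x`, `y`, path from `f x`
to `y`), the homotopy fibre product `NielsenSpace`. Since the homotopy is relative to the boundary,
the boundary values are the constant paths given by `C = f⁻¹(Y)`. Hence Nielsen equivalence is
ordinary oriented bordism of maps into a fixed space (`nielsenEquiv_iff`), restricted to the maps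
that factor through the constant paths.

It remains to know that oriented bordism is an equivalence relation compatible with disjoint union.
Cylinders give reflexivity and the group axioms (`BordantMaps.of_diffeomorph`), the cylinder with
both ends incoming gives inverses (`BordantMaps.add_neg`), and reversing the orientation gives
symmetry. Transitivity (`BordantMaps.trans`) is the geometric core: two bordisms are glued along
collars by removing the common boundary and identifying `(x, t)` with `(x, 1 - t)` on the open
collars. The quotient is studied as that of an open set by a free partial involution with closed
graph (`GluingInvolution`): freeness and closedness make the projection a local homeomorphism onto a
Hausdorff space, and the transition maps between local sections are locally the identity or the
involution, so smoothness and orientation descend. The maps descend after each collar has been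
pushed to its base.

Homotopy invariance is formal. A strong deformation retract over `Z` induces a monomorphism of
Nielsen classes (`NielsenClass.map_injective`), so the maps induced by both ends of a homotopy `F`,
and by the inclusion of half a cylinder, are injective. If `a` is essential for `f`, then `F`
matches it with a unique class `b` of `g`. For any homotopy `G` of `g` the class `a` survives the
concatenation of `F` and `G`, whence `b` survives `G`: so `b` is essential. The reversed homotopy
shows that `a ↦ b` is onto the essential classes, and injectivity at the ends makes it an
isomorphism of groups. -/

noncomputable section

/-! ### Local diffeomorphisms: cancellation, products and disjoint unions. -/

section LocalDiffeomorph

variable {E F G H₁ H₂ H₃ : Type*} [NormedAddCommGroup E] [NormedSpace ℝ E]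
  [NormedAddCommGroup F] [NormedSpace ℝ F] [NormedAddCommGroup G] [NormedSpace ℝ G]
  [TopologicalSpace H₁] [TopologicalSpace H₂] [TopologicalSpace H₃]
  {I : ModelWithCorners ℝ E H₁} {J : ModelWithCorners ℝ F H₂} {K : ModelWithCorners ℝ G H₃}
  {M N P : Type*} [TopologicalSpace M] [ChartedSpace H₁ M] [TopologicalSpace N] [ChartedSpace H₂ N]
  [TopologicalSpace P] [ChartedSpace H₃ P] {n : WithTop ℕ∞}

theorem OpenPartialHomeomorph.isLocalDiffeomorphAt (e : OpenPartialHomeomorph M N)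
    (he : ContMDiffOn I J n e e.source) (he' : ContMDiffOn J I n e.symm e.target) {x : M}
    (hx : x ∈ e.source) : IsLocalDiffeomorphAt I J n e x :=
  ⟨{ toPartialEquiv := e.toPartialEquiv
     open_source := e.open_source
     open_target := e.open_target
     contMDiffOn_toFun := he
     contMDiffOn_invFun := he' }, hx, fun _ _ => rfl⟩

theorem isLocalDiffeomorphAt_of_inverse {f : M → N} {g : N → M} {s : Set M} {t : Set N}
    (hs : IsOpen s) (ht : IsOpen t) (hf : ContMDiffOn I J n f s) (hg : ContMDiffOn J I n g t)
    (hst : Set.MapsTo f s t) (hts : Set.MapsTo g t s) (hl : ∀ x ∈ s, g (f x) = x)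
    (hr : ∀ y ∈ t, f (g y) = y) {x : M} (hx : x ∈ s) : IsLocalDiffeomorphAt I J n f x :=
  ⟨{ toFun := f
     invFun := g
     source := s
     target := t
     map_source' := hst
     map_target' := hts
     left_inv' := hl
     right_inv' := hr
     open_source := hs
     open_target := ht
     contMDiffOn_toFun := hf
     contMDiffOn_invFun := hg }, hx, fun _ _ => rfl⟩

theorem IsLocalDiffeomorphAt.congr {f g : M → N} {x : M} (hf : IsLocalDiffeomorphAt I J n f x)
    (h : g =ᶠ[nhds x] f) : IsLocalDiffeomorphAt I J n g x := by
  obtain ⟨Φ, hx, heq⟩ := hf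
  obtain ⟨s, hs, hso, hxs⟩ := eventually_nhds_iff.1
    (h.and (Φ.open_source.mem_nhds hx))
  let e := Φ.toOpenPartialHomeomorph.restrOpen s hso
  refine ⟨{ toPartialEquiv := e.toPartialEquiv
            open_source := e.open_source
            open_target := e.open_target
            contMDiffOn_toFun := Φ.contMDiffOn_toFun.mono Set.inter_subset_left
            contMDiffOn_invFun := Φ.contMDiffOn_invFun.mono Set.inter_subset_left },
    ⟨hx, hxs⟩, fun y hy => ?_⟩
  exact (hs y hy.2).1.trans (heq hy.1)

theorem IsLocalDiffeomorphAt.map_nhds {f : M → N} {x : M} (hf : IsLocalDiffeomorphAt I J n f x) :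
    Filter.map f (nhds x) = nhds (f x) := by
  obtain ⟨Φ, hx, heq⟩ := hf
  have h := Φ.toOpenPartialHomeomorph.map_nhds_eq hx
  have h' : f =ᶠ[nhds x] Φ.toOpenPartialHomeomorph :=
    Filter.eventuallyEq_of_mem (Φ.open_source.mem_nhds hx) heq
  rw [Filter.map_congr h', h, h'.eq_of_nhds]

/-- Near `f x` the map `g` is `g ∘ f` after the local inverse of `f`. Maps prescribed only through a
parametrisation, such as the exchange of two collars, are seen to be smooth in this way. -/
theorem IsLocalDiffeomorphAt.of_comp {f : M → N} {g : N → P} {x : M}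
    (hf : IsLocalDiffeomorphAt I J n f x) (hgf : IsLocalDiffeomorphAt I K n (g ∘ f) x) :
    IsLocalDiffeomorphAt J K n g (f x) := by
  have h := hf.localInverse_isLocalDiffeomorphAt
  have hx : hf.localInverse (f x) = x := hf.localInverse_left_inv hf.localInverse_mem_target
  rw [← hx] at hgf
  refine (h.comp K P hgf).congr ?_
  filter_upwards [hf.localInverse_eventuallyEq_right] with y hy
  simp only [Function.comp_apply, id] at hy ⊢
  rw [hy]

theorem IsLocalDiffeomorphAt.id (x : M) : IsLocalDiffeomorphAt I I n (fun x : M => x) x :=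
  (Diffeomorph.refl I M n).isLocalDiffeomorph x

end LocalDiffeomorph

section Prod

variable {E F E' F' H₁ H₂ H₁' H₂' : Type*} [NormedAddCommGroup E] [NormedSpace ℝ E]
  [NormedAddCommGroup F] [NormedSpace ℝ F] [NormedAddCommGroup E'] [NormedSpace ℝ E']
  [NormedAddCommGroup F'] [NormedSpace ℝ F']
  [TopologicalSpace H₁] [TopologicalSpace H₂] [TopologicalSpace H₁'] [TopologicalSpace H₂']
  {I : ModelWithCorners ℝ E H₁} {J : ModelWithCorners ℝ F H₂}
  {I' : ModelWithCorners ℝ E' H₁'} {J' : ModelWithCorners ℝ F' H₂'}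
  {M N M' N' : Type*} [TopologicalSpace M] [ChartedSpace H₁ M]
  [TopologicalSpace N] [ChartedSpace H₂ N] [TopologicalSpace M'] [ChartedSpace H₁' M']
  [TopologicalSpace N'] [ChartedSpace H₂' N'] {n : WithTop ℕ∞}

theorem IsLocalDiffeomorphAt.prodMap {f : M → N} {g : M' → N'} {q : M × M'}
    (hf : IsLocalDiffeomorphAt I J n f q.1) (hg : IsLocalDiffeomorphAt I' J' n g q.2) :
    IsLocalDiffeomorphAt (I.prod I') (J.prod J') n (Prod.map f g) q := by
  obtain ⟨Φ, hx, heq⟩ := hf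
  obtain ⟨Ψ, hy, heq'⟩ := hg
  have h := (Φ.toOpenPartialHomeomorph.prod Ψ.toOpenPartialHomeomorph).isLocalDiffeomorphAt
    (I := I.prod I') (J := J.prod J') (n := n) (x := q)
    (Φ.contMDiffOn_toFun.prodMap Ψ.contMDiffOn_toFun)
    (Φ.contMDiffOn_invFun.prodMap Ψ.contMDiffOn_invFun) ⟨hx, hy⟩
  refine h.congr ?_
  filter_upwards [(Φ.open_source.prod Ψ.open_source).mem_nhds ⟨hx, hy⟩] with z hz
  exact Prod.ext (heq hz.1) (heq' hz.2)

end Prod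

section Sum

variable {E H : Type*} [NormedAddCommGroup E] [NormedSpace ℝ E] [TopologicalSpace H]
  {I : ModelWithCorners ℝ E H} {M N : Type*} [TopologicalSpace M] [ChartedSpace H M]
  [TopologicalSpace N] [ChartedSpace H N] {n : WithTop ℕ∞}

theorem isLocalDiffeomorphAt_inl (x : M) :
    IsLocalDiffeomorphAt I I n (Sum.inl : M → M ⊕ N) x := by
  refine isLocalDiffeomorphAt_of_inverse (s := Set.univ) (t := Set.range Sum.inl)
    (g := Sum.elim id fun _ => x) isOpen_univ isOpen_range_inl ContMDiff.inl.contMDiffOn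
    (ContMDiff.sumElim contMDiff_id contMDiff_const).contMDiffOn
    (fun y _ => ⟨y, rfl⟩) (fun _ _ => trivial) (fun _ _ => rfl) ?_ trivial
  rintro _ ⟨y, rfl⟩
  rfl

theorem isLocalDiffeomorphAt_inr (x : N) :
    IsLocalDiffeomorphAt I I n (Sum.inr : N → M ⊕ N) x := by
  refine isLocalDiffeomorphAt_of_inverse (s := Set.univ) (t := Set.range Sum.inr)
    (g := Sum.elim (fun _ => x) id) isOpen_univ isOpen_range_inr ContMDiff.inr.contMDiffOn
    (ContMDiff.sumElim contMDiff_const contMDiff_id).contMDiffOn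
    (fun y _ => ⟨y, rfl⟩) (fun _ _ => trivial) (fun _ _ => rfl) ?_ trivial
  rintro _ ⟨y, rfl⟩
  rfl

end Sum

/-! ### Signed Jacobians and orientations. -/

section SignedJacobian

variable {E H₁ H₂ H₃ : Type*} [NormedAddCommGroup E] [NormedSpace ℝ E]
  [TopologicalSpace H₁] [TopologicalSpace H₂] [TopologicalSpace H₃]
  {I : ModelWithCorners ℝ E H₁} {J : ModelWithCorners ℝ E H₂} {K : ModelWithCorners ℝ E H₃}
  {M N P : Type*} [TopologicalSpace M] [ChartedSpace H₁ M] [TopologicalSpace N] [ChartedSpace H₂ N]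
  [TopologicalSpace P] [ChartedSpace H₃ P]

/-- The Jacobian determinant of a map between manifolds with the same model vector space, in the
preferred charts. -/
def jacobian (I : ModelWithCorners ℝ E H₁) (J : ModelWithCorners ℝ E H₂) (f : M → N) (x : M) : ℝ :=
  ContinuousLinearMap.det (M := E) (mfderiv I J f x)

/-- The Jacobian determinant corrected by the signs `s`, `t` comparing the preferred charts of the
source and the target with given orientations. -/
def signedJacobian (I : ModelWithCorners ℝ E H₁) (J : ModelWithCorners ℝ E H₂)
    (s : M → ℤˣ) (t : N → ℤˣ) (f : M → N) (x : M) : ℝ :=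
  ((s x : ℤ) : ℝ) * ((t (f x) : ℤ) : ℝ) * jacobian I J f x

theorem det_comp_continuousLinearMap (A B : E →L[ℝ] E) : (A.comp B).det = A.det * B.det := by
  simp only [ContinuousLinearMap.det]
  exact LinearMap.det_comp _ _

theorem jacobian_comp {f : M → N} {g : N → P} {x : M} (hg : MDifferentiableAt J K g (f x))
    (hf : MDifferentiableAt I J f x) :
    jacobian I K (g ∘ f) x = jacobian J K g (f x) * jacobian I J f x := by
  unfold jacobian
  rw [mfderiv_comp x hg hf]
  exact det_comp_continuousLinearMap _ _

theorem units_cast_mul_self (u : ℤˣ) : ((u : ℤ) : ℝ) * ((u : ℤ) : ℝ) = 1 := by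
  rcases Int.units_eq_one_or u with rfl | rfl <;> simp

/-- The sign at the intermediate point enters twice and squares to one. -/
theorem signedJacobian_comp {f : M → N} {g : N → P} {x : M} (s : M → ℤˣ) (t : N → ℤˣ) (u : P → ℤˣ)
    (hg : MDifferentiableAt J K g (f x)) (hf : MDifferentiableAt I J f x) :
    signedJacobian I K s u (g ∘ f) x =
      signedJacobian J K t u g (f x) * signedJacobian I J s t f x := by
  have h := units_cast_mul_self (t (f x))
  unfold signedJacobian
  rw [jacobian_comp hg hf, Function.comp_apply]
  linear_combination (-(((s x : ℤ) : ℝ) * ((u (g (f x)) : ℤ) : ℝ) * jacobian J K g (f x) *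
    jacobian I J f x)) * h

theorem jacobian_congr {f g : M → N} {x : M} (h : f =ᶠ[nhds x] g) :
    jacobian I J f x = jacobian I J g x := by
  unfold jacobian
  have := h.mfderiv_eq (I := I) (I' := J)
  exact congrArg (ContinuousLinearMap.det (M := E)) this

theorem signedJacobian_congr {f g : M → N} {x : M} {s : M → ℤˣ} {t : N → ℤˣ}
    (h : f =ᶠ[nhds x] g) : signedJacobian I J s t f x = signedJacobian I J s t g x := by
  unfold signedJacobian
  rw [jacobian_congr h, h.eq_of_nhds]

theorem HasMFDerivAt.jacobian_eq {f : M → N} {x : M} {A : E →L[ℝ] E}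
    (h : HasMFDerivAt I J f x A) : jacobian I J f x = A.det := by
  unfold jacobian
  exact congrArg (ContinuousLinearMap.det (M := E)) h.mfderiv

theorem det_id_continuousLinearMap : (ContinuousLinearMap.id ℝ E).det = 1 := by
  simp [ContinuousLinearMap.det]

theorem jacobian_id (x : M) : jacobian I I (fun x : M => x) x = 1 :=
  (HasMFDerivAt.jacobian_eq (hasMFDerivAt_id x)).trans det_id_continuousLinearMap

theorem signedJacobian_id (s : M → ℤˣ) (x : M) : signedJacobian I I s s (fun x : M => x) x = 1 := by
  unfold signedJacobian
  rw [jacobian_id, mul_one, units_cast_mul_self]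

theorem signedJacobian_neg_left (s : M → ℤˣ) (t : N → ℤˣ) (f : M → N) (x : M) :
    signedJacobian I J (fun x => -s x) t f x = -signedJacobian I J s t f x := by
  simp [signedJacobian]

theorem signedJacobian_neg_right (s : M → ℤˣ) (t : N → ℤˣ) (f : M → N) (x : M) :
    signedJacobian I J s (fun x => -t x) f x = -signedJacobian I J s t f x := by
  simp [signedJacobian]

theorem IsLocalDiffeomorphAt.signedJacobian_comp {f : M → N} {g : N → P} {x : M}
    (s : M → ℤˣ) (t : N → ℤˣ) (u : P → ℤˣ) (hg : IsLocalDiffeomorphAt J K ∞ g (f x))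
    (hf : IsLocalDiffeomorphAt I J ∞ f x) :
    signedJacobian I K s u (g ∘ f) x =
      signedJacobian J K t u g (f x) * signedJacobian I J s t f x :=
  _root_.signedJacobian_comp s t u (hg.mdifferentiableAt (by simp)) (hf.mdifferentiableAt (by simp))

theorem jacobian_chartAt [IsManifold I 1 M] {x x₀ : M} (hx : x ∈ (chartAt H₁ x₀).source) :
    jacobian I I (chartAt H₁ x₀) x = (tangentCoordChange I x x₀ x).det := by
  unfold jacobian
  exact congrArg (ContinuousLinearMap.det (M := E)) (mfderiv_chartAt_eq_tangentCoordChange hx)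

/-- The tangent space at `x` is identified with the model vector space through the preferred chart
at `x`, so in these coordinates that chart has the identity as derivative. -/
theorem jacobian_chartAt_self [IsManifold I 1 M] (x : M) :
    jacobian I I (chartAt H₁ x) x = 1 := by
  rw [jacobian_chartAt (mem_chart_source _ x)]
  have : tangentCoordChange I x x x = ContinuousLinearMap.id ℝ E := by
    ext v
    exact tangentCoordChange_self (mem_extChartAt_source x)
  rw [this, det_id_continuousLinearMap]

theorem mdifferentiableAt_chartAt' [IsManifold I 1 M] {x x₀ : M}
    (hx : x ∈ (chartAt H₁ x₀).source) : MDifferentiableAt I I (chartAt H₁ x₀) x :=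
  mdifferentiableAt_atlas (chart_mem_atlas H₁ x₀) hx

/-- With the constant sign `o.sign x₀` on the model, `locally_constant` becomes a statement about a
signed Jacobian, to which the chain rule applies. -/
theorem ManifoldOrientation.signedJacobian_chartAt_pos [IsManifold I 1 M]
    (o : ManifoldOrientation I M) (x₀ : M) :
    ∀ᶠ x in nhds x₀,
      0 < signedJacobian I I o.sign (fun _ => o.sign x₀) (chartAt H₁ x₀) x := by
  filter_upwards [o.locally_constant x₀, chart_source_mem_nhds H₁ x₀] with x hx hx'
  unfold signedJacobian
  rwa [jacobian_chartAt hx']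

/-- An orientation given by signs for which the preferred charts are locally orientation
preserving. -/
def ManifoldOrientation.ofSignedJacobian [IsManifold I 1 M] (s : M → ℤˣ)
    (hs : ∀ x₀, ∀ᶠ x in nhds x₀,
      0 < signedJacobian I I s (fun _ => s x₀) (chartAt H₁ x₀) x) :
    ManifoldOrientation I M where
  sign := s
  locally_constant x₀ := by
    filter_upwards [hs x₀, chart_source_mem_nhds H₁ x₀] with x hx hx'
    unfold signedJacobian at hx
    rwa [jacobian_chartAt hx'] at hx

/-- The opposite orientation. -/
def ManifoldOrientation.neg [IsManifold I 1 M] (o : ManifoldOrientation I M) :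
    ManifoldOrientation I M where
  sign x := -o.sign x
  locally_constant x₀ := by
    filter_upwards [o.locally_constant x₀] with x hx
    simpa using hx

end SignedJacobian

section SignedJacobianProd

variable {E E' H₁ H₂ H₁' H₂' : Type*} [NormedAddCommGroup E] [NormedSpace ℝ E]
  [NormedAddCommGroup E'] [NormedSpace ℝ E'] [FiniteDimensional ℝ E] [FiniteDimensional ℝ E']
  [TopologicalSpace H₁] [TopologicalSpace H₂] [TopologicalSpace H₁'] [TopologicalSpace H₂']
  {I : ModelWithCorners ℝ E H₁} {J : ModelWithCorners ℝ E H₂}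
  {I' : ModelWithCorners ℝ E' H₁'} {J' : ModelWithCorners ℝ E' H₂'}
  {M N M' N' : Type*} [TopologicalSpace M] [ChartedSpace H₁ M]
  [TopologicalSpace N] [ChartedSpace H₂ N] [TopologicalSpace M'] [ChartedSpace H₁' M']
  [TopologicalSpace N'] [ChartedSpace H₂' N']

theorem jacobian_prodMap {f : M → N} {g : M' → N'} {q : M × M'}
    (hf : MDifferentiableAt I J f q.1) (hg : MDifferentiableAt I' J' g q.2) :
    jacobian (I.prod I') (J.prod J') (Prod.map f g) q =
      jacobian I J f q.1 * jacobian I' J' g q.2 := by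
  unfold jacobian
  refine (congrArg (ContinuousLinearMap.det (M := E × E')) (mfderiv_prodMap hf hg)).trans ?_
  exact LinearMap.det_prodMap _ _

theorem signedJacobian_prodMap {f : M → N} {g : M' → N'} {q : M × M'}
    (s : M → ℤˣ) (t : N → ℤˣ) (s' : M' → ℤˣ) (t' : N' → ℤˣ)
    (hf : MDifferentiableAt I J f q.1) (hg : MDifferentiableAt I' J' g q.2) :
    signedJacobian (I.prod I') (J.prod J') (fun q => s q.1 * s' q.2) (fun q => t q.1 * t' q.2)
      (Prod.map f g) q =
      signedJacobian I J s t f q.1 * signedJacobian I' J' s' t' g q.2 := by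
  unfold signedJacobian
  rw [jacobian_prodMap hf hg]
  simp only [Prod.map_fst, Prod.map_snd, Units.val_mul, Int.cast_mul]
  ring

/-- The product orientation. -/
def ManifoldOrientation.prod [IsManifold I 1 M] [IsManifold I' 1 M']
    (o : ManifoldOrientation I M) (o' : ManifoldOrientation I' M') :
    ManifoldOrientation (I.prod I') (M × M') :=
  .ofSignedJacobian (fun q => o.sign q.1 * o'.sign q.2) (by
    rintro ⟨x₀, y₀⟩
    rw [nhds_prod_eq]
    filter_upwards [((o.signedJacobian_chartAt_pos x₀).and (chart_source_mem_nhds H₁ x₀)).prod_mk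
      ((o'.signedJacobian_chartAt_pos y₀).and (chart_source_mem_nhds H₁' y₀))] with q hq
    have h := signedJacobian_prodMap (q := q) o.sign (fun _ => o.sign x₀) o'.sign
      (fun _ => o'.sign y₀) (mdifferentiableAt_chartAt' (I := I) hq.1.2)
      (mdifferentiableAt_chartAt' (I := I') hq.2.2)
    have h' := mul_pos hq.1.1 hq.2.1
    rw [← h] at h'
    -- The Jacobian was computed for the product charted structure on the model; it is needed for
    -- the structure of the model over itself, which is the same.
    rw [chartedSpaceSelf_prod] at h'
    exact h')

end SignedJacobianProd

section SignedJacobianSum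

variable {E H : Type*} [NormedAddCommGroup E] [NormedSpace ℝ E] [TopologicalSpace H]
  {I : ModelWithCorners ℝ E H} {M N : Type*} [TopologicalSpace M] [ChartedSpace H M]
  [TopologicalSpace N] [ChartedSpace H N]

theorem jacobian_inl (x : M) : jacobian I I (Sum.inl : M → M ⊕ N) x = 1 := by
  refine (HasMFDerivAt.jacobian_eq (A := ContinuousLinearMap.id ℝ E) ?_).trans
    det_id_continuousLinearMap
  exact hasMFDerivWithinAt_univ.1 (hasMFDerivWithinAt_inl (I := I) (q := x) (s := Set.univ))

theorem jacobian_inr (x : N) : jacobian I I (Sum.inr : N → M ⊕ N) x = 1 := by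
  refine (HasMFDerivAt.jacobian_eq (A := ContinuousLinearMap.id ℝ E) ?_).trans
    det_id_continuousLinearMap
  exact hasMFDerivWithinAt_univ.1 (hasMFDerivWithinAt_inr (I := I) (q' := x) (t := Set.univ))

theorem signedJacobian_inl (s : M → ℤˣ) (t : N → ℤˣ) (x : M) :
    signedJacobian I I s (Sum.elim s t) Sum.inl x = 1 := by
  unfold signedJacobian
  rw [jacobian_inl, Sum.elim_inl, mul_one, units_cast_mul_self]

theorem signedJacobian_inr (s : M → ℤˣ) (t : N → ℤˣ) (x : N) :
    signedJacobian I I t (Sum.elim s t) Sum.inr x = 1 := by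
  unfold signedJacobian
  rw [jacobian_inr, Sum.elim_inr, mul_one, units_cast_mul_self]

end SignedJacobianSum

/-! ### Affine maps of the closed half line. -/

section HalfLine

/-- The point of the closed half line with coordinate `max r 0`. -/
def halfLinePoint (r : ℝ) : EuclideanHalfSpace 1 :=
  ⟨WithLp.toLp 2 fun _ => max r 0, le_max_right _ _⟩

/-- The affine map `t ↦ a t + b` of the closed half line, cut off at `0`. -/
def halfLineAffine (a b : ℝ) (t : EuclideanHalfSpace 1) : EuclideanHalfSpace 1 :=
  halfLinePoint (a * t.1 0 + b)

theorem halfLinePoint_coord {r : ℝ} (hr : 0 ≤ r) : (halfLinePoint r).1 0 = r :=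
  max_eq_left hr

theorem halfLine_ext {t u : EuclideanHalfSpace 1} (h : t.1 0 = u.1 0) : t = u := by
  ext i
  rw [Subsingleton.elim i 0]
  exact h

theorem halfLineAffine_coord {a b : ℝ} {t : EuclideanHalfSpace 1} (h : 0 ≤ a * t.1 0 + b) :
    (halfLineAffine a b t).1 0 = a * t.1 0 + b :=
  max_eq_left h

theorem continuous_halfLineCoord : Continuous fun t : EuclideanHalfSpace 1 => t.1 0 := by
  fun_prop

theorem continuous_halfLinePoint : Continuous halfLinePoint := by
  unfold halfLinePoint
  fun_prop

theorem continuous_halfLineAffine (a b : ℝ) : Continuous (halfLineAffine a b) :=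
  continuous_halfLinePoint.comp (by fun_prop)

/-- The hypothesis makes the cut-off at `0` inactive near `t`, which leaves the affine map on the
range of the model. -/
theorem halfLineAffine_writtenInExtChartAt {a b : ℝ} {t : EuclideanHalfSpace 1}
    (h : ∀ᶠ u : EuclideanHalfSpace 1 in nhds t, 0 ≤ a * u.1 0 + b) :
    writtenInExtChartAt (𝓡∂ 1) (𝓡∂ 1) t (halfLineAffine a b)
      =ᶠ[nhdsWithin (extChartAt (𝓡∂ 1) t t) (Set.range (𝓡∂ 1))]
      fun y => a • y + WithLp.toLp 2 fun _ => b := by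
  have h' : ∀ᶠ y in nhdsWithin (extChartAt (𝓡∂ 1) t t) (Set.range (𝓡∂ 1)),
      0 ≤ a * ((𝓡∂ 1).symm y).1 0 + b := by
    have hc : Filter.Tendsto (𝓡∂ 1).symm (nhds (extChartAt (𝓡∂ 1) t t)) (nhds t) := by
      have := (𝓡∂ 1).continuous_symm.tendsto (extChartAt (𝓡∂ 1) t t)
      simpa only [mfld_simps, chartAt_self_eq] using this
    exact (hc.mono_left nhdsWithin_le_nhds).eventually h
  filter_upwards [h', self_mem_nhdsWithin] with y hy hy'
  obtain ⟨u, rfl⟩ := hy'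
  rw [ModelWithCorners.left_inv] at hy
  ext i
  rw [Subsingleton.elim i 0]
  simp only [writtenInExtChartAt, mfld_simps]
  exact max_eq_left hy

theorem hasMFDerivAt_halfLineAffine {a b : ℝ} {t : EuclideanHalfSpace 1}
    (h : ∀ᶠ u : EuclideanHalfSpace 1 in nhds t, 0 ≤ a * u.1 0 + b) :
    HasMFDerivAt (𝓡∂ 1) (𝓡∂ 1) (halfLineAffine a b) t
      (a • ContinuousLinearMap.id ℝ (EuclideanSpace ℝ (Fin 1))) := by
  refine ⟨(continuous_halfLineAffine a b).continuousAt, ?_⟩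
  refine HasFDerivWithinAt.congr_of_eventuallyEq ?_ (halfLineAffine_writtenInExtChartAt h)
    ((halfLineAffine_writtenInExtChartAt h).eq_of_nhdsWithin ⟨t, rfl⟩)
  exact ((hasFDerivWithinAt_id _ _).const_smul a).add_const _

theorem contMDiffAt_halfLineAffine {a b : ℝ} {t : EuclideanHalfSpace 1}
    (h : ∀ᶠ u : EuclideanHalfSpace 1 in nhds t, 0 ≤ a * u.1 0 + b) :
    ContMDiffAt (𝓡∂ 1) (𝓡∂ 1) ∞ (halfLineAffine a b) t := by
  rw [contMDiffAt_iff]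
  refine ⟨(continuous_halfLineAffine a b).continuousAt, ?_⟩
  refine ContDiffWithinAt.congr_of_eventuallyEq ?_ (halfLineAffine_writtenInExtChartAt h)
    ((halfLineAffine_writtenInExtChartAt h).eq_of_nhdsWithin ⟨t, rfl⟩)
  exact ((contDiff_id.const_smul a).add contDiff_const).contDiffWithinAt

theorem jacobian_halfLineAffine {a b : ℝ} {t : EuclideanHalfSpace 1}
    (h : ∀ᶠ u : EuclideanHalfSpace 1 in nhds t, 0 ≤ a * u.1 0 + b) :
    jacobian (𝓡∂ 1) (𝓡∂ 1) (halfLineAffine a b) t = a := by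
  rw [(hasMFDerivAt_halfLineAffine h).jacobian_eq]
  simp [ContinuousLinearMap.det]

/-- The map `t ↦ t / 2` of the closed half line. -/
abbrev halfLineHalve : EuclideanHalfSpace 1 → EuclideanHalfSpace 1 := halfLineAffine (1 / 2) 0

/-- The map `t ↦ 1 - t` of the closed half line, cut off at `0`. -/
abbrev halfLineFlip : EuclideanHalfSpace 1 → EuclideanHalfSpace 1 := halfLineAffine (-1) 1

theorem halfLineHalve_coord (t : EuclideanHalfSpace 1) : (halfLineHalve t).1 0 = t.1 0 / 2 := by
  have := t.2
  rw [halfLineAffine_coord] <;> linarith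

theorem halfLineFlip_coord {t : EuclideanHalfSpace 1} (ht : t.1 0 ≤ 1) :
    (halfLineFlip t).1 0 = 1 - t.1 0 := by
  rw [halfLineAffine_coord] <;> linarith

theorem isLocalDiffeomorphAt_halfLineHalve (t : EuclideanHalfSpace 1) :
    IsLocalDiffeomorphAt (𝓡∂ 1) (𝓡∂ 1) ∞ halfLineHalve t := by
  refine isLocalDiffeomorphAt_of_inverse (g := halfLineAffine 2 0) isOpen_univ isOpen_univ
    (fun u _ => (contMDiffAt_halfLineAffine (.of_forall fun v => ?_)).contMDiffWithinAt)
    (fun u _ => (contMDiffAt_halfLineAffine (.of_forall fun v => ?_)).contMDiffWithinAt)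
    (Set.mapsTo_univ _ _) (Set.mapsTo_univ _ _) (fun u _ => ?_) (fun u _ => ?_) (Set.mem_univ t)
  · have := v.2; linarith
  · have := v.2; linarith
  · have := u.2
    apply halfLine_ext
    rw [halfLineAffine_coord] <;> rw [halfLineHalve_coord] <;> linarith
  · have := u.2
    apply halfLine_ext
    rw [halfLineHalve_coord, halfLineAffine_coord] <;> linarith

theorem jacobian_halfLineHalve (t : EuclideanHalfSpace 1) :
    jacobian (𝓡∂ 1) (𝓡∂ 1) halfLineHalve t = 1 / 2 :=
  jacobian_halfLineAffine (.of_forall fun v => by have := v.2; linarith)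

/-- The open interval `(0, 1)` in the closed half line. -/
def halfLineIoo : Set (EuclideanHalfSpace 1) := {t | 0 < t.1 0 ∧ t.1 0 < 1}

theorem isOpen_halfLineIoo : IsOpen halfLineIoo :=
  (isOpen_lt continuous_const continuous_halfLineCoord).inter
    (isOpen_lt continuous_halfLineCoord continuous_const)

theorem halfLineFlip_mem {t : EuclideanHalfSpace 1} (ht : t ∈ halfLineIoo) :
    halfLineFlip t ∈ halfLineIoo := by
  obtain ⟨h0, h1⟩ := ht
  constructor <;> rw [halfLineFlip_coord h1.le] <;> linarith

theorem halfLineFlip_flip {t : EuclideanHalfSpace 1} (ht : t ∈ halfLineIoo) :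
    halfLineFlip (halfLineFlip t) = t := by
  apply halfLine_ext
  rw [halfLineFlip_coord (halfLineFlip_mem ht).2.le, halfLineFlip_coord ht.2.le]
  ring

theorem eventually_halfLineFlip {t : EuclideanHalfSpace 1} (ht : t ∈ halfLineIoo) :
    ∀ᶠ u : EuclideanHalfSpace 1 in nhds t, 0 ≤ (-1) * u.1 0 + 1 := by
  filter_upwards [isOpen_halfLineIoo.mem_nhds ht] with u hu
  linarith [hu.2]

theorem isLocalDiffeomorphAt_halfLineFlip {t : EuclideanHalfSpace 1} (ht : t ∈ halfLineIoo) :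
    IsLocalDiffeomorphAt (𝓡∂ 1) (𝓡∂ 1) ∞ halfLineFlip t :=
  isLocalDiffeomorphAt_of_inverse (g := halfLineFlip) isOpen_halfLineIoo isOpen_halfLineIoo
    (fun _ hu => (contMDiffAt_halfLineAffine (eventually_halfLineFlip hu)).contMDiffWithinAt)
    (fun _ hu => (contMDiffAt_halfLineAffine (eventually_halfLineFlip hu)).contMDiffWithinAt)
    (fun _ => halfLineFlip_mem) (fun _ => halfLineFlip_mem) (fun _ => halfLineFlip_flip)
    (fun _ => halfLineFlip_flip) ht

theorem jacobian_halfLineFlip {t : EuclideanHalfSpace 1} (ht : t ∈ halfLineIoo) :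
    jacobian (𝓡∂ 1) (𝓡∂ 1) halfLineFlip t = -1 :=
  jacobian_halfLineAffine (eventually_halfLineFlip ht)

end HalfLine

/-! ### Charts and the standard orientation of the unit interval. -/

section Interval

theorem isLocalDiffeomorphAt_IccLeftChart {t : Set.Icc (0 : ℝ) 1}
    (ht : t ∈ (IccLeftChart (0 : ℝ) 1).source) :
    IsLocalDiffeomorphAt (𝓡∂ 1) (𝓡∂ 1) ∞ (IccLeftChart (0 : ℝ) 1) t := by
  have h : IccLeftChart (0 : ℝ) 1 ∈ IsManifold.maximalAtlas (𝓡∂ 1) ∞ (Set.Icc (0 : ℝ) 1) :=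
    IsManifold.subset_maximalAtlas (Set.mem_insert _ _)
  exact (IccLeftChart (0 : ℝ) 1).isLocalDiffeomorphAt (contMDiffOn_of_mem_maximalAtlas h)
    (contMDiffOn_symm_of_mem_maximalAtlas h) ht

theorem isLocalDiffeomorphAt_IccRightChart {t : Set.Icc (0 : ℝ) 1}
    (ht : t ∈ (IccRightChart (0 : ℝ) 1).source) :
    IsLocalDiffeomorphAt (𝓡∂ 1) (𝓡∂ 1) ∞ (IccRightChart (0 : ℝ) 1) t := by
  have h : IccRightChart (0 : ℝ) 1 ∈ IsManifold.maximalAtlas (𝓡∂ 1) ∞ (Set.Icc (0 : ℝ) 1) :=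
    IsManifold.subset_maximalAtlas (Set.mem_insert_of_mem _ rfl)
  exact (IccRightChart (0 : ℝ) 1).isLocalDiffeomorphAt (contMDiffOn_of_mem_maximalAtlas h)
    (contMDiffOn_symm_of_mem_maximalAtlas h) ht

/-- The sign comparing the preferred chart of `[0, 1]` with the standard orientation. -/
def unitIntervalSign (t : Set.Icc (0 : ℝ) 1) : ℤˣ := if t.1 < 1 then 1 else -1

theorem signedJacobian_IccLeftChart {t : Set.Icc (0 : ℝ) 1} (ht : t.1 < 1) :
    signedJacobian (𝓡∂ 1) (𝓡∂ 1) unitIntervalSign (fun _ => 1) (IccLeftChart (0 : ℝ) 1) t = 1 := by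
  unfold signedJacobian
  rw [← Icc_chartedSpaceChartAt_of_le_top ht, jacobian_chartAt_self]
  simp [unitIntervalSign, ht]

/-- The preferred chart is the left one for `t < 1` and the right one only at `1`, hence the jump of
`unitIntervalSign`. For `t < 1` the right chart is the left one followed by the flip, of Jacobian
`-1`; at `1` the Jacobian is `1` and the sign is `-1`. -/
theorem signedJacobian_IccRightChart {t : Set.Icc (0 : ℝ) 1} (ht : 0 < t.1) :
    signedJacobian (𝓡∂ 1) (𝓡∂ 1) unitIntervalSign (fun _ => 1)
      (IccRightChart (0 : ℝ) 1) t = -1 := by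
  by_cases h1 : t.1 < 1
  · have hc : IccLeftChart (0 : ℝ) 1 t ∈ halfLineIoo := by
      simpa [halfLineIoo, IccLeftChart] using ⟨ht, h1⟩
    have h : IccRightChart (0 : ℝ) 1 =ᶠ[nhds t] halfLineFlip ∘ IccLeftChart (0 : ℝ) 1 := by
      refine .of_forall fun u => halfLine_ext ?_
      have h0 := u.2.1
      have h1 := u.2.2
      rw [Function.comp_apply, halfLineFlip_coord] <;> simp [IccLeftChart, IccRightChart, h1]
    rw [signedJacobian_congr h, IsLocalDiffeomorphAt.signedJacobian_comp _ (fun _ => 1) _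
      (isLocalDiffeomorphAt_halfLineFlip hc) (isLocalDiffeomorphAt_IccLeftChart h1),
      signedJacobian_IccLeftChart h1]
    simp [signedJacobian, jacobian_halfLineFlip hc]
  · unfold signedJacobian
    rw [← Icc_chartedSpaceChartAt_of_top_le (not_lt.1 h1), jacobian_chartAt_self]
    simp [unitIntervalSign, h1]

/-- The standard orientation of `[0, 1]`. -/
def unitIntervalOrientation : ManifoldOrientation (𝓡∂ 1) (Set.Icc (0 : ℝ) 1) :=
  .ofSignedJacobian unitIntervalSign (by
    intro t₀
    by_cases h : t₀.1 < 1
    · have hn : ∀ᶠ t : Set.Icc (0 : ℝ) 1 in nhds t₀, t.1 < 1 :=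
        continuous_subtype_val.continuousAt.eventually_lt continuousAt_const h
      filter_upwards [hn] with t ht
      have hs : unitIntervalSign t₀ = 1 := if_pos h
      rw [Icc_chartedSpaceChartAt_of_le_top h, hs, signedJacobian_IccLeftChart ht]
      exact one_pos
    · have hn : ∀ᶠ t : Set.Icc (0 : ℝ) 1 in nhds t₀, 0 < t.1 :=
        continuousAt_const.eventually_lt continuous_subtype_val.continuousAt
          (one_pos.trans_le (not_lt.1 h))
      filter_upwards [hn] with t ht
      have hs : unitIntervalSign t₀ = -1 := if_neg h
      rw [Icc_chartedSpaceChartAt_of_top_le (not_lt.1 h), hs,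
        signedJacobian_neg_right _ (fun _ => 1), signedJacobian_IccRightChart ht]
      norm_num)

end Interval

theorem Diffeomorph.isLocalDiffeomorphAt {E H M N : Type*} [NormedAddCommGroup E]
    [NormedSpace ℝ E] [TopologicalSpace H] {I : ModelWithCorners ℝ E H}
    [TopologicalSpace M] [ChartedSpace H M] [TopologicalSpace N] [ChartedSpace H N]
    (φ : Diffeomorph I I M N ∞) (x : M) : IsLocalDiffeomorphAt I I ∞ φ x :=
  φ.isLocalDiffeomorph x

theorem isLocalDiffeomorphAt_id {E H M : Type*} [NormedAddCommGroup E] [NormedSpace ℝ E]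
    [TopologicalSpace H] {I : ModelWithCorners ℝ E H} [TopologicalSpace M] [ChartedSpace H M]
    (x : M) : IsLocalDiffeomorphAt I I ∞ (id : M → M) x :=
  IsLocalDiffeomorphAt.id x

/-! ### Operations on collars and their effect on orientations. -/

section CollarOperations

variable {p : ℕ} {N N' W W' : Type*}
  [TopologicalSpace N] [ChartedSpace (EuclideanSpace ℝ (Fin p)) N]
  [TopologicalSpace N'] [ChartedSpace (EuclideanSpace ℝ (Fin p)) N']
  [TopologicalSpace W]
  [ChartedSpace (ModelProd (EuclideanSpace ℝ (Fin p)) (EuclideanHalfSpace 1)) W]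
  [TopologicalSpace W']
  [ChartedSpace (ModelProd (EuclideanSpace ℝ (Fin p)) (EuclideanHalfSpace 1)) W']

theorem isOpen_collarDomain : IsOpen (collarDomain N) :=
  isOpen_lt (continuous_halfLineCoord.comp continuous_snd) continuous_const

/-- The endpoint of the closed half line. -/
abbrev halfLineZero : EuclideanHalfSpace 1 := ⟨0, le_rfl⟩

theorem mem_collarDomain_zero {N : Type*} (x : N) : (x, halfLineZero) ∈ collarDomain N := by
  simp [collarDomain]

theorem signedJacobian_prodMap_fst (s : N → ℤˣ) (t : N' → ℤˣ) {f : N → N'}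
    {g : EuclideanHalfSpace 1 → EuclideanHalfSpace 1} {q : N × EuclideanHalfSpace 1}
    (hf : IsLocalDiffeomorphAt (𝓡 p) (𝓡 p) ∞ f q.1)
    (hg : IsLocalDiffeomorphAt (𝓡∂ 1) (𝓡∂ 1) ∞ g q.2) :
    signedJacobian (collarModel p) (collarModel p) (fun q => s q.1) (fun q => t q.1)
      (Prod.map f g) q = signedJacobian (𝓡 p) (𝓡 p) s t f q.1 * jacobian (𝓡∂ 1) (𝓡∂ 1) g q.2 := by
  have h := signedJacobian_prodMap (q := q) s t (fun _ => 1) (fun _ => 1)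
    (hf.mdifferentiableAt (by simp)) (hg.mdifferentiableAt (by simp))
  simpa [signedJacobian] using h

theorem disjoint_image_inl_inr {A B V V' : Type*} (f : A → V) (g : B → V') (s : Set A) (t : Set B) :
    Disjoint ((Sum.inl ∘ f : A → V ⊕ V') '' s) ((Sum.inr ∘ g : B → V ⊕ V') '' t) := by
  rw [Set.disjoint_left]
  rintro _ ⟨a, _, rfl⟩ ⟨b, _, h⟩
  cases h

theorem disjoint_image_comp {A B V V' : Type*} {f : A → V} {g : B → V} {s : Set A} {t : Set B}
    {i : V → V'} (hi : Function.Injective i) (h : Disjoint (f '' s) (g '' t)) :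
    Disjoint ((i ∘ f) '' s) ((i ∘ g) '' t) := by
  rw [Set.image_comp, Set.image_comp]
  exact (Set.disjoint_image_iff hi).2 h

namespace BoundaryCollar

theorem isLocalDiffeomorphAt (θ : BoundaryCollar p N W) {q : N × EuclideanHalfSpace 1}
    (hq : q ∈ collarDomain N) :
    IsLocalDiffeomorphAt (collarModel p) (collarModel p) ∞ θ.toFun q :=
  θ.isLocalDiffeomorphOn ⟨q, hq⟩

theorem continuousAt (θ : BoundaryCollar p N W) {q : N × EuclideanHalfSpace 1}
    (hq : q ∈ collarDomain N) : ContinuousAt θ.toFun q :=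
  (θ.isLocalDiffeomorphAt hq).contMDiffAt.continuousAt

theorem isOpen_image (θ : BoundaryCollar p N W) {s : Set (N × EuclideanHalfSpace 1)}
    (hs : IsOpen s) (hsd : s ⊆ collarDomain N) : IsOpen (θ.toFun '' s) := by
  rw [isOpen_iff_mem_nhds]
  rintro _ ⟨q, hq, rfl⟩
  rw [← (θ.isLocalDiffeomorphAt (hsd hq)).map_nhds]
  exact Filter.image_mem_map (hs.mem_nhds hq)

theorem orientedJacobian_eq [IsManifold (𝓡 p) 1 N] [IsManifold (collarModel p) 1 W]
    (oN : ManifoldOrientation (𝓡 p) N) (oW : ManifoldOrientation (collarModel p) W)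
    (θ : BoundaryCollar p N W) (q : N × EuclideanHalfSpace 1) :
    θ.orientedJacobian oN oW q =
      signedJacobian (collarModel p) (collarModel p) (fun q => oN.sign q.1) oW.sign θ.toFun q :=
  rfl

/-- The image of a collar under a map which is an injective local diffeomorphism on it. -/
def postcomp (θ : BoundaryCollar p N W) (g : W → W')
    (hg : ∀ q ∈ collarDomain N,
      IsLocalDiffeomorphAt (collarModel p) (collarModel p) ∞ g (θ.toFun q))
    (hinj : Set.InjOn g (θ.toFun '' collarDomain N)) : BoundaryCollar p N W' where
  toFun := g ∘ θ.toFun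
  injOn := hinj.comp θ.injOn (Set.mapsTo_image _ _)
  isLocalDiffeomorphOn q := (θ.isLocalDiffeomorphAt q.2).comp _ _ (hg q q.2)

/-- The collar `θ ∘ (f × g)`. -/
def precomp (θ : BoundaryCollar p N W) (f : N' → N)
    (g : EuclideanHalfSpace 1 → EuclideanHalfSpace 1)
    (hf : ∀ x, IsLocalDiffeomorphAt (𝓡 p) (𝓡 p) ∞ f x)
    (hg : ∀ t : EuclideanHalfSpace 1, t.1 0 < 1 → IsLocalDiffeomorphAt (𝓡∂ 1) (𝓡∂ 1) ∞ g t)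
    (hgd : ∀ t : EuclideanHalfSpace 1, t.1 0 < 1 → (g t).1 0 < 1)
    (hfi : Function.Injective f) (hgi : Function.Injective g) : BoundaryCollar p N' W where
  toFun := θ.toFun ∘ Prod.map f g
  injOn := θ.injOn.comp (Function.Injective.injOn (hfi.prodMap hgi)) fun q hq => hgd q.2 hq
  isLocalDiffeomorphOn q :=
    ((hf q.1.1).prodMap (hg q.1.2 q.2)).comp _ _ (θ.isLocalDiffeomorphAt (hgd q.1.2 q.2))

/-- The collar of a disjoint union given by disjoint collars. -/
def sum (θ : BoundaryCollar p N W) (θ' : BoundaryCollar p N' W)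
    (h : Disjoint (θ.toFun '' collarDomain N) (θ'.toFun '' collarDomain N')) :
    BoundaryCollar p (N ⊕ N') W where
  toFun q := Sum.elim (fun x => θ.toFun (x, q.2)) (fun x => θ'.toFun (x, q.2)) q.1
  injOn := by
    rw [Set.disjoint_left] at h
    rintro ⟨x | x, t⟩ ht ⟨y | y, u⟩ hu hxy
    · have := θ.injOn (x₁ := (x, t)) (x₂ := (y, u)) ht hu hxy
      simp_all
    · exact (h ⟨(x, t), ht, rfl⟩ ⟨(y, u), hu, hxy.symm⟩).elim
    · exact (h ⟨(y, u), hu, rfl⟩ ⟨(x, t), ht, hxy⟩).elim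
    · have := θ'.injOn (x₁ := (x, t)) (x₂ := (y, u)) ht hu hxy
      simp_all
  isLocalDiffeomorphOn := by
    rintro ⟨⟨x | x, t⟩, ht⟩
    · exact (IsLocalDiffeomorphAt.prodMap (q := (x, t)) (isLocalDiffeomorphAt_inl x)
        (IsLocalDiffeomorphAt.id t)).of_comp (θ.isLocalDiffeomorphAt (q := (x, t)) ht)
    · exact (IsLocalDiffeomorphAt.prodMap (q := (x, t)) (isLocalDiffeomorphAt_inr x)
        (IsLocalDiffeomorphAt.id t)).of_comp (θ'.isLocalDiffeomorphAt (q := (x, t)) ht)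

/-- The collar of the empty manifold. -/
def ofIsEmpty [IsEmpty N] : BoundaryCollar p N W where
  toFun q := isEmptyElim q.1
  injOn q := isEmptyElim q.1
  isLocalDiffeomorphOn q := isEmptyElim q.1.1

/-- A collar in the first summand of a disjoint union. -/
abbrev inl (θ : BoundaryCollar p N W) : BoundaryCollar p N (W ⊕ W') :=
  θ.postcomp Sum.inl (fun _ _ => isLocalDiffeomorphAt_inl _) Sum.inl_injective.injOn

/-- A collar in the second summand of a disjoint union. -/
abbrev inr (θ : BoundaryCollar p N W') : BoundaryCollar p N (W ⊕ W') :=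
  θ.postcomp Sum.inr (fun _ _ => isLocalDiffeomorphAt_inr _) Sum.inr_injective.injOn

theorem disjoint_inl_inr (θ : BoundaryCollar p N W) (θ' : BoundaryCollar p N' W') :
    Disjoint ((θ.inl (W' := W')).toFun '' collarDomain N)
      ((θ'.inr (W := W)).toFun '' collarDomain N') :=
  disjoint_image_inl_inr _ _ _ _

variable [IsManifold (𝓡 p) 1 N] [IsManifold (𝓡 p) 1 N'] [IsManifold (collarModel p) 1 W]
  [IsManifold (collarModel p) 1 W']

theorem orientedJacobian_postcomp (oN : ManifoldOrientation (𝓡 p) N)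
    (oW : ManifoldOrientation (collarModel p) W) (oW' : ManifoldOrientation (collarModel p) W')
    (θ : BoundaryCollar p N W) (g : W → W')
    (hg : ∀ q ∈ collarDomain N,
      IsLocalDiffeomorphAt (collarModel p) (collarModel p) ∞ g (θ.toFun q))
    (hinj : Set.InjOn g (θ.toFun '' collarDomain N)) {q : N × EuclideanHalfSpace 1}
    (hq : q ∈ collarDomain N) :
    (θ.postcomp g hg hinj).orientedJacobian oN oW' q =
      signedJacobian (collarModel p) (collarModel p) oW.sign oW'.sign g (θ.toFun q) *
        θ.orientedJacobian oN oW q := by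
  rw [orientedJacobian_eq, orientedJacobian_eq]
  exact IsLocalDiffeomorphAt.signedJacobian_comp _ _ _ (hg q hq) (θ.isLocalDiffeomorphAt hq)

theorem orientedJacobian_precomp (oN : ManifoldOrientation (𝓡 p) N)
    (oN' : ManifoldOrientation (𝓡 p) N') (oW : ManifoldOrientation (collarModel p) W)
    (θ : BoundaryCollar p N W) (f : N' → N)
    (g : EuclideanHalfSpace 1 → EuclideanHalfSpace 1)
    (hf : ∀ x, IsLocalDiffeomorphAt (𝓡 p) (𝓡 p) ∞ f x)
    (hg : ∀ t : EuclideanHalfSpace 1, t.1 0 < 1 → IsLocalDiffeomorphAt (𝓡∂ 1) (𝓡∂ 1) ∞ g t)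
    (hgd : ∀ t : EuclideanHalfSpace 1, t.1 0 < 1 → (g t).1 0 < 1)
    (hfi : Function.Injective f) (hgi : Function.Injective g) {q : N' × EuclideanHalfSpace 1}
    (hq : q ∈ collarDomain N') :
    (θ.precomp f g hf hg hgd hfi hgi).orientedJacobian oN' oW q =
      θ.orientedJacobian oN oW (Prod.map f g q) *
        (signedJacobian (𝓡 p) (𝓡 p) oN'.sign oN.sign f q.1 * jacobian (𝓡∂ 1) (𝓡∂ 1) g q.2) := by
  rw [← signedJacobian_prodMap_fst _ _ (hf q.1) (hg q.2 hq), orientedJacobian_eq,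
    orientedJacobian_eq]
  exact IsLocalDiffeomorphAt.signedJacobian_comp (f := Prod.map f g) _ (fun q => oN.sign q.1) _
    (θ.isLocalDiffeomorphAt (hgd q.2 hq)) ((hf q.1).prodMap (hg q.2 hq))

/-- Restriction to the summand `N` is composition with `inl × id`, whose signed Jacobian is one. -/
theorem orientedJacobian_sum_inl (oN : ManifoldOrientation (𝓡 p) N)
    (oN' : ManifoldOrientation (𝓡 p) N') (oW : ManifoldOrientation (collarModel p) W)
    (θ : BoundaryCollar p N W) (θ' : BoundaryCollar p N' W)
    (h : Disjoint (θ.toFun '' collarDomain N) (θ'.toFun '' collarDomain N')) {x : N}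
    {t : EuclideanHalfSpace 1} (ht : (x, t) ∈ collarDomain N) :
    (θ.sum θ' h).orientedJacobian (oN.sum oN') oW (Sum.inl x, t) =
      θ.orientedJacobian oN oW (x, t) := by
  have hi : IsLocalDiffeomorphAt (𝓡 p) (𝓡 p) ∞ (Sum.inl : N → N ⊕ N') (x, t).1 :=
    isLocalDiffeomorphAt_inl x
  have ht' : IsLocalDiffeomorphAt (𝓡∂ 1) (𝓡∂ 1) ∞ (fun t : EuclideanHalfSpace 1 => t) (x, t).2 :=
    IsLocalDiffeomorphAt.id t
  have hc := IsLocalDiffeomorphAt.signedJacobian_comp (f := Prod.map Sum.inl fun t => t)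
    (x := (x, t)) (fun q => oN.sign q.1) (fun q => (oN.sum oN').sign q.1) oW.sign
    ((θ.sum θ' h).isLocalDiffeomorphAt (q := (Sum.inl x, t)) ht) (hi.prodMap ht')
  rw [signedJacobian_prodMap_fst _ _ hi ht', jacobian_id] at hc
  have hs : signedJacobian (𝓡 p) (𝓡 p) oN.sign (oN.sum oN').sign Sum.inl x = 1 :=
    signedJacobian_inl _ _ _
  rw [hs, mul_one, mul_one] at hc
  exact hc.symm

theorem orientedJacobian_sum_inr (oN : ManifoldOrientation (𝓡 p) N)
    (oN' : ManifoldOrientation (𝓡 p) N') (oW : ManifoldOrientation (collarModel p) W)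
    (θ : BoundaryCollar p N W) (θ' : BoundaryCollar p N' W)
    (h : Disjoint (θ.toFun '' collarDomain N) (θ'.toFun '' collarDomain N')) {x : N'}
    {t : EuclideanHalfSpace 1} (ht : (x, t) ∈ collarDomain N') :
    (θ.sum θ' h).orientedJacobian (oN.sum oN') oW (Sum.inr x, t) =
      θ'.orientedJacobian oN' oW (x, t) := by
  have hi : IsLocalDiffeomorphAt (𝓡 p) (𝓡 p) ∞ (Sum.inr : N' → N ⊕ N') (x, t).1 :=
    isLocalDiffeomorphAt_inr x
  have ht' : IsLocalDiffeomorphAt (𝓡∂ 1) (𝓡∂ 1) ∞ (fun t : EuclideanHalfSpace 1 => t) (x, t).2 :=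
    IsLocalDiffeomorphAt.id t
  have hc := IsLocalDiffeomorphAt.signedJacobian_comp (f := Prod.map Sum.inr fun t => t)
    (x := (x, t)) (fun q => oN'.sign q.1) (fun q => (oN.sum oN').sign q.1) oW.sign
    ((θ.sum θ' h).isLocalDiffeomorphAt (q := (Sum.inr x, t)) ht) (hi.prodMap ht')
  rw [signedJacobian_prodMap_fst _ _ hi ht', jacobian_id] at hc
  have hs : signedJacobian (𝓡 p) (𝓡 p) oN'.sign (oN.sum oN').sign Sum.inr x = 1 :=
    signedJacobian_inr _ _ _
  rw [hs, mul_one, mul_one] at hc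
  exact hc.symm

theorem orientedJacobian_inl (oN : ManifoldOrientation (𝓡 p) N)
    (oW : ManifoldOrientation (collarModel p) W) (oW' : ManifoldOrientation (collarModel p) W')
    (θ : BoundaryCollar p N W) {q : N × EuclideanHalfSpace 1} (hq : q ∈ collarDomain N) :
    (θ.inl (W' := W')).orientedJacobian oN (oW.sum oW') q = θ.orientedJacobian oN oW q := by
  rw [orientedJacobian_postcomp oN oW _ _ _ _ _ hq]
  have hs : signedJacobian (collarModel p) (collarModel p) oW.sign (oW.sum oW').sign Sum.inl
    (θ.toFun q) = 1 := signedJacobian_inl _ _ _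
  rw [hs, one_mul]

theorem orientedJacobian_inr (oN : ManifoldOrientation (𝓡 p) N)
    (oW : ManifoldOrientation (collarModel p) W) (oW' : ManifoldOrientation (collarModel p) W')
    (θ : BoundaryCollar p N W') {q : N × EuclideanHalfSpace 1} (hq : q ∈ collarDomain N) :
    (θ.inr (W := W)).orientedJacobian oN (oW.sum oW') q = θ.orientedJacobian oN oW' q := by
  rw [orientedJacobian_postcomp oN oW' _ _ _ _ _ hq]
  have hs : signedJacobian (collarModel p) (collarModel p) oW'.sign (oW.sum oW').sign Sum.inr
    (θ.toFun q) = 1 := signedJacobian_inr _ _ _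
  rw [hs, one_mul]

end BoundaryCollar

end CollarOperations

/-! ### Oriented bordisms: reversal and disjoint union. -/

section Bordant

variable {p : ℕ}

section

variable {N₀ N₁ N₀' N₁' : Type*}
  [TopologicalSpace N₀] [ChartedSpace (EuclideanSpace ℝ (Fin p)) N₀] [IsManifold (𝓡 p) 1 N₀]
  [TopologicalSpace N₁] [ChartedSpace (EuclideanSpace ℝ (Fin p)) N₁] [IsManifold (𝓡 p) 1 N₁]
  [TopologicalSpace N₀'] [ChartedSpace (EuclideanSpace ℝ (Fin p)) N₀'] [IsManifold (𝓡 p) 1 N₀']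
  [TopologicalSpace N₁'] [ChartedSpace (EuclideanSpace ℝ (Fin p)) N₁'] [IsManifold (𝓡 p) 1 N₁']
  {o₀ : ManifoldOrientation (𝓡 p) N₀} {o₁ : ManifoldOrientation (𝓡 p) N₁}
  {o₀' : ManifoldOrientation (𝓡 p) N₀'} {o₁' : ManifoldOrientation (𝓡 p) N₁'}

instance (b : OrientedBordism p N₀ N₁ o₀ o₁) : IsManifold (collarModel p) ∞ b.W := b.isManifoldW

instance (b : OrientedBordism p N₀ N₁ o₀ o₁) : CompactSpace b.W := b.compactW

instance (b : OrientedBordism p N₀ N₁ o₀ o₁) : T2Space b.W := b.t2W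

/-- The bordism with the opposite orientation and direction. -/
def OrientedBordism.symm (b : OrientedBordism p N₀ N₁ o₀ o₁) :
    OrientedBordism p N₁ N₀ o₁ o₀ where
  W := b.W
  orientation := b.orientation.neg
  collar₀ := b.collar₁
  collar₁ := b.collar₀
  disjoint_collars := b.disjoint_collars.symm
  boundary_eq := b.boundary_eq.trans (Set.union_comm _ _)
  preserves₀ q hq := by
    have h := b.reverses₁ q hq
    rw [BoundaryCollar.orientedJacobian_eq] at h ⊢
    exact (neg_pos.2 h).trans_eq (signedJacobian_neg_right _ b.orientation.sign _ _).symm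
  reverses₁ q hq := by
    have h := b.preserves₀ q hq
    rw [BoundaryCollar.orientedJacobian_eq] at h ⊢
    exact (signedJacobian_neg_right _ b.orientation.sign _ _).trans_lt (neg_neg_of_pos h)

theorem BoundaryCollar.image_sum {N N' W : Type*}
    [TopologicalSpace N] [ChartedSpace (EuclideanSpace ℝ (Fin p)) N]
    [TopologicalSpace N'] [ChartedSpace (EuclideanSpace ℝ (Fin p)) N'] [TopologicalSpace W]
    [ChartedSpace (ModelProd (EuclideanSpace ℝ (Fin p)) (EuclideanHalfSpace 1)) W]
    (θ : BoundaryCollar p N W) (θ' : BoundaryCollar p N' W)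
    (h : Disjoint (θ.toFun '' collarDomain N) (θ'.toFun '' collarDomain N')) :
    (θ.sum θ' h).toFun '' collarDomain (N ⊕ N') =
      θ.toFun '' collarDomain N ∪ θ'.toFun '' collarDomain N' := by
  ext w
  constructor
  · rintro ⟨⟨x | x, t⟩, ht, rfl⟩
    · exact Or.inl ⟨(x, t), ht, rfl⟩
    · exact Or.inr ⟨(x, t), ht, rfl⟩
  · rintro (⟨⟨x, t⟩, ht, rfl⟩ | ⟨⟨x, t⟩, ht, rfl⟩)
    · exact ⟨(Sum.inl x, t), ht, rfl⟩
    · exact ⟨(Sum.inr x, t), ht, rfl⟩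

theorem BoundaryCollar.range_base_sum {N N' W : Type*}
    [TopologicalSpace N] [ChartedSpace (EuclideanSpace ℝ (Fin p)) N]
    [TopologicalSpace N'] [ChartedSpace (EuclideanSpace ℝ (Fin p)) N'] [TopologicalSpace W]
    [ChartedSpace (ModelProd (EuclideanSpace ℝ (Fin p)) (EuclideanHalfSpace 1)) W]
    (θ : BoundaryCollar p N W) (θ' : BoundaryCollar p N' W)
    (h : Disjoint (θ.toFun '' collarDomain N) (θ'.toFun '' collarDomain N')) :
    Set.range (θ.sum θ' h).base = Set.range θ.base ∪ Set.range θ'.base := by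
  ext w
  simp only [Set.mem_range, Set.mem_union, Sum.exists]
  rfl

/-- The disjoint union of bordisms. -/
def OrientedBordism.sum (b : OrientedBordism p N₀ N₁ o₀ o₁)
    (b' : OrientedBordism p N₀' N₁' o₀' o₁') :
    OrientedBordism p (N₀ ⊕ N₀') (N₁ ⊕ N₁') (o₀.sum o₀') (o₁.sum o₁') where
  W := b.W ⊕ b'.W
  orientation := b.orientation.sum b'.orientation
  collar₀ := b.collar₀.inl.sum b'.collar₀.inr (BoundaryCollar.disjoint_inl_inr _ _)
  collar₁ := b.collar₁.inl.sum b'.collar₁.inr (BoundaryCollar.disjoint_inl_inr _ _)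
  disjoint_collars := by
    rw [BoundaryCollar.image_sum, BoundaryCollar.image_sum, Set.disjoint_union_left,
      Set.disjoint_union_right, Set.disjoint_union_right]
    exact ⟨⟨disjoint_image_comp Sum.inl_injective b.disjoint_collars,
      disjoint_image_inl_inr _ _ _ _⟩, (disjoint_image_inl_inr _ _ _ _).symm,
      disjoint_image_comp Sum.inr_injective b'.disjoint_collars⟩
  boundary_eq := by
    rw [BoundaryCollar.range_base_sum, BoundaryCollar.range_base_sum,
      ModelWithCorners.boundary_disjointUnion, b.boundary_eq, b'.boundary_eq, Set.image_union,
      Set.image_union, ← Set.range_comp, ← Set.range_comp, ← Set.range_comp, ← Set.range_comp]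
    exact Set.union_union_union_comm _ _ _ _
  preserves₀ := by
    rintro ⟨x | x, t⟩ ht
    · have ht' : (x, t) ∈ collarDomain N₀ := ht
      rw [BoundaryCollar.orientedJacobian_sum_inl _ _ _ _ _ _ ht',
        BoundaryCollar.orientedJacobian_inl _ _ _ _ ht']
      exact b.preserves₀ (x, t) ht
    · have ht' : (x, t) ∈ collarDomain N₀' := ht
      rw [BoundaryCollar.orientedJacobian_sum_inr _ _ _ _ _ _ ht',
        BoundaryCollar.orientedJacobian_inr _ _ _ _ ht']
      exact b'.preserves₀ (x, t) ht
  reverses₁ := by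
    rintro ⟨x | x, t⟩ ht
    · have ht' : (x, t) ∈ collarDomain N₁ := ht
      rw [BoundaryCollar.orientedJacobian_sum_inl _ _ _ _ _ _ ht',
        BoundaryCollar.orientedJacobian_inl _ _ _ _ ht']
      exact b.reverses₁ (x, t) ht
    · have ht' : (x, t) ∈ collarDomain N₁' := ht
      rw [BoundaryCollar.orientedJacobian_sum_inr _ _ _ _ _ _ ht',
        BoundaryCollar.orientedJacobian_inr _ _ _ _ ht']
      exact b'.reverses₁ (x, t) ht

/-- Two maps from closed oriented manifolds to a space are bordant if they extend to an oriented
bordism. -/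
def BordantMaps {E : Type*} [TopologicalSpace E] (o₀ : ManifoldOrientation (𝓡 p) N₀)
    (o₁ : ManifoldOrientation (𝓡 p) N₁) (s₀ : N₀ → E) (s₁ : N₁ → E) : Prop :=
  ∃ (b : OrientedBordism p N₀ N₁ o₀ o₁) (Φ : C(b.W, E)),
    (∀ x, Φ (b.collar₀.base x) = s₀ x) ∧ ∀ x, Φ (b.collar₁.base x) = s₁ x

variable {E : Type*} [TopologicalSpace E] {s₀ : N₀ → E} {s₁ : N₁ → E} {s₀' : N₀' → E}
  {s₁' : N₁' → E}

theorem BordantMaps.symm (h : BordantMaps o₀ o₁ s₀ s₁) : BordantMaps o₁ o₀ s₁ s₀ :=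
  let ⟨b, Φ, h₀, h₁⟩ := h
  ⟨b.symm, Φ, h₁, h₀⟩

theorem BordantMaps.sum (h : BordantMaps o₀ o₁ s₀ s₁) (h' : BordantMaps o₀' o₁' s₀' s₁') :
    BordantMaps (o₀.sum o₀') (o₁.sum o₁') (Sum.elim s₀ s₀') (Sum.elim s₁ s₁') := by
  obtain ⟨b, Φ, h₀, h₁⟩ := h
  obtain ⟨b', Φ', h₀', h₁'⟩ := h'
  refine ⟨b.sum b', ⟨Sum.elim Φ Φ', Φ.continuous.sumElim Φ'.continuous⟩, ?_, ?_⟩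
  · rintro (x | x)
    exacts [h₀ x, h₀' x]
  · rintro (x | x)
    exacts [h₁ x, h₁' x]

end

/-! ### Cylinders as bordisms. -/

section Cylinder

/-- The standard collar of the lower end of `[0, 1]`. -/
def intervalCollarBot : EuclideanHalfSpace 1 → Set.Icc (0 : ℝ) 1 :=
  (IccLeftChart (0 : ℝ) 1).symm ∘ halfLineHalve

/-- The standard collar of the upper end of `[0, 1]`. -/
def intervalCollarTop : EuclideanHalfSpace 1 → Set.Icc (0 : ℝ) 1 :=
  (IccRightChart (0 : ℝ) 1).symm ∘ halfLineHalve

/-- The factor `1/2` keeps the two collars apart: their images are `[0, 1/2)` and `(1/2, 1]`. -/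
theorem intervalCollarBot_coe {t : EuclideanHalfSpace 1} (ht : t.1 0 < 1) :
    (intervalCollarBot t : ℝ) = t.1 0 / 2 := by
  have h := halfLineHalve_coord t
  rw [intervalCollarBot, Function.comp_apply, IccLeftChart_symm_apply, Subtype.coe_mk, h,
    min_eq_left] <;> linarith

theorem intervalCollarTop_coe {t : EuclideanHalfSpace 1} (ht : t.1 0 < 1) :
    (intervalCollarTop t : ℝ) = 1 - t.1 0 / 2 := by
  have h := halfLineHalve_coord t
  rw [intervalCollarTop, Function.comp_apply, IccRightChart_symm_apply, Subtype.coe_mk, h,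
    max_eq_left]
  linarith

theorem halfLineHalve_mem_left {t : EuclideanHalfSpace 1} (ht : t.1 0 < 1) :
    halfLineHalve t ∈ (IccLeftChart (0 : ℝ) 1).target := by
  have h := halfLineHalve_coord t
  change (halfLineHalve t).1 0 < 1 - 0
  linarith

theorem halfLineHalve_mem_right {t : EuclideanHalfSpace 1} (ht : t.1 0 < 1) :
    halfLineHalve t ∈ (IccRightChart (0 : ℝ) 1).target := by
  have h := halfLineHalve_coord t
  change (halfLineHalve t).1 0 < 1 - 0
  linarith

theorem isLocalDiffeomorphAt_symm {E H M : Type*} [NormedAddCommGroup E] [NormedSpace ℝ E]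
    [TopologicalSpace H] {I : ModelWithCorners ℝ E H} [TopologicalSpace M] [ChartedSpace H M]
    {e : OpenPartialHomeomorph M H} {y : H} (hy : y ∈ e.target)
    (he : IsLocalDiffeomorphAt I I ∞ e (e.symm y)) : IsLocalDiffeomorphAt I I ∞ e.symm y := by
  have h := he.of_comp (K := I) (g := e.symm) ((IsLocalDiffeomorphAt.id _).congr
    (e.eventually_left_inverse (e.map_target hy)))
  rwa [e.right_inv hy] at h

theorem signedJacobian_symm {E H M : Type*} [NormedAddCommGroup E] [NormedSpace ℝ E]
    [TopologicalSpace H] {I : ModelWithCorners ℝ E H} [TopologicalSpace M] [ChartedSpace H M]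
    {e : OpenPartialHomeomorph M H} {y : H} (hy : y ∈ e.target) (s : M → ℤˣ) (t : H → ℤˣ)
    (he : IsLocalDiffeomorphAt I I ∞ e (e.symm y)) :
    signedJacobian I I s t e (e.symm y) * signedJacobian I I t s e.symm y = 1 := by
  rw [← IsLocalDiffeomorphAt.signedJacobian_comp t s t he (isLocalDiffeomorphAt_symm hy he),
    ← signedJacobian_id (I := I) t y]
  exact signedJacobian_congr (e.eventually_right_inverse hy)

theorem isLocalDiffeomorphAt_intervalCollarBot {t : EuclideanHalfSpace 1} (ht : t.1 0 < 1) :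
    IsLocalDiffeomorphAt (𝓡∂ 1) (𝓡∂ 1) ∞ intervalCollarBot t :=
  (isLocalDiffeomorphAt_halfLineHalve t).comp _ _ (isLocalDiffeomorphAt_symm
    (halfLineHalve_mem_left ht) (isLocalDiffeomorphAt_IccLeftChart
      ((IccLeftChart (0 : ℝ) 1).map_target (halfLineHalve_mem_left ht))))

theorem isLocalDiffeomorphAt_intervalCollarTop {t : EuclideanHalfSpace 1} (ht : t.1 0 < 1) :
    IsLocalDiffeomorphAt (𝓡∂ 1) (𝓡∂ 1) ∞ intervalCollarTop t :=
  (isLocalDiffeomorphAt_halfLineHalve t).comp _ _ (isLocalDiffeomorphAt_symm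
    (halfLineHalve_mem_right ht) (isLocalDiffeomorphAt_IccRightChart
      ((IccRightChart (0 : ℝ) 1).map_target (halfLineHalve_mem_right ht))))

theorem signedJacobian_intervalCollarBot {t : EuclideanHalfSpace 1} (ht : t.1 0 < 1) :
    0 < signedJacobian (𝓡∂ 1) (𝓡∂ 1) (fun _ => 1) unitIntervalSign intervalCollarBot t := by
  have hm := (IccLeftChart (0 : ℝ) 1).map_target (halfLineHalve_mem_left ht)
  have hd := isLocalDiffeomorphAt_IccLeftChart hm
  have h := signedJacobian_symm (halfLineHalve_mem_left ht) unitIntervalSign (fun _ => 1) hd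
  rw [signedJacobian_IccLeftChart hm, one_mul] at h
  rw [intervalCollarBot, IsLocalDiffeomorphAt.signedJacobian_comp _ (fun _ => 1) _
    (isLocalDiffeomorphAt_symm (halfLineHalve_mem_left ht) hd)
    (isLocalDiffeomorphAt_halfLineHalve t), h]
  simp [signedJacobian, jacobian_halfLineHalve]

/-- At the upper end the inward direction is the decreasing one; this is the sign in `∂(N × I) = N ⊔
-N`. -/
theorem signedJacobian_intervalCollarTop {t : EuclideanHalfSpace 1} (ht : t.1 0 < 1) :
    signedJacobian (𝓡∂ 1) (𝓡∂ 1) (fun _ => 1) unitIntervalSign intervalCollarTop t < 0 := by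
  have hm := (IccRightChart (0 : ℝ) 1).map_target (halfLineHalve_mem_right ht)
  have hd := isLocalDiffeomorphAt_IccRightChart hm
  have h := signedJacobian_symm (halfLineHalve_mem_right ht) unitIntervalSign (fun _ => 1) hd
  rw [signedJacobian_IccRightChart hm, neg_one_mul] at h
  rw [intervalCollarTop, IsLocalDiffeomorphAt.signedJacobian_comp _ (fun _ => 1) _
    (isLocalDiffeomorphAt_symm (halfLineHalve_mem_right ht) hd)
    (isLocalDiffeomorphAt_halfLineHalve t), neg_eq_iff_eq_neg.1 h]
  simp [signedJacobian, jacobian_halfLineHalve]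

theorem intervalCollarBot_zero : intervalCollarBot halfLineZero = ⊥ := by
  apply Subtype.ext
  rw [intervalCollarBot_coe (by simp)]
  simp

theorem intervalCollarTop_zero : intervalCollarTop halfLineZero = ⊤ := by
  apply Subtype.ext
  rw [intervalCollarTop_coe (by simp)]
  simp

variable {N : Type*} [TopologicalSpace N] [ChartedSpace (EuclideanSpace ℝ (Fin p)) N]

/-- The standard collar of the lower end of the cylinder `N × [0, 1]`. -/
def cylinderCollarBot : BoundaryCollar p N (N × Set.Icc (0 : ℝ) 1) where
  toFun := Prod.map (fun x => x) intervalCollarBot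
  injOn := by
    rintro ⟨x, t⟩ ht ⟨y, u⟩ hu h
    obtain ⟨h₁, h₂⟩ := Prod.ext_iff.1 h
    refine Prod.ext h₁ (halfLine_ext ?_)
    have h₃ := congrArg Subtype.val h₂
    simp only [Prod.map_snd] at h₃
    rw [intervalCollarBot_coe ht, intervalCollarBot_coe hu] at h₃
    dsimp only
    linarith
  isLocalDiffeomorphOn q :=
    (IsLocalDiffeomorphAt.id q.1.1).prodMap (isLocalDiffeomorphAt_intervalCollarBot q.2)

/-- The standard collar of the upper end of the cylinder `N × [0, 1]`. -/
def cylinderCollarTop : BoundaryCollar p N (N × Set.Icc (0 : ℝ) 1) where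
  toFun := Prod.map (fun x => x) intervalCollarTop
  injOn := by
    rintro ⟨x, t⟩ ht ⟨y, u⟩ hu h
    obtain ⟨h₁, h₂⟩ := Prod.ext_iff.1 h
    refine Prod.ext h₁ (halfLine_ext ?_)
    have h₃ := congrArg Subtype.val h₂
    simp only [Prod.map_snd] at h₃
    rw [intervalCollarTop_coe ht, intervalCollarTop_coe hu] at h₃
    dsimp only
    linarith
  isLocalDiffeomorphOn q :=
    (IsLocalDiffeomorphAt.id q.1.1).prodMap (isLocalDiffeomorphAt_intervalCollarTop q.2)

theorem disjoint_cylinderCollars :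
    Disjoint ((cylinderCollarBot (p := p) (N := N)).toFun '' collarDomain N)
      ((cylinderCollarTop (p := p) (N := N)).toFun '' collarDomain N) := by
  rw [Set.disjoint_left]
  rintro _ ⟨⟨x, t⟩, ht, rfl⟩ ⟨⟨y, u⟩, hu, h⟩
  have h₃ := congrArg (fun q => (q.2 : ℝ)) h
  simp only [cylinderCollarBot, cylinderCollarTop, Prod.map_snd] at h₃
  rw [intervalCollarTop_coe hu, intervalCollarBot_coe ht] at h₃
  have ht' : t.1 0 < 1 := ht
  have hu' : u.1 0 < 1 := hu
  linarith

theorem cylinderCollarBot_base (x : N) : (cylinderCollarBot (p := p)).base x = (x, ⊥) :=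
  Prod.ext rfl intervalCollarBot_zero

theorem cylinderCollarTop_base (x : N) : (cylinderCollarTop (p := p)).base x = (x, ⊤) :=
  Prod.ext rfl intervalCollarTop_zero

theorem boundary_cylinder [IsManifold (𝓡 p) ∞ N] [BoundarylessManifold (𝓡 p) N] :
    (collarModel p).boundary (N × Set.Icc (0 : ℝ) 1) =
      Set.range (cylinderCollarBot (p := p) (N := N)).base ∪
        Set.range (cylinderCollarTop (p := p) (N := N)).base := by
  rw [boundary_product]
  ext ⟨x, t⟩
  simp only [Set.mem_union, Set.mem_range, cylinderCollarBot_base, cylinderCollarTop_base,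
    Prod.mk.injEq, exists_eq_left]
  simp [Set.prod, eq_comm]

theorem orientedJacobian_cylinderCollarBot [IsManifold (𝓡 p) 1 N]
    (o : ManifoldOrientation (𝓡 p) N) {q : N × EuclideanHalfSpace 1} (hq : q ∈ collarDomain N) :
    0 < cylinderCollarBot.orientedJacobian o (o.prod unitIntervalOrientation) q := by
  have h := signedJacobian_prodMap (q := q) o.sign o.sign (fun _ => 1) unitIntervalSign
    ((IsLocalDiffeomorphAt.id (I := 𝓡 p) (n := ∞) q.1).mdifferentiableAt (by simp))
    ((isLocalDiffeomorphAt_intervalCollarBot hq).mdifferentiableAt (by simp))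
  simp only [mul_one] at h
  rw [signedJacobian_id, one_mul] at h
  exact (signedJacobian_intervalCollarBot hq).trans_eq h.symm

theorem orientedJacobian_cylinderCollarTop [IsManifold (𝓡 p) 1 N]
    (o : ManifoldOrientation (𝓡 p) N) {q : N × EuclideanHalfSpace 1} (hq : q ∈ collarDomain N) :
    cylinderCollarTop.orientedJacobian o (o.prod unitIntervalOrientation) q < 0 := by
  have h := signedJacobian_prodMap (q := q) o.sign o.sign (fun _ => 1) unitIntervalSign
    ((IsLocalDiffeomorphAt.id (I := 𝓡 p) (n := ∞) q.1).mdifferentiableAt (by simp))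
    ((isLocalDiffeomorphAt_intervalCollarTop hq).mdifferentiableAt (by simp))
  simp only [mul_one] at h
  rw [signedJacobian_id, one_mul] at h
  exact h.trans_lt (signedJacobian_intervalCollarTop hq)

end Cylinder

section CylinderBordism

variable {N N' : Type} [TopologicalSpace N] [ChartedSpace (EuclideanSpace ℝ (Fin p)) N]
  [TopologicalSpace N'] [ChartedSpace (EuclideanSpace ℝ (Fin p)) N']
  [IsManifold (𝓡 p) 1 N'] [IsManifold (𝓡 p) ∞ N] [CompactSpace N] [T2Space N]
  [BoundarylessManifold (𝓡 p) N]

/-- The cylinder of an orientation preserving diffeomorphism. -/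
def OrientedBordism.cylinder (o : ManifoldOrientation (𝓡 p) N) (o' : ManifoldOrientation (𝓡 p) N')
    (φ : Diffeomorph (𝓡 p) (𝓡 p) N' N ∞)
    (hφ : ∀ x, 0 < signedJacobian (𝓡 p) (𝓡 p) o'.sign o.sign φ x) :
    OrientedBordism p N' N o' o where
  W := N × Set.Icc (0 : ℝ) 1
  orientation := o.prod unitIntervalOrientation
  collar₀ := cylinderCollarBot.precomp φ id φ.isLocalDiffeomorphAt
    (fun _ _ => isLocalDiffeomorphAt_id _) (fun _ h => h) φ.injective Function.injective_id
  collar₁ := cylinderCollarTop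
  disjoint_collars := by
    refine disjoint_cylinderCollars.mono_left ?_
    rintro _ ⟨q, hq, rfl⟩
    exact ⟨(φ q.1, q.2), hq, rfl⟩
  boundary_eq := by
    rw [boundary_cylinder]
    congr 1
    exact (φ.surjective.range_comp _).symm
  preserves₀ q hq := by
    rw [BoundaryCollar.orientedJacobian_precomp o _ _ _ _ _ _ _ _ _ _ hq]
    refine mul_pos (orientedJacobian_cylinderCollarBot o hq) (mul_pos (hφ _) ?_)
    exact one_pos.trans_eq (jacobian_id q.2).symm
  reverses₁ _ := orientedJacobian_cylinderCollarTop o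

variable {E : Type*} [TopologicalSpace E]

/-- The map `s` is extended to the cylinder independently of the height, and `φ` reparametrises the
lower collar. Reflexivity, associativity, the zero law and commutativity are all instances. -/
theorem BordantMaps.of_diffeomorph {o : ManifoldOrientation (𝓡 p) N}
    {o' : ManifoldOrientation (𝓡 p) N'} (φ : Diffeomorph (𝓡 p) (𝓡 p) N' N ∞)
    (hφ : ∀ x, 0 < signedJacobian (𝓡 p) (𝓡 p) o'.sign o.sign φ x) {s : N → E} {s' : N' → E}
    (hs : Continuous s) (h : ∀ x, s (φ x) = s' x) : BordantMaps o' o s' s :=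
  ⟨.cylinder o o' φ hφ, ⟨fun q : N × Set.Icc (0 : ℝ) 1 => s q.1, hs.comp continuous_fst⟩, h,
    fun _ => rfl⟩

theorem BordantMaps.refl (o : ManifoldOrientation (𝓡 p) N) {s : N → E} (hs : Continuous s) :
    BordantMaps o o s s :=
  .of_diffeomorph (Diffeomorph.refl (𝓡 p) N ∞)
    (fun x => one_pos.trans_eq (signedJacobian_id o.sign x).symm) hs fun _ => rfl

/-- The cylinder, as a bordism from two copies of the manifold with opposite orientations to the
empty manifold. -/
def OrientedBordism.bentCylinder [IsEmpty N'] (o : ManifoldOrientation (𝓡 p) N)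
    (o' : ManifoldOrientation (𝓡 p) N') : OrientedBordism p (N ⊕ N) N' (o.sum o.neg) o' where
  W := N × Set.Icc (0 : ℝ) 1
  orientation := o.prod unitIntervalOrientation
  collar₀ := cylinderCollarBot.sum cylinderCollarTop disjoint_cylinderCollars
  collar₁ := .ofIsEmpty
  disjoint_collars := by
    rw [Set.disjoint_right]
    rintro _ ⟨q, _⟩
    exact isEmptyElim q.1
  boundary_eq := by
    rw [BoundaryCollar.range_base_sum, Set.range_eq_empty (BoundaryCollar.base _ : N' → _),
      Set.union_empty, boundary_cylinder]
  preserves₀ := by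
    rintro ⟨x | x, t⟩ ht
    · have ht' : (x, t) ∈ collarDomain N := ht
      rw [BoundaryCollar.orientedJacobian_sum_inl _ _ _ _ _ _ ht']
      exact orientedJacobian_cylinderCollarBot o (q := (x, t)) ht
    · have ht' : (x, t) ∈ collarDomain N := ht
      rw [BoundaryCollar.orientedJacobian_sum_inr _ _ _ _ _ _ ht']
      -- The upper collar reverses `o`, hence preserves `o.neg`; so both ends can serve as incoming
      -- boundary.
      have h := orientedJacobian_cylinderCollarTop o (q := (x, t)) ht
      rw [BoundaryCollar.orientedJacobian_eq] at h ⊢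
      exact (neg_pos.2 h).trans_eq (signedJacobian_neg_left
        (fun q : N × EuclideanHalfSpace 1 => o.sign q.1) _ _ _).symm
  reverses₁ := fun q => isEmptyElim q.1

theorem BordantMaps.add_neg [IsEmpty N'] (o : ManifoldOrientation (𝓡 p) N)
    (o' : ManifoldOrientation (𝓡 p) N') {s : N → E} (hs : Continuous s) {s' : N' → E} :
    BordantMaps (o.sum o.neg) o' (Sum.elim s s) s' := by
  refine ⟨.bentCylinder o o', ⟨fun q : N × Set.Icc (0 : ℝ) 1 => s q.1, hs.comp continuous_fst⟩,
    ?_, fun x => isEmptyElim x⟩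
  rintro (x | x) <;> rfl

end CylinderBordism

end Bordant

/-! ### Manifold structures transported by local homeomorphisms. -/

section LocallyModelled

variable {E H : Type*} [NormedAddCommGroup E] [NormedSpace ℝ E] [TopologicalSpace H]
  {I : ModelWithCorners ℝ E H} {M W : Type*} [TopologicalSpace M] [ChartedSpace H M]
  [TopologicalSpace W] [ChartedSpace H W]

/-- The charts of `W` are those of `M`, transported by the local homeomorphisms `e w`. -/
structure IsLocallyModelled (H : Type*) [TopologicalSpace H] {M W : Type*} [TopologicalSpace M]
    [ChartedSpace H M] [TopologicalSpace W] [ChartedSpace H W]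
    (e : W → OpenPartialHomeomorph W M) : Prop where
  mem_source : ∀ w, w ∈ (e w).source
  chartAt_eq : ∀ w, chartAt H w = (e w).trans (chartAt H (e w w))
  atlas_eq : ∀ c ∈ atlas H W, ∃ w, c = chartAt H w

/-- The transition maps of the local homeomorphisms `e w` are local diffeomorphisms. -/
def SmoothTransitions (I : ModelWithCorners ℝ E H) (e : W → OpenPartialHomeomorph W M) : Prop :=
  ∀ w v m, m ∈ ((e w).symm.trans (e v)).source →
    IsLocalDiffeomorphAt I I ∞ ((e w).symm.trans (e v)) m

/-- The charted space whose charts are those of `M`, transported by the local homeomorphisms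
`e w`. -/
abbrev chartedSpaceOfLocalHomeomorphs {H M W : Type*} [TopologicalSpace H] [TopologicalSpace M]
    [ChartedSpace H M] [TopologicalSpace W] (e : W → OpenPartialHomeomorph W M)
    (he : ∀ w, w ∈ (e w).source) : ChartedSpace H W where
  atlas := Set.range fun w => (e w).trans (chartAt H (e w w))
  chartAt w := (e w).trans (chartAt H (e w w))
  mem_chart_source w := ⟨he w, mem_chart_source H (e w w)⟩
  chart_mem_atlas w := ⟨w, rfl⟩

theorem chartAt_isLocalDiffeomorphAt [IsManifold I ∞ M] {x x₀ : M}
    (hx : x ∈ (chartAt H x₀).source) : IsLocalDiffeomorphAt I I ∞ (chartAt H x₀) x :=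
  (chartAt H x₀).isLocalDiffeomorphAt contMDiffOn_chart contMDiffOn_chart_symm hx

variable {e : W → OpenPartialHomeomorph W M}

/-- A change of charts of `W` is an inverse chart of `M`, then a transition map between `e w` and `e
w'`, then a chart of `M`. -/
theorem IsLocallyModelled.isManifold [IsManifold I ∞ M] (he : IsLocallyModelled H e)
    (ht : SmoothTransitions I e) : IsManifold I ∞ W := by
  refine isManifold_of_contDiffOn I ∞ W fun c c' hc hc' => ?_
  obtain ⟨w, rfl⟩ := he.atlas_eq c hc
  obtain ⟨w', rfl⟩ := he.atlas_eq c' hc'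
  rw [← contMDiffOn_iff_contDiffOn, he.chartAt_eq w, he.chartAt_eq w']
  set a := chartAt H (e w w)
  set a' := chartAt H (e w' w')
  rintro y ⟨hy, z, rfl⟩
  rw [Set.mem_preimage, ModelWithCorners.left_inv] at hy
  obtain ⟨⟨hz₁, hz₂⟩, hz₃, hz₄⟩ := hy
  have h₁ : ContMDiffAt I I ∞ a.symm z :=
    contMDiffOn_chart_symm.contMDiffAt (a.open_target.mem_nhds hz₁)
  have h₂ : ContMDiffAt I I ∞ ((e w).symm.trans (e w')) (a.symm z) :=
    (ht w w' _ ⟨hz₂, hz₃⟩).contMDiffAt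
  have h₃ : ContMDiffAt I I ∞ a' ((e w).symm.trans (e w') (a.symm z)) :=
    contMDiffOn_chart.contMDiffAt (a'.open_source.mem_nhds hz₄)
  have h₄ := I.contMDiff.contMDiffAt.comp z (h₃.comp z (h₂.comp z h₁))
  have h₅ : ContMDiffWithinAt 𝓘(ℝ, E) I ∞ I.symm (Set.range I) (I z) :=
    I.contMDiffOn_symm (I z) ⟨z, rfl⟩
  have h₆ := h₄.comp_contMDiffWithinAt_of_eq (x := I z) h₅ (I.left_inv z)
  exact h₆.mono Set.inter_subset_right

variable [IsManifold I ∞ M] [IsManifold I ∞ W]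

/-- Near `w` the map `e w` is the preferred chart at `w` followed by the inverse of the preferred
chart at `e w w`. -/
theorem IsLocallyModelled.isLocalDiffeomorphAt_self (he : IsLocallyModelled H e) (w : W) :
    IsLocalDiffeomorphAt I I ∞ (e w) w := by
  have hc : IsLocalDiffeomorphAt I I ∞ (chartAt H w) w :=
    chartAt_isLocalDiffeomorphAt (mem_chart_source H w)
  have hm : e w w ∈ (chartAt H (e w w)).source := mem_chart_source H (e w w)
  have hs : chartAt H w w = chartAt H (e w w) (e w w) := by rw [he.chartAt_eq w]; rfl
  have ha : IsLocalDiffeomorphAt I I ∞ (chartAt H (e w w)).symm (chartAt H w w) := by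
    rw [hs]
    refine isLocalDiffeomorphAt_symm ((chartAt H (e w w)).map_source hm) ?_
    rw [(chartAt H (e w w)).left_inv hm]
    exact chartAt_isLocalDiffeomorphAt hm
  refine (hc.comp _ _ ha).congr ?_
  have hcont := (e w).continuousAt (he.mem_source w)
  filter_upwards [hcont.preimage_mem_nhds ((chartAt H (e w w)).open_source.mem_nhds hm)] with v hv
  rw [Function.comp_apply, he.chartAt_eq w]
  exact ((chartAt H (e w w)).left_inv hv).symm

/-- Reduces assertions about `e w` at any point `w'` of its source to the transition maps and to `e
w'` at its own base point. -/
theorem eventuallyEq_transition (he : IsLocallyModelled H e) {w w' : W} :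
    e w =ᶠ[nhds w'] (e w').symm.trans (e w) ∘ e w' := by
  filter_upwards [(e w').open_source.mem_nhds (he.mem_source w')] with v hv
  exact congrArg (e w) ((e w').left_inv hv).symm

theorem mem_transition_source (he : IsLocallyModelled H e) {w w' : W} (hw' : w' ∈ (e w).source) :
    e w' w' ∈ ((e w').symm.trans (e w)).source := by
  refine ⟨(e w').map_source (he.mem_source w'), ?_⟩
  change (e w').symm (e w' w') ∈ (e w).source
  rwa [(e w').left_inv (he.mem_source w')]

theorem IsLocallyModelled.isLocalDiffeomorphAt (he : IsLocallyModelled H e)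
    (ht : SmoothTransitions I e) {w w' : W} (hw' : w' ∈ (e w).source) :
    IsLocalDiffeomorphAt I I ∞ (e w) w' :=
  ((he.isLocalDiffeomorphAt_self w').comp _ _
    (ht w' w _ (mem_transition_source he hw'))).congr (eventuallyEq_transition he)

/-- The preferred chart at `w` is `e w` followed by the preferred chart at `e w w`, and both charts
have Jacobian one at their base points; the signs agree by the choice of the sign on `W`. -/
theorem IsLocallyModelled.signedJacobian_self (he : IsLocallyModelled H e)
    (s : M → ℤˣ) (w : W) :
    signedJacobian I I (fun w => s (e w w)) s (e w) w = 1 := by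
  have hm : e w w ∈ (chartAt H (e w w)).source := mem_chart_source H (e w w)
  have h₁ := jacobian_chartAt_self (I := I) w
  rw [he.chartAt_eq w] at h₁
  have h₂ := jacobian_comp (I := I) (J := I) (K := I) (f := e w) (g := chartAt H (e w w)) (x := w)
    ((chartAt_isLocalDiffeomorphAt (I := I) hm).mdifferentiableAt (by simp))
    ((he.isLocalDiffeomorphAt_self w).mdifferentiableAt (by simp))
  rw [jacobian_chartAt_self, one_mul] at h₂
  unfold signedJacobian
  rw [← h₂, units_cast_mul_self, one_mul]
  exact h₁

theorem IsLocallyModelled.signedJacobian_pos (he : IsLocallyModelled H e)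
    (ht : SmoothTransitions I e) {s : M → ℤˣ}
    (hs : ∀ w w' m, m ∈ ((e w).symm.trans (e w')).source →
      0 < signedJacobian I I s s ((e w).symm.trans (e w')) m) {w w' : W}
    (hw' : w' ∈ (e w).source) :
    0 < signedJacobian I I (fun w => s (e w w)) s (e w) w' := by
  rw [signedJacobian_congr (eventuallyEq_transition he), IsLocalDiffeomorphAt.signedJacobian_comp _
    s _ (ht w' w _ (mem_transition_source he hw')) (he.isLocalDiffeomorphAt_self w'),
    he.signedJacobian_self, mul_one]
  exact hs w' w _ (mem_transition_source he hw')

/-- The orientation transported by local homeomorphisms with orientation preserving transition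
maps. -/
def IsLocallyModelled.orientation (he : IsLocallyModelled H e)
    (ht : SmoothTransitions I e) (o : ManifoldOrientation I M)
    (hs : ∀ w w' m, m ∈ ((e w).symm.trans (e w')).source →
      0 < signedJacobian I I o.sign o.sign ((e w).symm.trans (e w')) m) :
    ManifoldOrientation I W :=
  .ofSignedJacobian (fun w => o.sign (e w w)) (by
    intro w₀
    have hcont := (e w₀).continuousAt (he.mem_source w₀)
    filter_upwards [hcont.eventually (o.signedJacobian_chartAt_pos (e w₀ w₀)),
      hcont.preimage_mem_nhds (chart_source_mem_nhds H (e w₀ w₀)),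
      (e w₀).open_source.mem_nhds (he.mem_source w₀)] with w hw hw' hw''
    rw [he.chartAt_eq w₀]
    have h := IsLocalDiffeomorphAt.signedJacobian_comp (f := e w₀) (g := chartAt H (e w₀ w₀))
      (x := w) (fun w => o.sign (e w w)) o.sign (fun _ => o.sign (e w₀ w₀))
      (chartAt_isLocalDiffeomorphAt (I := I) hw') (he.isLocalDiffeomorphAt ht hw'')
    exact (mul_pos hw (he.signedJacobian_pos ht hs hw'')).trans_eq h.symm)

end LocallyModelled

/-! ### The quotient of an oriented manifold by a free partial involution. -/

section Gluing

/-- A free orientation preserving smooth involution `σ` of an open subset `D` of an open subset `U`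
of an oriented manifold, with closed graph in `U × U`. -/
structure GluingInvolution {E H : Type*} [NormedAddCommGroup E] [NormedSpace ℝ E]
    [TopologicalSpace H] (I : ModelWithCorners ℝ E H) {M : Type*} [TopologicalSpace M]
    [ChartedSpace H M] [IsManifold I 1 M] (o : ManifoldOrientation I M) where
  U : Set M
  D : Set M
  σ : M → M
  isOpen_U : IsOpen U
  isOpen_D : IsOpen D
  subset : D ⊆ U
  map_mem : ∀ x ∈ D, σ x ∈ D
  involutive : ∀ x ∈ D, σ (σ x) = x
  free : ∀ x ∈ D, σ x ≠ x
  isLocalDiffeomorphAt : ∀ x ∈ D, IsLocalDiffeomorphAt I I ∞ σ x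
  preserves : ∀ x ∈ D, 0 < signedJacobian I I o.sign o.sign σ x
  isClosed_graph : IsClosed {q : U × U | q.1.1 ∈ D ∧ q.2.1 = σ q.1.1}

namespace GluingInvolution

variable {E H : Type*} [NormedAddCommGroup E] [NormedSpace ℝ E]
    [TopologicalSpace H] {I : ModelWithCorners ℝ E H} {M : Type*} [TopologicalSpace M]
    [ChartedSpace H M] [IsManifold I ∞ M] {o : ManifoldOrientation I M} (G : GluingInvolution I o)

/-- Points of `U` are identified with their images under the involution. -/
def setoid : Setoid G.U where
  r x y := y = x ∨ (x.1 ∈ G.D ∧ y.1 = G.σ x.1)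
  iseqv := by
    refine ⟨fun x => Or.inl rfl, ?_, ?_⟩
    · rintro x y (rfl | ⟨hx, hy⟩)
      · exact Or.inl rfl
      · right
        rw [hy]
        exact ⟨G.map_mem _ hx, (G.involutive _ hx).symm⟩
    · rintro x y z (rfl | ⟨hx, hy⟩) (rfl | ⟨hy', hz⟩)
      · exact Or.inl rfl
      · exact Or.inr ⟨hy', hz⟩
      · exact Or.inr ⟨hx, hy⟩
      · left
        apply Subtype.ext
        rw [hz, hy, G.involutive _ hx]

/-- The manifold obtained by gluing along the involution. -/
def Glued : Type _ := Quotient G.setoid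

instance : TopologicalSpace G.Glued := inferInstanceAs (TopologicalSpace (Quotient G.setoid))

/-- The projection of `U` to the glued manifold. -/
def toGlued (u : G.U) : G.Glued := Quotient.mk G.setoid u

theorem toGlued_surjective : Function.Surjective G.toGlued := Quotient.mk_surjective

theorem continuous_toGlued : Continuous G.toGlued := continuous_quotient_mk'

variable {G} in
theorem toGlued_eq {x y : G.U} : G.toGlued x = G.toGlued y ↔ y = x ∨ (x.1 ∈ G.D ∧ y.1 = G.σ x.1) :=
  Quotient.eq (r := G.setoid)

theorem toGlued_σ {x : M} (hx : x ∈ G.D) :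
    G.toGlued ⟨G.σ x, G.subset (G.map_mem x hx)⟩ = G.toGlued ⟨x, G.subset hx⟩ :=
  (toGlued_eq.2 (Or.inr ⟨hx, rfl⟩)).symm

/-- The saturation of `s` is the union of `s` and `D ∩ σ⁻¹(s)`, and the latter is open because `σ`
is continuous on the open set `D`. -/
theorem isOpenMap_toGlued : IsOpenMap G.toGlued := by
  intro s hs
  change IsOpen (G.toGlued ⁻¹' (G.toGlued '' s))
  have h : G.toGlued ⁻¹' (G.toGlued '' s) =
      s ∪ Subtype.val ⁻¹' (G.D ∩ G.σ ⁻¹' (Subtype.val '' s)) := by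
    ext x
    constructor
    · rintro ⟨y, hy, hxy⟩
      rcases toGlued_eq.1 hxy.symm with rfl | ⟨hx, hyx⟩
      · exact Or.inl hy
      · exact Or.inr ⟨hx, y, hy, hyx⟩
    · rintro (hx | ⟨hx, y, hy, hyx⟩)
      · exact ⟨x, hx, rfl⟩
      · exact ⟨y, hy, (toGlued_eq.2 (Or.inr ⟨hx, hyx⟩)).symm⟩
  rw [h]
  refine hs.union (IsOpen.preimage continuous_subtype_val ?_)
  refine ContinuousOn.isOpen_inter_preimage (fun x hx => ?_) G.isOpen_D
    (G.isOpen_U.isOpenMap_subtype_val s hs)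
  exact (G.isLocalDiffeomorphAt x hx).contMDiffAt.continuousAt.continuousWithinAt

theorem isOpenQuotientMap_toGlued : IsOpenQuotientMap G.toGlued :=
  ⟨G.toGlued_surjective, G.continuous_toGlued, G.isOpenMap_toGlued⟩

/-- An open quotient is Hausdorff exactly when the relation is closed, and here the relation is the
diagonal together with the graph of `σ`. -/
instance [T2Space M] : T2Space G.Glued := by
  rw [t2Space_iff_of_isOpenQuotientMap G.isOpenQuotientMap_toGlued]
  have h : {q : G.U × G.U | G.toGlued q.1 = G.toGlued q.2} =
      Set.diagonal G.U ∪ {q : G.U × G.U | q.1.1 ∈ G.D ∧ q.2.1 = G.σ q.1.1} := by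
    ext ⟨x, y⟩
    simp only [Set.mem_ofPred_eq, toGlued_eq, Set.mem_union, Set.mem_diagonal_iff]
    rw [eq_comm (a := y)]
  rw [h]
  exact isClosed_diagonal.union G.isClosed_graph

/-- Since `σ` has no fixed point, `(u, u)` lies off the closed graph, and so does a square `s × s`
around it. -/
theorem exists_injective_nhds (u : G.U) :
    ∃ s : Set G.U, IsOpen s ∧ u ∈ s ∧ Set.InjOn G.toGlued s := by
  have h : (u, u) ∉ {q : G.U × G.U | q.1.1 ∈ G.D ∧ q.2.1 = G.σ q.1.1} :=
    fun h => G.free _ h.1 h.2.symm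
  have h' := G.isClosed_graph.isOpen_compl.mem_nhds h
  rw [nhds_prod_eq, Filter.mem_prod_self_iff] at h'
  obtain ⟨t, ht, hts⟩ := h'
  obtain ⟨s, hst, hs, hus⟩ := mem_nhds_iff.1 ht
  refine ⟨s, hs, hus, fun x hx y hy hxy => ?_⟩
  rcases toGlued_eq.1 hxy with h | h
  · exact h.symm
  · exact (hts (a := (x, y)) ⟨hst hx, hst hy⟩ h).elim

/-- On a small open set the projection is injective, continuous and open; its inverse there,
followed by the inclusion in `M`, is the section. -/
theorem exists_section (w : G.Glued) : ∃ e : OpenPartialHomeomorph G.Glued M,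
    w ∈ e.source ∧ (∀ w ∈ e.source, ∃ h : e w ∈ G.U, G.toGlued ⟨e w, h⟩ = w) ∧
    ∀ m ∈ e.target, ∃ h : m ∈ G.U, e.symm m = G.toGlued ⟨m, h⟩ ∧ e (G.toGlued ⟨m, h⟩) = m := by
  obtain ⟨u, rfl⟩ := G.toGlued_surjective w
  obtain ⟨s, hs, hus, hinj⟩ := G.exists_injective_nhds u
  have : Nonempty s := ⟨⟨u, hus⟩⟩
  have h₁ : Topology.IsOpenEmbedding fun x : s => G.toGlued x.1 :=
    .of_continuous_injective_isOpenMap (G.continuous_toGlued.comp continuous_subtype_val)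
      (fun x y h => Subtype.ext (hinj x.2 y.2 h))
      (G.isOpenMap_toGlued.comp hs.isOpenMap_subtype_val)
  have h₂ : Topology.IsOpenEmbedding fun x : s => (x.1 : M) :=
    G.isOpen_U.isOpenEmbedding_subtypeVal.comp hs.isOpenEmbedding_subtypeVal
  let a := h₁.toOpenPartialHomeomorph
  let b := h₂.toOpenPartialHomeomorph
  have ha : ∀ x : s, a.symm (G.toGlued x.1) = x := fun x => a.left_inv (x := x) (Set.mem_univ x)
  have hb : ∀ x : s, b.symm x.1.1 = x := fun x => b.left_inv (x := x) (Set.mem_univ x)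
  refine ⟨a.symm.trans b, ⟨⟨⟨u, hus⟩, trivial, rfl⟩, Set.mem_univ _⟩, ?_, ?_⟩
  · rintro _ ⟨⟨x, -, rfl⟩, -⟩
    have hx : (a.symm.trans b) (G.toGlued x.1) = x.1.1 := congrArg b (ha x)
    change ∃ h : (a.symm.trans b) (G.toGlued x.1) ∈ G.U,
      G.toGlued ⟨(a.symm.trans b) (G.toGlued x.1), h⟩ = G.toGlued x.1
    simp only [hx]
    exact ⟨x.1.2, trivial⟩
  · rintro _ ⟨⟨x, -, rfl⟩, -⟩
    exact ⟨x.1.2, congrArg a (hb x), congrArg b (ha x)⟩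

/-- A local section of the projection, with values in a neighbourhood of a lift of `w`. -/
def lift (w : G.Glued) : OpenPartialHomeomorph G.Glued M :=
  (G.exists_section w).choose

theorem mem_lift_source (w : G.Glued) : w ∈ (G.lift w).source :=
  (G.exists_section w).choose_spec.1

theorem lift_mem {w w' : G.Glued} (h : w' ∈ (G.lift w).source) : G.lift w w' ∈ G.U :=
  ((G.exists_section w).choose_spec.2.1 w' h).1

theorem toGlued_lift {w w' : G.Glued} (h : w' ∈ (G.lift w).source) :
    G.toGlued ⟨G.lift w w', G.lift_mem h⟩ = w' :=
  ((G.exists_section w).choose_spec.2.1 w' h).2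

theorem lift_target_subset (w : G.Glued) : (G.lift w).target ⊆ G.U := fun m hm =>
  ((G.exists_section w).choose_spec.2.2 m hm).1

theorem lift_symm {w : G.Glued} {m : M} (hm : m ∈ (G.lift w).target) :
    (G.lift w).symm m = G.toGlued ⟨m, G.lift_target_subset w hm⟩ :=
  ((G.exists_section w).choose_spec.2.2 m hm).2.1

theorem lift_toGlued {w : G.Glued} {m : M} (hm : m ∈ (G.lift w).target) :
    G.lift w (G.toGlued ⟨m, G.lift_target_subset w hm⟩) = m :=
  ((G.exists_section w).choose_spec.2.2 m hm).2.2

instance : ChartedSpace H G.Glued :=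
  chartedSpaceOfLocalHomeomorphs G.lift G.mem_lift_source

theorem isLocallyModelled : IsLocallyModelled H G.lift where
  mem_source := G.mem_lift_source
  chartAt_eq _ := rfl
  atlas_eq := by
    rintro _ ⟨w, rfl⟩
    exact ⟨w, rfl⟩

/-- A local section of the projection is, near a point `m` of `U`, inverse to the projection up to
the involution. -/
theorem lift_toGlued_eventually (w : G.Glued) {m : M} (hm : m ∈ G.U)
    (hw : G.toGlued ⟨m, hm⟩ ∈ (G.lift w).source) :
    (∀ᶠ x in nhds m, ∃ h : x ∈ G.U, G.lift w (G.toGlued ⟨x, h⟩) = x) ∨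
      (m ∈ G.D ∧ ∀ᶠ x in nhds m, ∃ h : x ∈ G.U, G.lift w (G.toGlued ⟨x, h⟩) = G.σ x) := by
  have h := G.toGlued_lift hw
  have ht := (G.lift w).map_source hw
  rcases toGlued_eq.1 h with h | ⟨h₁, h₂⟩
  · left
    have hm' : m ∈ (G.lift w).target := by
      have h' : m = G.lift w (G.toGlued ⟨m, hm⟩) := congrArg Subtype.val h
      rwa [← h'] at ht
    filter_upwards [(G.lift w).open_target.mem_nhds hm'] with x hx
    exact ⟨_, G.lift_toGlued hx⟩
  · right
    have hmD : m ∈ G.D := by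
      have := G.map_mem _ h₁
      rwa [← h₂] at this
    have hσ : G.σ m = G.lift w (G.toGlued ⟨m, hm⟩) := by
      have h₃ : m = G.σ (G.lift w (G.toGlued ⟨m, hm⟩)) := h₂
      have h₄ := G.involutive _ h₁
      rw [← h₃] at h₄
      exact h₄
    refine ⟨hmD, ?_⟩
    have hc := (G.isLocalDiffeomorphAt m hmD).contMDiffAt.continuousAt
    rw [← hσ] at ht
    filter_upwards [G.isOpen_D.mem_nhds hmD,
      hc.preimage_mem_nhds ((G.lift w).open_target.mem_nhds ht)] with x hx hx'
    refine ⟨G.subset hx, ?_⟩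
    rw [← G.toGlued_σ hx]
    exact G.lift_toGlued hx'

/-- Two lifts of one point are equal or exchanged by `σ`, and the alternative persists nearby.
Smoothness and orientation of the quotient thus reduce to the properties of `σ`. -/
theorem transition_eventuallyEq {w w' : G.Glued} {m : M}
    (hm : m ∈ ((G.lift w).symm.trans (G.lift w')).source) :
    (⇑((G.lift w).symm.trans (G.lift w')) =ᶠ[nhds m] fun x => x) ∨
      (m ∈ G.D ∧ ⇑((G.lift w).symm.trans (G.lift w')) =ᶠ[nhds m] G.σ) := by
  obtain ⟨hm₁, hm₂⟩ := hm
  have hm₂' : (G.lift w).symm m ∈ (G.lift w').source := hm₂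
  rw [G.lift_symm hm₁] at hm₂'
  have hn := (G.lift w).open_target.mem_nhds hm₁
  refine (G.lift_toGlued_eventually w' _ hm₂').imp ?_ (And.imp_right ?_) <;>
  · intro h
    filter_upwards [h, hn] with x hx hx'
    obtain ⟨_, hx⟩ := hx
    exact (congrArg (G.lift w') (G.lift_symm hx')).trans hx

theorem smoothTransitions : SmoothTransitions I G.lift := by
  intro w w' m hm
  rcases G.transition_eventuallyEq hm with h | ⟨hD, h⟩
  · exact (IsLocalDiffeomorphAt.id m).congr h
  · exact (G.isLocalDiffeomorphAt m hD).congr h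

theorem transition_preserves (w w' : G.Glued) (m : M)
    (hm : m ∈ ((G.lift w).symm.trans (G.lift w')).source) :
    0 < signedJacobian I I o.sign o.sign ((G.lift w).symm.trans (G.lift w')) m := by
  rcases G.transition_eventuallyEq hm with h | ⟨hD, h⟩
  · rw [signedJacobian_congr h, signedJacobian_id]
    exact one_pos
  · rw [signedJacobian_congr h]
    exact G.preserves m hD

instance : IsManifold I ∞ G.Glued := G.isLocallyModelled.isManifold G.smoothTransitions

/-- The orientation of the glued manifold. -/
def orientation : ManifoldOrientation I G.Glued :=
  G.isLocallyModelled.orientation G.smoothTransitions o G.transition_preserves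

/-- The projection, extended to all of `M` by the value `w₀`. -/
def proj (w₀ : G.Glued) (m : M) : G.Glued := by
  classical
  exact if h : m ∈ G.U then G.toGlued ⟨m, h⟩ else w₀

theorem proj_of_mem (w₀ : G.Glued) {m : M} (h : m ∈ G.U) : G.proj w₀ m = G.toGlued ⟨m, h⟩ :=
  dif_pos h

theorem lift_proj_eventuallyEq (w₀ : G.Glued) {m : M} (hm : m ∈ G.U) :
    (G.lift (G.proj w₀ m) ∘ G.proj w₀ =ᶠ[nhds m] fun x => x) ∨
      (m ∈ G.D ∧ G.lift (G.proj w₀ m) ∘ G.proj w₀ =ᶠ[nhds m] G.σ) := by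
  have h : G.toGlued ⟨m, hm⟩ ∈ (G.lift (G.proj w₀ m)).source := by
    rw [← G.proj_of_mem w₀ hm]
    exact G.mem_lift_source _
  refine (G.lift_toGlued_eventually _ hm h).imp ?_ (And.imp_right ?_) <;>
  · intro h
    filter_upwards [h] with x hx
    obtain ⟨hU, hx⟩ := hx
    rw [Function.comp_apply, G.proj_of_mem w₀ hU, hx]

theorem proj_eventuallyEq (w₀ : G.Glued) {m : M} (hm : m ∈ G.U) :
    G.proj w₀ =ᶠ[nhds m]
      (G.lift (G.proj w₀ m)).symm ∘ (G.lift (G.proj w₀ m) ∘ G.proj w₀) := by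
  have hc : ContinuousAt (G.proj w₀) m := by
    have h : ContinuousOn (G.proj w₀) G.U := by
      rw [continuousOn_iff_continuous_domRestrict]
      convert G.continuous_toGlued using 1
      ext x
      exact G.proj_of_mem w₀ x.2
    exact h.continuousAt (G.isOpen_U.mem_nhds hm)
  filter_upwards [hc.preimage_mem_nhds ((G.lift (G.proj w₀ m)).open_source.mem_nhds
    (G.mem_lift_source _))] with x hx
  exact ((G.lift (G.proj w₀ m)).left_inv hx).symm

theorem isLocalDiffeomorphAt_lift_proj (w₀ : G.Glued) {m : M} (hm : m ∈ G.U) :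
    IsLocalDiffeomorphAt I I ∞ (G.lift (G.proj w₀ m) ∘ G.proj w₀) m := by
  rcases G.lift_proj_eventuallyEq w₀ hm with h | ⟨hD, h⟩
  · exact (IsLocalDiffeomorphAt.id m).congr h
  · exact (G.isLocalDiffeomorphAt m hD).congr h

/-- Followed by a lift, the projection is locally the identity or `σ`, and the lift is a local
diffeomorphism at its base point. -/
theorem isLocalDiffeomorphAt_proj (w₀ : G.Glued) {m : M} (hm : m ∈ G.U) :
    IsLocalDiffeomorphAt I I ∞ (G.proj w₀) m := by
  have h₁ := G.isLocallyModelled.isLocalDiffeomorphAt_self (I := I) (G.proj w₀ m)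
  have h₂ : IsLocalDiffeomorphAt I I ∞ (G.lift (G.proj w₀ m)).symm
      (G.lift (G.proj w₀ m) (G.proj w₀ m)) :=
    h₁.of_comp ((IsLocalDiffeomorphAt.id _).congr
      ((G.lift (G.proj w₀ m)).eventually_left_inverse (G.mem_lift_source _)))
  exact ((G.isLocalDiffeomorphAt_lift_proj w₀ hm).comp _ _ h₂).congr (G.proj_eventuallyEq w₀ hm)

theorem signedJacobian_proj_pos (w₀ : G.Glued) {m : M} (hm : m ∈ G.U) :
    0 < signedJacobian I I o.sign G.orientation.sign (G.proj w₀) m := by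
  have h₁ := G.isLocallyModelled.isLocalDiffeomorphAt_self (I := I) (G.proj w₀ m)
  have h₂ := IsLocalDiffeomorphAt.signedJacobian_comp o.sign G.orientation.sign o.sign h₁
    (G.isLocalDiffeomorphAt_proj w₀ hm)
  have h₃ : signedJacobian I I G.orientation.sign o.sign (G.lift (G.proj w₀ m)) (G.proj w₀ m) = 1 :=
    G.isLocallyModelled.signedJacobian_self o.sign (G.proj w₀ m)
  rw [h₃, one_mul] at h₂
  rw [← h₂]
  rcases G.lift_proj_eventuallyEq w₀ hm with h | ⟨hD, h⟩
  · rw [signedJacobian_congr h, signedJacobian_id]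
    exact one_pos
  · rw [signedJacobian_congr h]
    exact G.preserves m hD

theorem isBoundaryPoint_toGlued {m : M} (hm : m ∈ G.U) :
    I.IsBoundaryPoint (G.toGlued ⟨m, hm⟩) ↔ I.IsBoundaryPoint m := by
  have h := (G.isLocalDiffeomorphAt_proj (G.toGlued ⟨m, hm⟩) hm).isBoundaryPoint_iff (by simp)
  rw [h, G.proj_of_mem]

end GluingInvolution

end Gluing

/-! ### Pushing a collar to its base. -/

section Retraction

variable {p : ℕ} {N W : Type*} [TopologicalSpace N] [ChartedSpace (EuclideanSpace ℝ (Fin p)) N]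
  [TopologicalSpace W]
  [ChartedSpace (ModelProd (EuclideanSpace ℝ (Fin p)) (EuclideanHalfSpace 1)) W]

theorem isCompact_collar [CompactSpace N] (c : ℝ) :
    IsCompact {q : N × EuclideanHalfSpace 1 | q.2.1 0 ≤ c} := by
  have h : {q : N × EuclideanHalfSpace 1 | q.2.1 0 ≤ c} =
      Set.univ ×ˢ (halfLinePoint '' Set.Icc 0 c) := by
    ext ⟨x, t⟩
    constructor
    · intro ht
      exact ⟨trivial, t.1 0, ⟨t.2, ht⟩, halfLine_ext (halfLinePoint_coord t.2)⟩
    · rintro ⟨-, r, ⟨hr, hrc⟩, rfl⟩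
      exact (halfLinePoint_coord hr).trans_le hrc
  rw [h]
  exact isCompact_univ.prod (isCompact_Icc.image continuous_halfLinePoint)

/-- The map of the closed half line which collapses `[0, 1/2]` and is the identity beyond `3/4`. -/
def halfLineCollapse (t : EuclideanHalfSpace 1) : EuclideanHalfSpace 1 :=
  -- The line of slope `3` vanishes at `1/2` and meets the diagonal at `3/4`.
  halfLinePoint (min (t.1 0) (3 * t.1 0 - 3 / 2))

theorem continuous_halfLineCollapse : Continuous halfLineCollapse :=
  continuous_halfLinePoint.comp (by fun_prop)

theorem halfLineCollapse_of_le {t : EuclideanHalfSpace 1} (ht : t.1 0 ≤ 1 / 2) :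
    halfLineCollapse t = halfLineZero :=
  halfLine_ext (max_eq_right ((min_le_right _ _).trans (by linarith)))

theorem halfLineCollapse_of_ge {t : EuclideanHalfSpace 1} (ht : 3 / 4 ≤ t.1 0) :
    halfLineCollapse t = t := by
  refine halfLine_ext ?_
  rw [halfLineCollapse, min_eq_left (by linarith), halfLinePoint_coord t.2]

theorem halfLineCollapse_lt {t : EuclideanHalfSpace 1} (ht : t.1 0 < 1) :
    (halfLineCollapse t).1 0 < 1 :=
  max_lt ((min_le_left _ _).trans_lt ht) one_pos

/-- The self map of `W` which pushes a collar to its base. -/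
def BoundaryCollar.collapseFun (θ : BoundaryCollar p N W) (w : W) : W := by
  classical
  exact if h : ∃ q ∈ collarDomain N, θ.toFun q = w then
    θ.toFun (h.choose.1, halfLineCollapse h.choose.2) else w

theorem BoundaryCollar.collapseFun_apply (θ : BoundaryCollar p N W)
    {q : N × EuclideanHalfSpace 1} (hq : q ∈ collarDomain N) :
    θ.collapseFun (θ.toFun q) = θ.toFun (q.1, halfLineCollapse q.2) := by
  have h : ∃ q' ∈ collarDomain N, θ.toFun q' = θ.toFun q := ⟨q, hq, rfl⟩
  have h' : h.choose = q := θ.injOn h.choose_spec.1 hq h.choose_spec.2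
  rw [collapseFun, dif_pos h, h']

theorem BoundaryCollar.collapseFun_of_notMem (θ : BoundaryCollar p N W) {w : W}
    (hw : w ∉ θ.toFun '' collarDomain N) : θ.collapseFun w = w :=
  dif_neg hw

/-- Inside the open collar the defining formula is continuous. A point outside has a neighbourhood
avoiding the compact, hence closed, image of `N × [0, 3/4]`, where the map is the identity. -/
theorem BoundaryCollar.continuous_collapseFun [CompactSpace N] [T2Space W]
    (θ : BoundaryCollar p N W) : Continuous θ.collapseFun := by
  rw [continuous_iff_continuousAt]
  intro w
  by_cases hw : w ∈ θ.toFun '' collarDomain N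
  · obtain ⟨q, hq, rfl⟩ := hw
    rw [ContinuousAt, ← (θ.isLocalDiffeomorphAt hq).map_nhds, Filter.tendsto_map'_iff,
      θ.collapseFun_apply hq]
    have hc : ContinuousAt (fun q : N × EuclideanHalfSpace 1 =>
        θ.toFun (q.1, halfLineCollapse q.2)) q :=
      ContinuousAt.comp (f := fun q : N × EuclideanHalfSpace 1 => (q.1, halfLineCollapse q.2))
        (θ.continuousAt (halfLineCollapse_lt hq))
        (continuous_fst.prodMk (continuous_halfLineCollapse.comp continuous_snd)).continuousAt
    refine hc.tendsto.congr' ?_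
    filter_upwards [isOpen_collarDomain.mem_nhds hq] with q' hq'
    exact (θ.collapseFun_apply hq').symm
  · have hK : IsClosed (θ.toFun '' {q | q.2.1 0 ≤ 3 / 4}) := by
      refine ((isCompact_collar (3 / 4)).image_of_continuousOn fun q hq => ?_).isClosed
      have hq' : q.2.1 0 ≤ 3 / 4 := hq
      exact (θ.continuousAt (hq'.trans_lt (by norm_num))).continuousWithinAt
    have hwK : w ∈ (θ.toFun '' {q | q.2.1 0 ≤ 3 / 4})ᶜ := by
      rintro ⟨q, hq, rfl⟩
      have hq' : q.2.1 0 ≤ 3 / 4 := hq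
      exact hw ⟨q, hq'.trans_lt (by norm_num), rfl⟩
    refine continuousAt_id.congr ?_
    filter_upwards [hK.isOpen_compl.mem_nhds hwK] with v hv
    by_cases hv' : v ∈ θ.toFun '' collarDomain N
    · obtain ⟨q, hq, rfl⟩ := hv'
      have h : 3 / 4 ≤ q.2.1 0 := by
        by_contra h
        exact hv ⟨q, (not_le.1 h).le, rfl⟩
      rw [θ.collapseFun_apply hq, halfLineCollapse_of_ge h]
      rfl
    · exact (θ.collapseFun_of_notMem hv').symm

theorem halfLineHalve_injective : Function.Injective halfLineHalve := by
  intro t u h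
  have h' := congrArg (fun v : EuclideanHalfSpace 1 => v.1 0) h
  simp only [halfLineHalve_coord] at h'
  exact halfLine_ext (by linarith)

theorem halfLineHalve_lt {t : EuclideanHalfSpace 1} (ht : t.1 0 < 1) :
    (halfLineHalve t).1 0 < 1 := by
  rw [halfLineHalve_coord]
  linarith

/-- The inner half of a collar. -/
def BoundaryCollar.halve (θ : BoundaryCollar p N W) : BoundaryCollar p N W :=
  θ.precomp id halfLineHalve isLocalDiffeomorphAt_id
    (fun t _ => isLocalDiffeomorphAt_halfLineHalve t) (fun _ => halfLineHalve_lt)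
    Function.injective_id halfLineHalve_injective

theorem BoundaryCollar.halve_apply (θ : BoundaryCollar p N W) (q : N × EuclideanHalfSpace 1) :
    θ.halve.toFun q = θ.toFun (q.1, halfLineHalve q.2) :=
  rfl

theorem halfLineHalve_zero : halfLineHalve halfLineZero = halfLineZero :=
  halfLine_ext (by rw [halfLineHalve_coord]; simp)

theorem BoundaryCollar.halve_base (θ : BoundaryCollar p N W) (x : N) :
    θ.halve.base x = θ.base x := by
  rw [base, halve_apply, halfLineHalve_zero]
  rfl

/-- At `t = 1` the halved collar takes the value of the original one at `1/2`; this gives the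
continuity on `N × [0, 1]` required in `GluableCollars`. -/
theorem BoundaryCollar.continuousAt_halve (θ : BoundaryCollar p N W)
    {q : N × EuclideanHalfSpace 1} (hq : q.2.1 0 ≤ 1) : ContinuousAt θ.halve.toFun q := by
  have h : (q.1, halfLineHalve q.2) ∈ collarDomain N := by
    change (halfLineHalve q.2).1 0 < 1
    rw [halfLineHalve_coord]
    linarith
  exact ContinuousAt.comp (f := fun q : N × EuclideanHalfSpace 1 => (q.1, halfLineHalve q.2))
    (θ.continuousAt h)
    (continuous_fst.prodMk ((continuous_halfLineAffine _ _).comp continuous_snd)).continuousAt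

theorem BoundaryCollar.image_halve_subset (θ : BoundaryCollar p N W) :
    θ.halve.toFun '' collarDomain N ⊆ θ.toFun '' collarDomain N := by
  rintro _ ⟨q, hq, rfl⟩
  exact ⟨(q.1, halfLineHalve q.2), halfLineHalve_lt hq, rfl⟩

/-- After the collapse a map depends only on the point of `N` along the halved collar. Two maps that
agree merely on `N` therefore become compatible with the gluing. -/
theorem BoundaryCollar.collapseFun_halve (θ : BoundaryCollar p N W)
    {q : N × EuclideanHalfSpace 1} (hq : q ∈ collarDomain N) :
    θ.collapseFun (θ.halve.toFun q) = θ.base q.1 := by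
  have hq' : q.2.1 0 < 1 := hq
  rw [halve_apply, θ.collapseFun_apply (halfLineHalve_lt hq'),
    halfLineCollapse_of_le (by rw [halfLineHalve_coord]; linarith)]
  rfl

theorem BoundaryCollar.orientedJacobian_halve [IsManifold (𝓡 p) 1 N]
    [IsManifold (collarModel p) 1 W]
    (oN : ManifoldOrientation (𝓡 p) N) (oW : ManifoldOrientation (collarModel p) W)
    (θ : BoundaryCollar p N W) {q : N × EuclideanHalfSpace 1} (hq : q ∈ collarDomain N) :
    θ.halve.orientedJacobian oN oW q =
      θ.orientedJacobian oN oW (q.1, halfLineHalve q.2) * (1 / 2) := by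
  have h := orientedJacobian_precomp oN oN oW θ id halfLineHalve isLocalDiffeomorphAt_id
    (fun t _ => isLocalDiffeomorphAt_halfLineHalve t) (fun _ => halfLineHalve_lt)
    Function.injective_id halfLineHalve_injective hq
  rw [jacobian_halfLineHalve] at h
  have h' : signedJacobian (𝓡 p) (𝓡 p) oN.sign oN.sign id q.1 = 1 := signedJacobian_id _ _
  rw [h', one_mul] at h
  exact h

end Retraction

/-! ### The involution exchanging two collars. -/

section CollarGluing

variable {p : ℕ} {N M : Type*} [TopologicalSpace N] [ChartedSpace (EuclideanSpace ℝ (Fin p)) N]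
  [TopologicalSpace M]
  [ChartedSpace (ModelProd (EuclideanSpace ℝ (Fin p)) (EuclideanHalfSpace 1)) M]

/-- `N × (0, 1)`, as a subset of `N × [0, ∞)`. -/
def openCollarDomain (N : Type*) : Set (N × EuclideanHalfSpace 1) := {q | q.2 ∈ halfLineIoo}

/-- The map `(x, t) ↦ (x, 1 - t)`. -/
def collarFlip : N × EuclideanHalfSpace 1 → N × EuclideanHalfSpace 1 := Prod.map id halfLineFlip

theorem isOpen_openCollarDomain : IsOpen (openCollarDomain N) :=
  isOpen_halfLineIoo.preimage continuous_snd

theorem openCollarDomain_subset {N : Type*} : openCollarDomain N ⊆ collarDomain N :=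
  fun _ hq => hq.2

theorem collarFlip_mem {N : Type*} {q : N × EuclideanHalfSpace 1} (hq : q ∈ openCollarDomain N) :
    collarFlip q ∈ openCollarDomain N :=
  halfLineFlip_mem hq

theorem collarFlip_flip {N : Type*} {q : N × EuclideanHalfSpace 1} (hq : q ∈ openCollarDomain N) :
    collarFlip (collarFlip q) = q :=
  Prod.ext rfl (halfLineFlip_flip hq)

theorem isLocalDiffeomorphAt_collarFlip {q : N × EuclideanHalfSpace 1}
    (hq : q ∈ openCollarDomain N) :
    IsLocalDiffeomorphAt (collarModel p) (collarModel p) ∞ collarFlip q :=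
  (isLocalDiffeomorphAt_id q.1).prodMap (isLocalDiffeomorphAt_halfLineFlip hq)

theorem signedJacobian_collarFlip (s : N → ℤˣ) {q : N × EuclideanHalfSpace 1}
    (hq : q ∈ openCollarDomain N) :
    signedJacobian (collarModel p) (collarModel p) (fun q => s q.1) (fun q => s q.1)
      collarFlip q = -1 := by
  have h := signedJacobian_prodMap_fst (p := p) (q := q) s s (isLocalDiffeomorphAt_id q.1)
    (isLocalDiffeomorphAt_halfLineFlip hq)
  have h' : signedJacobian (𝓡 p) (𝓡 p) s s id q.1 = 1 := signedJacobian_id _ _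
  rw [h', one_mul, jacobian_halfLineFlip hq] at h
  exact h

/-- The map exchanging the points `β(x, t)` and `γ(x, 1 - t)` of two collars. -/
def collarSwap (β γ : BoundaryCollar p N M) (m : M) : M := by
  classical
  exact if h : ∃ q ∈ openCollarDomain N, β.toFun q = m then γ.toFun (collarFlip h.choose)
    else if h : ∃ q ∈ openCollarDomain N, γ.toFun q = m then β.toFun (collarFlip h.choose) else m

theorem collarSwap_left (β γ : BoundaryCollar p N M) {q : N × EuclideanHalfSpace 1}
    (hq : q ∈ openCollarDomain N) : collarSwap β γ (β.toFun q) = γ.toFun (collarFlip q) := by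
  have h : ∃ q' ∈ openCollarDomain N, β.toFun q' = β.toFun q := ⟨q, hq, rfl⟩
  have h' : h.choose = q := β.injOn (openCollarDomain_subset h.choose_spec.1)
    (openCollarDomain_subset hq) h.choose_spec.2
  rw [collarSwap, dif_pos h, h']

theorem collarSwap_right {β γ : BoundaryCollar p N M}
    (hd : Disjoint (β.toFun '' collarDomain N) (γ.toFun '' collarDomain N))
    {q : N × EuclideanHalfSpace 1} (hq : q ∈ openCollarDomain N) :
    collarSwap β γ (γ.toFun q) = β.toFun (collarFlip q) := by
  have h₀ : ¬∃ q' ∈ openCollarDomain N, β.toFun q' = γ.toFun q := by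
    rintro ⟨q', hq', h⟩
    exact Set.disjoint_left.1 hd ⟨q', openCollarDomain_subset hq', h⟩
      ⟨q, openCollarDomain_subset hq, rfl⟩
  have h : ∃ q' ∈ openCollarDomain N, γ.toFun q' = γ.toFun q := ⟨q, hq, rfl⟩
  have h' : h.choose = q := γ.injOn (openCollarDomain_subset h.choose_spec.1)
    (openCollarDomain_subset hq) h.choose_spec.2
  rw [collarSwap, dif_neg h₀, dif_pos h, h']

theorem isLocalDiffeomorphAt_of_comp_collar {β γ : BoundaryCollar p N M} {σ : M → M}
    (hσ : ∀ q ∈ openCollarDomain N, σ (β.toFun q) = γ.toFun (collarFlip q))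
    {q : N × EuclideanHalfSpace 1} (hq : q ∈ openCollarDomain N) :
    IsLocalDiffeomorphAt (collarModel p) (collarModel p) ∞ σ (β.toFun q) := by
  refine (β.isLocalDiffeomorphAt (openCollarDomain_subset hq)).of_comp ?_
  refine ((isLocalDiffeomorphAt_collarFlip hq).comp _ _ (γ.isLocalDiffeomorphAt
    (openCollarDomain_subset (collarFlip_mem hq)))).congr ?_
  filter_upwards [isOpen_openCollarDomain.mem_nhds hq] with q' hq'
  exact hσ q' hq'

/-- The minus sign is the signed Jacobian of the flip. When one of `β`, `γ` preserves and the other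
reverses the orientation, it follows that `σ` preserves it. -/
theorem signedJacobian_of_comp_collar [IsManifold (𝓡 p) 1 N] [IsManifold (collarModel p) 1 M]
    (oN : ManifoldOrientation (𝓡 p) N) (o : ManifoldOrientation (collarModel p) M)
    {β γ : BoundaryCollar p N M} {σ : M → M}
    (hσ : ∀ q ∈ openCollarDomain N, σ (β.toFun q) = γ.toFun (collarFlip q))
    {q : N × EuclideanHalfSpace 1} (hq : q ∈ openCollarDomain N) :
    signedJacobian (collarModel p) (collarModel p) o.sign o.sign σ (β.toFun q) *
      β.orientedJacobian oN o q = -γ.orientedJacobian oN o (collarFlip q) := by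
  rw [BoundaryCollar.orientedJacobian_eq, BoundaryCollar.orientedJacobian_eq,
    ← IsLocalDiffeomorphAt.signedJacobian_comp _ o.sign _
      (isLocalDiffeomorphAt_of_comp_collar hσ hq)
      (β.isLocalDiffeomorphAt (openCollarDomain_subset hq))]
  have h : σ ∘ β.toFun =ᶠ[nhds q] γ.toFun ∘ collarFlip := by
    filter_upwards [isOpen_openCollarDomain.mem_nhds hq] with q' hq'
    exact hσ q' hq'
  rw [signedJacobian_congr h, IsLocalDiffeomorphAt.signedJacobian_comp _ (fun q => oN.sign q.1) _
    (γ.isLocalDiffeomorphAt (openCollarDomain_subset (collarFlip_mem hq)))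
    (isLocalDiffeomorphAt_collarFlip hq), signedJacobian_collarFlip oN.sign hq, mul_neg_one]

theorem BoundaryCollar.isCompact_range_base [CompactSpace N] (θ : BoundaryCollar p N M) :
    IsCompact (Set.range θ.base) := by
  refine isCompact_range (continuous_iff_continuousAt.2 fun x => ?_)
  exact ContinuousAt.comp (f := fun x : N => (x, halfLineZero))
    (θ.continuousAt (mem_collarDomain_zero x)) (by fun_prop)

theorem BoundaryCollar.base_notMem {θ : BoundaryCollar p N M} {q : N × EuclideanHalfSpace 1}
    (hq : q ∈ openCollarDomain N) : θ.toFun q ∉ Set.range θ.base := by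
  rintro ⟨x, hx⟩
  have h := θ.injOn (mem_collarDomain_zero x) (openCollarDomain_subset hq) hx
  have h' : 0 < q.2.1 0 := hq.1
  rw [← h] at h'
  exact lt_irrefl _ h'

end CollarGluing

/-! ### Gluing two collars: closed graph, compactness and surviving collars. -/

section GluableCollars

variable {p : ℕ} {N M : Type*} [TopologicalSpace N] [ChartedSpace (EuclideanSpace ℝ (Fin p)) N]
  [TopologicalSpace M]
  [ChartedSpace (ModelProd (EuclideanSpace ℝ (Fin p)) (EuclideanHalfSpace 1)) M]

/-- The pairs of points of the closed collars which are to be glued. -/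
def GluableCollars.closedGraph (β γ : BoundaryCollar p N M) : Set (M × M) :=
  (fun q => (β.toFun q, γ.toFun (collarFlip q))) '' {q : N × EuclideanHalfSpace 1 | q.2.1 0 ≤ 1}

/-- At height `0` the point `m` would be in the base of `β`, at height `1` the point `m'` would be
in the base of `γ`; off the bases only `0 < t < 1` remains. -/
theorem GluableCollars.exists_of_mem_closedGraph {β γ : BoundaryCollar p N M} {m m' : M}
    (h : (m, m') ∈ GluableCollars.closedGraph β γ)
    (hm : m ∈ (Set.range β.base ∪ Set.range γ.base)ᶜ)
    (hm' : m' ∈ (Set.range β.base ∪ Set.range γ.base)ᶜ) :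
    ∃ q ∈ openCollarDomain N, m = β.toFun q ∧ m' = γ.toFun (collarFlip q) := by
  obtain ⟨⟨x, t⟩, ht, h⟩ := h
  obtain ⟨rfl, rfl⟩ := Prod.ext_iff.1 h
  have ht' : t.1 0 ≤ 1 := ht
  refine ⟨(x, t), ⟨lt_of_le_of_ne t.2 fun h₀ => hm (Or.inl ⟨x, ?_⟩),
    lt_of_le_of_ne ht' fun h₁ => hm' (Or.inr ⟨x, ?_⟩)⟩, rfl, rfl⟩
  · have : t = halfLineZero := halfLine_ext h₀.symm
    rw [this]
    rfl
  · have : halfLineFlip t = halfLineZero := halfLine_ext (by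
      rw [halfLineFlip_coord ht', h₁]
      simp)
    change γ.toFun (x, halfLineZero) = γ.toFun (x, halfLineFlip t)
    rw [this]

theorem continuous_collarFlip : Continuous (collarFlip (N := N)) :=
  continuous_id.prodMap (continuous_halfLineAffine _ _)

variable [IsManifold (𝓡 p) 1 N] [IsManifold (collarModel p) ∞ M]

/-- Two disjoint collars of `N`, extending continuously to `N × [0, 1]`, of which the first
reverses and the second preserves the orientation. -/
structure GluableCollars (oN : ManifoldOrientation (𝓡 p) N)
    (o : ManifoldOrientation (collarModel p) M) (β γ : BoundaryCollar p N M) : Prop where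
  disjoint : Disjoint (β.toFun '' collarDomain N) (γ.toFun '' collarDomain N)
  reverses : ∀ q ∈ collarDomain N, β.orientedJacobian oN o q < 0
  preserves : ∀ q ∈ collarDomain N, 0 < γ.orientedJacobian oN o q
  continuousAt_left : ∀ q : N × EuclideanHalfSpace 1, q.2.1 0 ≤ 1 → ContinuousAt β.toFun q
  continuousAt_right : ∀ q : N × EuclideanHalfSpace 1, q.2.1 0 ≤ 1 → ContinuousAt γ.toFun q

variable {oN : ManifoldOrientation (𝓡 p) N} {o : ManifoldOrientation (collarModel p) M}
  {β γ : BoundaryCollar p N M}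

namespace GluableCollars

theorem ne (h : GluableCollars oN o β γ) {q q' : N × EuclideanHalfSpace 1}
    (hq : q ∈ collarDomain N) (hq' : q' ∈ collarDomain N) : β.toFun q ≠ γ.toFun q' := fun h' =>
  Set.disjoint_left.1 h.disjoint ⟨q, hq, rfl⟩ ⟨q', hq', h'.symm⟩

theorem notMem_left (h : GluableCollars oN o β γ) {q : N × EuclideanHalfSpace 1}
    (hq : q ∈ openCollarDomain N) : β.toFun q ∈ (Set.range β.base ∪ Set.range γ.base)ᶜ := by
  rintro (hx | ⟨x, hx⟩)
  · exact BoundaryCollar.base_notMem hq hx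
  · exact h.ne (openCollarDomain_subset hq) (mem_collarDomain_zero x) hx.symm

theorem notMem_right (h : GluableCollars oN o β γ) {q : N × EuclideanHalfSpace 1}
    (hq : q ∈ openCollarDomain N) : γ.toFun q ∈ (Set.range β.base ∪ Set.range γ.base)ᶜ := by
  rintro (⟨x, hx⟩ | hx)
  · exact h.ne (mem_collarDomain_zero x) (openCollarDomain_subset hq) hx
  · exact BoundaryCollar.base_notMem hq hx

/-- It is a continuous image of the compact `N × [0, 1]`; the continuity of the collars up to height
`1` is needed here. -/
theorem isClosed_closedGraph [CompactSpace N] [T2Space M] (h : GluableCollars oN o β γ) :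
    IsClosed (closedGraph β γ) := by
  refine ((isCompact_collar 1).image_of_continuousOn fun q hq => ?_).isClosed
  have hq' : q.2.1 0 ≤ 1 := hq
  have h₁ : ContinuousAt (fun q => γ.toFun (collarFlip q)) q := by
    refine ContinuousAt.comp (f := collarFlip) (h.continuousAt_right _ ?_)
      continuous_collarFlip.continuousAt
    have h₂ := q.2.2
    change (halfLineFlip q.2).1 0 ≤ 1
    rw [halfLineFlip_coord hq']
    linarith
  exact ((h.continuousAt_left q hq').prodMk h₁).continuousWithinAt

/-- The gluing of two collars. -/
def gluing [CompactSpace N] [T2Space M] (h : GluableCollars oN o β γ) :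
    GluingInvolution (collarModel p) o where
  U := (Set.range β.base ∪ Set.range γ.base)ᶜ
  D := β.toFun '' openCollarDomain N ∪ γ.toFun '' openCollarDomain N
  σ := collarSwap β γ
  isOpen_U := (β.isCompact_range_base.union γ.isCompact_range_base).isClosed.isOpen_compl
  isOpen_D := (β.isOpen_image isOpen_openCollarDomain openCollarDomain_subset).union
    (γ.isOpen_image isOpen_openCollarDomain openCollarDomain_subset)
  subset := by
    rintro _ (⟨q, hq, rfl⟩ | ⟨q, hq, rfl⟩)
    exacts [h.notMem_left hq, h.notMem_right hq]
  map_mem := by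
    rintro _ (⟨q, hq, rfl⟩ | ⟨q, hq, rfl⟩)
    · rw [collarSwap_left β γ hq]
      exact Or.inr ⟨_, collarFlip_mem hq, rfl⟩
    · rw [collarSwap_right h.disjoint hq]
      exact Or.inl ⟨_, collarFlip_mem hq, rfl⟩
  involutive := by
    rintro _ (⟨q, hq, rfl⟩ | ⟨q, hq, rfl⟩)
    · rw [collarSwap_left β γ hq, collarSwap_right h.disjoint (collarFlip_mem hq),
        collarFlip_flip hq]
    · rw [collarSwap_right h.disjoint hq, collarSwap_left β γ (collarFlip_mem hq),
        collarFlip_flip hq]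
  free := by
    rintro _ (⟨q, hq, rfl⟩ | ⟨q, hq, rfl⟩)
    · rw [collarSwap_left β γ hq]
      exact (h.ne (openCollarDomain_subset hq) (openCollarDomain_subset (collarFlip_mem hq))).symm
    · rw [collarSwap_right h.disjoint hq]
      exact h.ne (openCollarDomain_subset (collarFlip_mem hq)) (openCollarDomain_subset hq)
  isLocalDiffeomorphAt := by
    rintro _ (⟨q, hq, rfl⟩ | ⟨q, hq, rfl⟩)
    · exact isLocalDiffeomorphAt_of_comp_collar (fun _ => collarSwap_left β γ) hq
    · exact isLocalDiffeomorphAt_of_comp_collar (fun _ => collarSwap_right h.disjoint) hq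
  preserves := by
    rintro _ (⟨q, hq, rfl⟩ | ⟨q, hq, rfl⟩)
    · have h₁ := signedJacobian_of_comp_collar oN o (fun _ => collarSwap_left β γ) hq
      have h₂ := h.reverses q (openCollarDomain_subset hq)
      have h₃ := h.preserves _ (openCollarDomain_subset (collarFlip_mem hq))
      exact pos_of_mul_neg_left (h₁.trans_lt (neg_neg_of_pos h₃)) h₂.le
    · have h₁ := signedJacobian_of_comp_collar oN o (fun _ => collarSwap_right h.disjoint) hq
      have h₂ := h.preserves q (openCollarDomain_subset hq)
      have h₃ := h.reverses _ (openCollarDomain_subset (collarFlip_mem hq))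
      exact pos_of_mul_pos_left ((neg_pos.2 h₃).trans_eq h₁.symm) h₂.le
  isClosed_graph := by
    set U : Set M := (Set.range β.base ∪ Set.range γ.base)ᶜ
    -- The graph of the swap is the trace on `U × U` of the closed graph and its transpose, because
    -- the two ends of the closed graph involve removed points.
    have hG : {q : U × U | q.1.1 ∈ β.toFun '' openCollarDomain N ∪ γ.toFun '' openCollarDomain N ∧
        q.2.1 = collarSwap β γ q.1.1} =
        (fun q : U × U => (q.1.1, q.2.1)) ⁻¹' closedGraph β γ ∪
          (fun q : U × U => (q.2.1, q.1.1)) ⁻¹' closedGraph β γ := by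
      ext ⟨⟨m, hm⟩, ⟨m', hm'⟩⟩
      constructor
      · rintro ⟨⟨q, hq, h₁⟩ | ⟨q, hq, h₁⟩, h₂⟩
        · dsimp only at h₁ h₂
          subst h₁
          rw [collarSwap_left β γ hq] at h₂
          exact Or.inl ⟨q, hq.2.le, Prod.ext rfl h₂.symm⟩
        · dsimp only at h₁ h₂
          subst h₁
          rw [collarSwap_right h.disjoint hq] at h₂
          refine Or.inr ⟨collarFlip q, (collarFlip_mem hq).2.le, Prod.ext h₂.symm ?_⟩
          dsimp only
          rw [collarFlip_flip hq]
      · rintro (h₁ | h₁)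
        · obtain ⟨q, hq, rfl, rfl⟩ := exists_of_mem_closedGraph h₁ hm hm'
          exact ⟨Or.inl ⟨q, hq, rfl⟩, (collarSwap_left β γ hq).symm⟩
        · obtain ⟨q, hq, rfl, rfl⟩ := exists_of_mem_closedGraph h₁ hm' hm
          refine ⟨Or.inr ⟨_, collarFlip_mem hq, rfl⟩, ?_⟩
          dsimp only
          rw [collarSwap_right h.disjoint (collarFlip_mem hq), collarFlip_flip hq]
    rw [hG]
    exact (h.isClosed_closedGraph.preimage (by fun_prop)).union
      (h.isClosed_closedGraph.preimage (by fun_prop))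

variable [CompactSpace N] [T2Space M]

theorem toGlued_eq_flip (h : GluableCollars oN o β γ) {q : N × EuclideanHalfSpace 1}
    (hq : q ∈ openCollarDomain N) :
    h.gluing.toGlued ⟨γ.toFun (collarFlip q), h.notMem_right (collarFlip_mem hq)⟩ =
      h.gluing.toGlued ⟨β.toFun q, h.notMem_left hq⟩ :=
  (GluingInvolution.toGlued_eq (G := h.gluing).2 (Or.inr ⟨Or.inl ⟨q, hq, rfl⟩,
    (collarSwap_left β γ hq).symm⟩)).symm

/-- `U` is not compact, but identified points have heights `t` and `1 - t`, one of which is at least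
`1/2`. So the complement `K` of the part of the collars below `1/2`, which is compact, already maps
onto the quotient. -/
instance compactSpace_glued [CompactSpace M] (h : GluableCollars oN o β γ) :
    CompactSpace h.gluing.Glued := by
  set V : Set (N × EuclideanHalfSpace 1) := {q | q.2.1 0 < 1 / 2}
  have hV : IsOpen V := isOpen_lt (continuous_halfLineCoord.comp continuous_snd) continuous_const
  have hVd : V ⊆ collarDomain N := fun q hq => lt_trans (b := (1 / 2 : ℝ)) hq (by norm_num)
  have hz : ∀ x : N, (x, halfLineZero) ∈ V := fun x => by simp [V]
  set K : Set M := (β.toFun '' V ∪ γ.toFun '' V)ᶜ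
  have hK : IsCompact K :=
    ((β.isOpen_image hV hVd).union (γ.isOpen_image hV hVd)).isClosed_compl.isCompact
  have hKU : K ⊆ h.gluing.U := by
    apply Set.compl_subset_compl.2
    rintro _ (⟨x, rfl⟩ | ⟨x, rfl⟩)
    exacts [Or.inl ⟨_, hz x, rfl⟩, Or.inr ⟨_, hz x, rfl⟩]
  have hK' : IsCompact ((Subtype.val : h.gluing.U → M) ⁻¹' K) :=
    (Topology.IsInducing.subtypeVal.isCompact_preimage_iff (by simpa using hKU)).2 hK
  have hflip : ∀ q ∈ V, q ∈ openCollarDomain N → collarFlip q ∉ V := by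
    intro q hq hq' hqV
    have h₁ : (halfLineFlip q.2).1 0 < 1 / 2 := hqV
    have h₂ : q.2.1 0 < 1 / 2 := hq
    rw [halfLineFlip_coord hq'.2.le] at h₁
    linarith
  have hpos : ∀ θ : BoundaryCollar p N M, ∀ q ∈ V, θ.toFun q ∉ Set.range θ.base →
      q ∈ openCollarDomain N := by
    intro θ q hq hθ
    refine ⟨lt_of_le_of_ne q.2.2 fun h₀ => hθ ⟨q.1, ?_⟩, hVd hq⟩
    have : q = (q.1, halfLineZero) := Prod.ext rfl (halfLine_ext h₀.symm)
    rw [this]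
    rfl
  refine ⟨?_⟩
  have himage : h.gluing.toGlued '' ((Subtype.val : h.gluing.U → M) ⁻¹' K) = Set.univ := by
    refine Set.eq_univ_of_forall fun w => ?_
    obtain ⟨⟨m, hm⟩, rfl⟩ := h.gluing.toGlued_surjective w
    by_cases hmK : m ∈ K
    · exact ⟨⟨m, hm⟩, hmK, rfl⟩
    rcases not_not.1 hmK with ⟨q, hq, rfl⟩ | ⟨q, hq, rfl⟩
    · have hq' := hpos β q hq fun h' => hm (Or.inl h')
      refine ⟨_, ?_, h.toGlued_eq_flip hq'⟩
      rintro (⟨q', hq'', h'⟩ | ⟨q', hq'', h'⟩)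
      · exact h.ne (hVd hq'') (openCollarDomain_subset (collarFlip_mem hq')) h'
      · rw [γ.injOn (hVd hq'') (openCollarDomain_subset (collarFlip_mem hq')) h'] at hq''
        exact hflip q hq hq' hq''
    · have hq' := hpos γ q hq fun h' => hm (Or.inr h')
      refine ⟨_, ?_, (h.toGlued_eq_flip (collarFlip_mem hq')).symm.trans ?_⟩
      · rintro (⟨q', hq'', h'⟩ | ⟨q', hq'', h'⟩)
        · rw [β.injOn (hVd hq'') (openCollarDomain_subset (collarFlip_mem hq')) h'] at hq''
          exact hflip q hq hq' hq''
        · exact h.ne (openCollarDomain_subset (collarFlip_mem hq')) (hVd hq'') h'.symm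
      · congr 2
        rw [collarFlip_flip hq']
  rw [← himage]
  exact hK'.image h.gluing.continuous_toGlued

end GluableCollars

/-- Off `D` no two distinct points are identified, so the projection is injective on the collar;
being an orientation preserving local diffeomorphism on `U`, it multiplies the oriented Jacobian by
a positive factor. -/
theorem GluingInvolution.exists_collar (G : GluingInvolution (collarModel p) o)
    (α : BoundaryCollar p N M) (hU : ∀ q ∈ collarDomain N, α.toFun q ∈ G.U)
    (hD : ∀ q ∈ collarDomain N, α.toFun q ∉ G.D) :
    ∃ α' : BoundaryCollar p N G.Glued,
      (∀ q (hq : q ∈ collarDomain N), α'.toFun q = G.toGlued ⟨α.toFun q, hU q hq⟩) ∧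
      ∀ q ∈ collarDomain N, ∃ c : ℝ, 0 < c ∧
        α'.orientedJacobian oN G.orientation q = c * α.orientedJacobian oN o q := by
  -- A point of `N` supplies the default value `w₀` of `proj`; for empty `N` the quotient may be
  -- empty.
  rcases isEmpty_or_nonempty N with hN | ⟨⟨x₀⟩⟩
  · exact ⟨.ofIsEmpty, fun q => isEmptyElim q.1, fun q => isEmptyElim q.1⟩
  let w₀ := G.toGlued ⟨α.base x₀, hU _ (mem_collarDomain_zero x₀)⟩
  have hinj : Set.InjOn (G.proj w₀) (α.toFun '' collarDomain N) := by
    rintro _ ⟨q, hq, rfl⟩ _ ⟨q', hq', rfl⟩ h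
    rw [G.proj_of_mem w₀ (hU q hq), G.proj_of_mem w₀ (hU q' hq'), toGlued_eq] at h
    rcases h with h | ⟨h, -⟩
    · exact (congrArg Subtype.val h).symm
    · exact (hD q hq h).elim
  refine ⟨α.postcomp (G.proj w₀) (fun q hq => G.isLocalDiffeomorphAt_proj w₀ (hU q hq)) hinj,
    fun q hq => G.proj_of_mem w₀ (hU q hq), fun q hq => ⟨_,
      G.signedJacobian_proj_pos w₀ (hU q hq), ?_⟩⟩
  exact BoundaryCollar.orientedJacobian_postcomp oN o G.orientation α _ _ hinj hq

end GluableCollars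

/-! ### Transitivity of bordism. -/

section Transitivity

variable {p : ℕ} {N₀ N N₂ : Type*} {M : Type}
  [TopologicalSpace N₀] [ChartedSpace (EuclideanSpace ℝ (Fin p)) N₀]
  [TopologicalSpace N] [ChartedSpace (EuclideanSpace ℝ (Fin p)) N] [IsManifold (𝓡 p) 1 N]
  [TopologicalSpace N₂] [ChartedSpace (EuclideanSpace ℝ (Fin p)) N₂]
  [TopologicalSpace M]
  [ChartedSpace (ModelProd (EuclideanSpace ℝ (Fin p)) (EuclideanHalfSpace 1)) M]
  [IsManifold (collarModel p) ∞ M] [CompactSpace N] [T2Space M]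
  {oN : ManifoldOrientation (𝓡 p) N} {o : ManifoldOrientation (collarModel p) M}
  {α : BoundaryCollar p N₀ M} {β γ : BoundaryCollar p N M} {δ : BoundaryCollar p N₂ M}

theorem GluableCollars.mem_U (h : GluableCollars oN o β γ)
    (hd : Disjoint (α.toFun '' collarDomain N₀)
      (β.toFun '' collarDomain N ∪ γ.toFun '' collarDomain N)) :
    ∀ q ∈ collarDomain N₀, α.toFun q ∈ h.gluing.U := by
  intro q hq h'
  refine Set.disjoint_left.1 hd ⟨q, hq, rfl⟩ ?_
  rcases h' with ⟨x, hx⟩ | ⟨x, hx⟩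
  exacts [Or.inl ⟨_, mem_collarDomain_zero x, hx⟩, Or.inr ⟨_, mem_collarDomain_zero x, hx⟩]

theorem GluableCollars.notMem_D (h : GluableCollars oN o β γ)
    (hd : Disjoint (α.toFun '' collarDomain N₀)
      (β.toFun '' collarDomain N ∪ γ.toFun '' collarDomain N)) :
    ∀ q ∈ collarDomain N₀, α.toFun q ∉ h.gluing.D := by
  intro q hq h'
  refine Set.disjoint_left.1 hd ⟨q, hq, rfl⟩ ?_
  exact h'.imp (fun ⟨q, hq, h⟩ => ⟨q, openCollarDomain_subset hq, h⟩)
    fun ⟨q, hq, h⟩ => ⟨q, openCollarDomain_subset hq, h⟩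

/-- The boundary of a glued manifold consists of the collars which are not glued. -/
theorem GluableCollars.boundary_glued (h : GluableCollars oN o β γ)
    (hα : Disjoint (α.toFun '' collarDomain N₀)
      (β.toFun '' collarDomain N ∪ γ.toFun '' collarDomain N))
    (hδ : Disjoint (δ.toFun '' collarDomain N₂)
      (β.toFun '' collarDomain N ∪ γ.toFun '' collarDomain N))
    (hb : (collarModel p).boundary M =
      (Set.range α.base ∪ Set.range β.base) ∪ (Set.range γ.base ∪ Set.range δ.base))
    {α' : BoundaryCollar p N₀ h.gluing.Glued} {δ' : BoundaryCollar p N₂ h.gluing.Glued}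
    (hα' : ∀ q (hq : q ∈ collarDomain N₀),
      α'.toFun q = h.gluing.toGlued ⟨α.toFun q, h.mem_U hα q hq⟩)
    (hδ' : ∀ q (hq : q ∈ collarDomain N₂),
      δ'.toFun q = h.gluing.toGlued ⟨δ.toFun q, h.mem_U hδ q hq⟩) :
    (collarModel p).boundary h.gluing.Glued = Set.range α'.base ∪ Set.range δ'.base := by
  have hα₀ : ∀ x, α'.base x = _ := fun x => hα' _ (mem_collarDomain_zero x)
  have hδ₀ : ∀ x, δ'.base x = _ := fun x => hδ' _ (mem_collarDomain_zero x)
  ext w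
  obtain ⟨⟨m, hm⟩, rfl⟩ := h.gluing.toGlued_surjective w
  constructor
  · intro hw
    have hw' : m ∈ (collarModel p).boundary M := (h.gluing.isBoundaryPoint_toGlued hm).1 hw
    rw [hb] at hw'
    rcases hw' with (⟨x, rfl⟩ | hx) | (hx | ⟨x, rfl⟩)
    · exact Or.inl ⟨x, hα₀ x⟩
    · exact (hm (Or.inl hx)).elim
    · exact (hm (Or.inr hx)).elim
    · exact Or.inr ⟨x, hδ₀ x⟩
  · rintro (⟨x, hx⟩ | ⟨x, hx⟩) <;> rw [← hx]
    · have hx' : α.base x ∈ (collarModel p).boundary M := by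
        rw [hb]
        exact Or.inl (Or.inl ⟨x, rfl⟩)
      have h' := (h.gluing.isBoundaryPoint_toGlued (h.mem_U hα _ (mem_collarDomain_zero x))).2 hx'
      rw [hα₀ x]
      exact h'
    · have hx' : δ.base x ∈ (collarModel p).boundary M := by
        rw [hb]
        exact Or.inr (Or.inr ⟨x, rfl⟩)
      have h' := (h.gluing.isBoundaryPoint_toGlued (h.mem_U hδ _ (mem_collarDomain_zero x))).2 hx'
      rw [hδ₀ x]
      exact h'

variable [IsManifold (𝓡 p) 1 N₀] [IsManifold (𝓡 p) 1 N₂]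
  {o₀ : ManifoldOrientation (𝓡 p) N₀} {o₂ : ManifoldOrientation (𝓡 p) N₂}

/-- The glued manifold is the bordism: `α` and `δ` descend to it and exhaust its boundary, and `hΦ`
lets `Φ` descend. -/
theorem GluableCollars.bordantMaps [CompactSpace M] (h : GluableCollars oN o β γ)
    (hα : Disjoint (α.toFun '' collarDomain N₀)
      (β.toFun '' collarDomain N ∪ γ.toFun '' collarDomain N))
    (hδ : Disjoint (δ.toFun '' collarDomain N₂)
      (β.toFun '' collarDomain N ∪ γ.toFun '' collarDomain N))
    (hαδ : Disjoint (α.toFun '' collarDomain N₀) (δ.toFun '' collarDomain N₂))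
    (hb : (collarModel p).boundary M =
      (Set.range α.base ∪ Set.range β.base) ∪ (Set.range γ.base ∪ Set.range δ.base))
    (h₀ : ∀ q ∈ collarDomain N₀, 0 < α.orientedJacobian o₀ o q)
    (h₂ : ∀ q ∈ collarDomain N₂, δ.orientedJacobian o₂ o q < 0)
    {E : Type*} [TopologicalSpace E] (Φ : C(M, E))
    (hΦ : ∀ q ∈ openCollarDomain N, Φ (β.toFun q) = Φ (γ.toFun (collarFlip q))) :
    BordantMaps o₀ o₂ (Φ ∘ α.base) (Φ ∘ δ.base) := by
  obtain ⟨α', hα', hα''⟩ := h.gluing.exists_collar (oN := o₀) α (h.mem_U hα) (h.notMem_D hα)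
  obtain ⟨δ', hδ', hδ''⟩ := h.gluing.exists_collar (oN := o₂) δ (h.mem_U hδ) (h.notMem_D hδ)
  let Ψ : h.gluing.Glued → E := Quotient.lift (fun u : h.gluing.U => Φ u.1) (by
    rintro ⟨x, hx⟩ ⟨y, hy⟩ (h' | ⟨h', hy'⟩)
    · rw [h']
    · dsimp only at h' hy' ⊢
      subst hy'
      change Φ x = Φ (collarSwap β γ x)
      rcases h' with ⟨q, hq, rfl⟩ | ⟨q, hq, rfl⟩
      · rw [collarSwap_left β γ hq, hΦ q hq]
      · rw [collarSwap_right h.disjoint hq, hΦ _ (collarFlip_mem hq), collarFlip_flip hq])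
  have hΨ : Continuous Ψ := (Φ.continuous.comp continuous_subtype_val).quotient_lift _
  refine ⟨⟨h.gluing.Glued, h.gluing.orientation, α', δ', ?_,
    h.boundary_glued hα hδ hb hα' hδ', ?_, ?_⟩, ⟨Ψ, hΨ⟩, ?_, ?_⟩
  · rw [Set.disjoint_left]
    rintro _ ⟨q, hq, rfl⟩ ⟨q', hq', h'⟩
    rw [hα' q hq, hδ' q' hq'] at h'
    rcases GluingInvolution.toGlued_eq.1 h' with h' | ⟨h', -⟩
    · exact Set.disjoint_left.1 hαδ ⟨q, hq, congrArg Subtype.val h'⟩ ⟨q', hq', rfl⟩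
    · exact h.notMem_D hδ q' hq' h'
  · intro q hq
    obtain ⟨c, hc, h'⟩ := hα'' q hq
    rw [h']
    exact mul_pos hc (h₀ q hq)
  · intro q hq
    obtain ⟨c, hc, h'⟩ := hδ'' q hq
    rw [h']
    exact mul_neg_of_pos_of_neg hc (h₂ q hq)
  · intro x
    exact congrArg Ψ (hα' _ (mem_collarDomain_zero x))
  · intro x
    exact congrArg Ψ (hδ' _ (mem_collarDomain_zero x))

/-- The inner halves of the two collars of `N` are glued. The given maps are first composed with the
collapses of the full collars, which makes them agree along the glued part; as the collapses fix
everything outside these collars, the values on `N₀` and `N₂` do not change. -/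
theorem BordantMaps.trans {E : Type*} [TopologicalSpace E] {s₀ : N₀ → E} {s : N → E}
    {s₂ : N₂ → E} (h₁ : BordantMaps o₀ oN s₀ s) (h₂ : BordantMaps oN o₂ s s₂) :
    BordantMaps o₀ o₂ s₀ s₂ := by
  obtain ⟨b₁, Φ₁, h₁₀, h₁₁⟩ := h₁
  obtain ⟨b₂, Φ₂, h₂₀, h₂₁⟩ := h₂
  let α : BoundaryCollar p N₀ (b₁.W ⊕ b₂.W) := b₁.collar₀.inl
  let β : BoundaryCollar p N (b₁.W ⊕ b₂.W) := b₁.collar₁.halve.inl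
  let γ : BoundaryCollar p N (b₁.W ⊕ b₂.W) := b₂.collar₀.halve.inr
  let δ : BoundaryCollar p N₂ (b₁.W ⊕ b₂.W) := b₂.collar₁.inr
  have hβγ : GluableCollars oN (b₁.orientation.sum b₂.orientation) β γ := by
    refine ⟨disjoint_image_inl_inr _ _ _ _, fun q hq => ?_, fun q hq => ?_, fun q hq => ?_,
      fun q hq => ?_⟩
    · rw [BoundaryCollar.orientedJacobian_inl _ _ _ _ hq,
        BoundaryCollar.orientedJacobian_halve _ _ _ hq]
      exact mul_neg_of_neg_of_pos (b₁.reverses₁ _ (halfLineHalve_lt hq)) (by norm_num)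
    · rw [BoundaryCollar.orientedJacobian_inr _ _ _ _ hq,
        BoundaryCollar.orientedJacobian_halve _ _ _ hq]
      exact mul_pos (b₂.preserves₀ _ (halfLineHalve_lt hq)) (by norm_num)
    · exact continuous_inl.continuousAt.comp (b₁.collar₁.continuousAt_halve hq)
    · exact continuous_inr.continuousAt.comp (b₂.collar₀.continuousAt_halve hq)
  have hd₁ := b₁.disjoint_collars.mono_right b₁.collar₁.image_halve_subset
  have hd₂ := b₂.disjoint_collars.symm.mono_right b₂.collar₀.image_halve_subset
  let Φ : C(b₁.W ⊕ b₂.W, E) :=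
    ⟨Sum.elim (Φ₁ ∘ b₁.collar₁.collapseFun) (Φ₂ ∘ b₂.collar₀.collapseFun),
      (Φ₁.continuous.comp b₁.collar₁.continuous_collapseFun).sumElim
        (Φ₂.continuous.comp b₂.collar₀.continuous_collapseFun)⟩
  have hΦ : ∀ q ∈ openCollarDomain N, Φ (β.toFun q) = Φ (γ.toFun (collarFlip q)) := by
    intro q hq
    change Φ₁ (b₁.collar₁.collapseFun (b₁.collar₁.halve.toFun q)) =
      Φ₂ (b₂.collar₀.collapseFun (b₂.collar₀.halve.toFun (collarFlip q)))
    rw [BoundaryCollar.collapseFun_halve _ (openCollarDomain_subset hq),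
      BoundaryCollar.collapseFun_halve _ (openCollarDomain_subset (collarFlip_mem hq)), h₁₁, h₂₀]
    rfl
  have hmain := hβγ.bordantMaps (α := α) (δ := δ) (o₀ := o₀) (o₂ := o₂)
    (Set.disjoint_union_right.2 ⟨disjoint_image_comp Sum.inl_injective hd₁,
      disjoint_image_inl_inr _ _ _ _⟩)
    (Set.disjoint_union_right.2 ⟨(disjoint_image_inl_inr _ _ _ _).symm,
      disjoint_image_comp Sum.inr_injective hd₂⟩)
    (disjoint_image_inl_inr _ _ _ _) ?_ ?_ ?_ Φ hΦ
  · convert hmain using 1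
    · funext x
      change s₀ x = Φ₁ (b₁.collar₁.collapseFun (b₁.collar₀.base x))
      rw [BoundaryCollar.collapseFun_of_notMem, h₁₀]
      exact Set.disjoint_left.1 b₁.disjoint_collars ⟨_, mem_collarDomain_zero x, rfl⟩
    · funext x
      change s₂ x = Φ₂ (b₂.collar₀.collapseFun (b₂.collar₁.base x))
      rw [BoundaryCollar.collapseFun_of_notMem, h₂₁]
      exact Set.disjoint_right.1 b₂.disjoint_collars ⟨_, mem_collarDomain_zero x, rfl⟩
  · rw [ModelWithCorners.boundary_disjointUnion, b₁.boundary_eq, b₂.boundary_eq, Set.image_union,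
      Set.image_union, ← Set.range_comp, ← Set.range_comp, ← Set.range_comp, ← Set.range_comp]
    have hβ : β.base = Sum.inl ∘ b₁.collar₁.base :=
      funext fun x => congrArg Sum.inl (b₁.collar₁.halve_base x)
    have hγ : γ.base = Sum.inr ∘ b₂.collar₀.base :=
      funext fun x => congrArg Sum.inr (b₂.collar₀.halve_base x)
    rw [hβ, hγ]
    rfl
  · intro q hq
    rw [BoundaryCollar.orientedJacobian_inl _ _ _ _ hq]
    exact b₁.preserves₀ q hq
  · intro q hq
    rw [BoundaryCollar.orientedJacobian_inr _ _ _ _ hq]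
    exact b₂.reverses₁ q hq

end Transitivity

/-! ### The structural diffeomorphisms of disjoint unions preserve orientations. -/

section SumDiffeomorphisms

variable {p : ℕ} {M N P : Type*} [TopologicalSpace M] [ChartedSpace (EuclideanSpace ℝ (Fin p)) M]
  [TopologicalSpace N] [ChartedSpace (EuclideanSpace ℝ (Fin p)) N]
  [TopologicalSpace P] [ChartedSpace (EuclideanSpace ℝ (Fin p)) P]

theorem signedJacobian_comp_inl {s : M → ℤˣ} {t : N → ℤˣ} {u : P → ℤˣ} {φ : M ⊕ N → P} {x : M}
    (hφ : IsLocalDiffeomorphAt (𝓡 p) (𝓡 p) ∞ φ (Sum.inl x)) :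
    signedJacobian (𝓡 p) (𝓡 p) (Sum.elim s t) u φ (Sum.inl x) =
      signedJacobian (𝓡 p) (𝓡 p) s u (φ ∘ Sum.inl) x := by
  rw [IsLocalDiffeomorphAt.signedJacobian_comp s (Sum.elim s t) u hφ (isLocalDiffeomorphAt_inl x),
    signedJacobian_inl, mul_one]

theorem signedJacobian_comp_inr {s : M → ℤˣ} {t : N → ℤˣ} {u : P → ℤˣ} {φ : M ⊕ N → P} {x : N}
    (hφ : IsLocalDiffeomorphAt (𝓡 p) (𝓡 p) ∞ φ (Sum.inr x)) :
    signedJacobian (𝓡 p) (𝓡 p) (Sum.elim s t) u φ (Sum.inr x) =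
      signedJacobian (𝓡 p) (𝓡 p) t u (φ ∘ Sum.inr) x := by
  rw [IsLocalDiffeomorphAt.signedJacobian_comp t (Sum.elim s t) u hφ (isLocalDiffeomorphAt_inr x),
    signedJacobian_inr, mul_one]

theorem signedJacobian_sumComm (s : M → ℤˣ) (t : N → ℤˣ) (x : M ⊕ N) :
    signedJacobian (𝓡 p) (𝓡 p) (Sum.elim s t) (Sum.elim t s)
      (Diffeomorph.sumComm (𝓡 p) M ∞ N) x = 1 := by
  have h := (Diffeomorph.sumComm (𝓡 p) M ∞ N).isLocalDiffeomorphAt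
  rcases x with x | x
  · rw [signedJacobian_comp_inl (h _), Diffeomorph.sumComm_inl, signedJacobian_inr]
  · rw [signedJacobian_comp_inr (h _), Diffeomorph.sumComm_inr, signedJacobian_inl]

theorem signedJacobian_sumEmpty [IsEmpty N] (s : M → ℤˣ) (t : N → ℤˣ) (x : M ⊕ N) :
    signedJacobian (𝓡 p) (𝓡 p) (Sum.elim s t) s
      (Diffeomorph.sumEmpty (𝓡 p) M (M' := N) ∞) x = 1 := by
  rcases x with x | x
  · rw [signedJacobian_comp_inl (Diffeomorph.isLocalDiffeomorphAt _ _)]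
    exact signedJacobian_id s x
  · exact isEmptyElim x

theorem signedJacobian_inr_comp (s : M → ℤˣ) (t : N → ℤˣ) (u : P → ℤˣ) {g : P → N} {x : P}
    (hg : IsLocalDiffeomorphAt (𝓡 p) (𝓡 p) ∞ g x) :
    signedJacobian (𝓡 p) (𝓡 p) u (Sum.elim s t) (Sum.inr ∘ g : P → M ⊕ N) x =
      signedJacobian (𝓡 p) (𝓡 p) u t g x := by
  rw [IsLocalDiffeomorphAt.signedJacobian_comp u t _ (isLocalDiffeomorphAt_inr (g x)) hg,
    signedJacobian_inr, one_mul]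

theorem signedJacobian_sumAssoc (s : M → ℤˣ) (t : N → ℤˣ) (u : P → ℤˣ) (x : (M ⊕ N) ⊕ P) :
    signedJacobian (𝓡 p) (𝓡 p) (Sum.elim (Sum.elim s t) u) (Sum.elim s (Sum.elim t u))
      (Diffeomorph.sumAssoc (𝓡 p) M ∞ N P) x = 1 := by
  have h := (Diffeomorph.sumAssoc (𝓡 p) M ∞ N P).isLocalDiffeomorphAt
  have h' : ∀ y, IsLocalDiffeomorphAt (𝓡 p) (𝓡 p) ∞
      (Diffeomorph.sumAssoc (𝓡 p) M ∞ N P ∘ Sum.inl) y := fun y =>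
    (isLocalDiffeomorphAt_inl y).comp _ _ (h _)
  rcases x with (x | x) | x
  · rw [signedJacobian_comp_inl (h _), signedJacobian_comp_inl (h' _)]
    exact signedJacobian_inl _ _ _
  · rw [signedJacobian_comp_inl (h _), signedJacobian_comp_inr (h' _)]
    exact (signedJacobian_inr_comp s (Sum.elim t u) t (isLocalDiffeomorphAt_inl x)).trans
      (signedJacobian_inl _ _ _)
  · rw [signedJacobian_comp_inr (h _)]
    exact (signedJacobian_inr_comp s (Sum.elim t u) u (isLocalDiffeomorphAt_inr x)).trans
      (signedJacobian_inr _ _ _)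

end SumDiffeomorphisms

/-! ### Nielsen equivalence as bordism over the Nielsen space. -/

section NielsenSpace

variable {X Z : Type*} [TopologicalSpace X] [TopologicalSpace Z]

/-- The space of triples of a point `x` of `X`, a point `y` of `Y` and a path from `f x` to `y`. -/
def NielsenSpace (f : C(X, Z)) (Y : Set Z) :=
  {e : X × Y × C(unitInterval, Z) // e.2.2 0 = f e.1 ∧ e.2.2 1 = e.2.1}

instance (f : C(X, Z)) (Y : Set Z) : TopologicalSpace (NielsenSpace f Y) :=
  inferInstanceAs (TopologicalSpace
    {e : X × Y × C(unitInterval, Z) // e.2.2 0 = f e.1 ∧ e.2.2 1 = e.2.1})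

/-- The points of `f⁻¹(Y)`, as constant paths. -/
def NielsenSpace.const (f : C(X, Z)) (Y : Set Z) (c : f ⁻¹' Y) : NielsenSpace f Y :=
  ⟨(c.1, ⟨f c.1, c.2⟩, ContinuousMap.const _ (f c.1)), rfl, rfl⟩

theorem NielsenSpace.continuous_const (f : C(X, Z)) (Y : Set Z) :
    Continuous (NielsenSpace.const f Y) := by
  refine Continuous.subtype_mk (continuous_subtype_val.prodMk (Continuous.prodMk ?_ ?_)) _
  · fun_prop
  · exact ContinuousMap.continuous_const'.comp (by fun_prop)

variable {p : ℕ} {f : C(X, Z)} {Y : Set Z}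

/-- Nielsen equivalence is bordism of maps to the Nielsen space. -/
theorem nielsenEquiv_iff {s₀ s₁ : OrientedSingularManifold p (f ⁻¹' Y)} :
    NielsenEquiv f Y s₀ s₁ ↔ BordantMaps s₀.orientation s₁.orientation
      (NielsenSpace.const f Y ∘ s₀.f) (NielsenSpace.const f Y ∘ s₁.f) := by
  constructor
  · rintro ⟨b, h, k, h₀, h₁, k₀, k₁, ⟨H⟩⟩
    -- Currying turns the homotopy into a continuous family of paths from `f (h w)` to `k w`.
    let H' : C(b.W, C(unitInterval, Z)) :=
      (H.toContinuousMap.comp ContinuousMap.prodSwap).curry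
    let Φ : C(b.W, NielsenSpace f Y) :=
      ⟨fun w => ⟨(h w, k w, H' w), H.apply_zero w, H.apply_one w⟩, by
        refine Continuous.subtype_mk ?_ _
        fun_prop⟩
    refine ⟨b, Φ, fun x => Subtype.ext (Prod.ext (h₀ x) (Prod.ext (Subtype.ext (k₀ x)) ?_)),
      fun x => Subtype.ext (Prod.ext (h₁ x) (Prod.ext (Subtype.ext (k₁ x)) ?_))⟩
    -- On the boundary the path is constant because the homotopy is relative to it.
    · ext t
      have hb : b.collar₀.base x ∈ (collarModel p).boundary b.W := by
        rw [b.boundary_eq]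
        exact Or.inl ⟨x, rfl⟩
      exact (H.eq_fst t hb).trans (congrArg f (h₀ x))
    · ext t
      have hb : b.collar₁.base x ∈ (collarModel p).boundary b.W := by
        rw [b.boundary_eq]
        exact Or.inr ⟨x, rfl⟩
      exact (H.eq_fst t hb).trans (congrArg f (h₁ x))
  · rintro ⟨b, Φ, h₀, h₁⟩
    have hΦ : Continuous fun w => (Φ w).1 := continuous_subtype_val.comp Φ.continuous
    let h : C(b.W, X) := ⟨fun w => (Φ w).1.1, hΦ.fst⟩
    let k : C(b.W, Y) := ⟨fun w => (Φ w).1.2.1, hΦ.snd.fst⟩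
    let H : C(b.W, C(unitInterval, Z)) := ⟨fun w => (Φ w).1.2.2, hΦ.snd.snd⟩
    have hH : Continuous fun q : unitInterval × b.W => H q.2 q.1 :=
      (ContinuousMap.continuous_uncurry_of_continuous H).comp continuous_swap
    refine ⟨b, h, k, fun x => ?_, fun x => ?_, fun x => ?_, fun x => ?_,
      ⟨⟨⟨⟨fun q => H q.2 q.1, hH⟩, fun w => (Φ w).2.1, fun w => (Φ w).2.2⟩, ?_⟩⟩⟩
    · exact congrArg (fun e : NielsenSpace f Y => e.1.1) (h₀ x)
    · exact congrArg (fun e : NielsenSpace f Y => e.1.1) (h₁ x)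
    · exact congrArg (fun e : NielsenSpace f Y => (e.1.2.1 : Z)) (h₀ x)
    · exact congrArg (fun e : NielsenSpace f Y => (e.1.2.1 : Z)) (h₁ x)
    · intro t w hw
      rw [b.boundary_eq] at hw
      -- Boundary points are sent to constant paths, so the uncurried homotopy is stationary there.
      have hc : ∃ c, Φ w = NielsenSpace.const f Y c := by
        rcases hw with ⟨x, rfl⟩ | ⟨x, rfl⟩
        exacts [⟨_, h₀ x⟩, ⟨_, h₁ x⟩]
      obtain ⟨c, hc⟩ := hc
      change (Φ w).1.2.2 t = f (Φ w).1.1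
      rw [hc]
      rfl

theorem nielsenEquiv_of_diffeomorph {s s' : OrientedSingularManifold p (f ⁻¹' Y)}
    (φ : Diffeomorph (𝓡 p) (𝓡 p) s'.M s.M ∞)
    (hφ : ∀ x, 0 < signedJacobian (𝓡 p) (𝓡 p) s'.orientation.sign s.orientation.sign φ x)
    (h : ∀ x, s.f (φ x) = s'.f x) : NielsenEquiv f Y s' s :=
  nielsenEquiv_iff.2 (.of_diffeomorph φ hφ ((NielsenSpace.continuous_const f Y).comp s.hf)
    fun x => congrArg _ (h x))

theorem nielsenEquiv_refl (s : OrientedSingularManifold p (f ⁻¹' Y)) : NielsenEquiv f Y s s :=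
  nielsenEquiv_iff.2 (.refl _ ((NielsenSpace.continuous_const f Y).comp s.hf))

theorem equivalence_nielsenEquiv : Equivalence (NielsenEquiv (p := p) f Y) where
  refl := nielsenEquiv_refl
  symm h := nielsenEquiv_iff.2 (nielsenEquiv_iff.1 h).symm
  trans h h' := nielsenEquiv_iff.2 ((nielsenEquiv_iff.1 h).trans (nielsenEquiv_iff.1 h'))

theorem NielsenEquiv.sum {s₀ s₁ t₀ t₁ : OrientedSingularManifold p (f ⁻¹' Y)}
    (hs : NielsenEquiv f Y s₀ s₁) (ht : NielsenEquiv f Y t₀ t₁) :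
    NielsenEquiv f Y (s₀.sum t₀) (s₁.sum t₁) := by
  have h := (nielsenEquiv_iff.1 hs).sum (nielsenEquiv_iff.1 ht)
  rw [← Sum.comp_elim, ← Sum.comp_elim] at h
  exact nielsenEquiv_iff.2 h

end NielsenSpace

/-! ### The group of Nielsen classes. -/

section Group

theorem BoundaryCollar.orientedJacobian_neg {p : ℕ} {N W : Type*} [TopologicalSpace N]
    [ChartedSpace (EuclideanSpace ℝ (Fin p)) N] [IsManifold (𝓡 p) 1 N] [TopologicalSpace W]
    [ChartedSpace (ModelProd (EuclideanSpace ℝ (Fin p)) (EuclideanHalfSpace 1)) W]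
    [IsManifold (collarModel p) 1 W] (oN : ManifoldOrientation (𝓡 p) N)
    (oW : ManifoldOrientation (collarModel p) W) (θ : BoundaryCollar p N W)
    (q : N × EuclideanHalfSpace 1) :
    θ.orientedJacobian oN.neg oW.neg q = θ.orientedJacobian oN oW q := by
  rw [orientedJacobian_eq, orientedJacobian_eq]
  refine (signedJacobian_neg_left (fun q : N × EuclideanHalfSpace 1 => oN.sign q.1)
    oW.neg.sign θ.toFun q).trans ?_
  rw [neg_eq_iff_eq_neg]
  exact signedJacobian_neg_right _ oW.sign θ.toFun q

variable {p : ℕ} {A : Type*} [TopologicalSpace A]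

/-- The singular manifold with the opposite orientation. -/
def OrientedSingularManifold.neg (s : OrientedSingularManifold p A) :
    OrientedSingularManifold p A where
  toSingularManifold := s.toSingularManifold
  t2Space := s.t2Space
  orientation := s.orientation.neg

/-- The empty singular manifold. -/
def OrientedSingularManifold.empty (p : ℕ) (A : Type*) [TopologicalSpace A] :
    OrientedSingularManifold p A :=
  letI : ChartedSpace (EuclideanSpace ℝ (Fin p)) Empty := ChartedSpace.empty _ _
  { toSingularManifold := SingularManifold.empty A Empty (𝓡 p)
    t2Space := inferInstanceAs (T2Space Empty)
    orientation := ⟨fun x : Empty => x.elim, fun x : Empty => x.elim⟩ }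

instance : IsEmpty (OrientedSingularManifold.empty p A).M := inferInstanceAs (IsEmpty Empty)

variable {X Z : Type*} [TopologicalSpace X] [TopologicalSpace Z] {f : C(X, Z)} {Y : Set Z}

/-- The bordism with all orientations reversed. -/
def OrientedBordism.neg {N₀ N₁ : Type*}
    [TopologicalSpace N₀] [ChartedSpace (EuclideanSpace ℝ (Fin p)) N₀] [IsManifold (𝓡 p) 1 N₀]
    [TopologicalSpace N₁] [ChartedSpace (EuclideanSpace ℝ (Fin p)) N₁] [IsManifold (𝓡 p) 1 N₁]
    {o₀ : ManifoldOrientation (𝓡 p) N₀} {o₁ : ManifoldOrientation (𝓡 p) N₁}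
    (b : OrientedBordism p N₀ N₁ o₀ o₁) : OrientedBordism p N₀ N₁ o₀.neg o₁.neg where
  W := b.W
  orientation := b.orientation.neg
  collar₀ := b.collar₀
  collar₁ := b.collar₁
  disjoint_collars := b.disjoint_collars
  boundary_eq := b.boundary_eq
  preserves₀ q hq := by
    rw [BoundaryCollar.orientedJacobian_neg]
    exact b.preserves₀ q hq
  reverses₁ q hq := by
    rw [BoundaryCollar.orientedJacobian_neg]
    exact b.reverses₁ q hq

theorem NielsenEquiv.neg {s₀ s₁ : OrientedSingularManifold p (f ⁻¹' Y)}
    (hs : NielsenEquiv f Y s₀ s₁) : NielsenEquiv f Y s₀.neg s₁.neg := by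
  obtain ⟨b, Φ, h₀, h₁⟩ := nielsenEquiv_iff.1 hs
  exact nielsenEquiv_iff.2 ⟨b.neg, Φ, h₀, h₁⟩

namespace NielsenClass

/-- `Quot.eq` yields the generated equivalence relation, which is the relation itself once
transitivity is known. -/
theorem mk_eq_mk {s t : OrientedSingularManifold p (f ⁻¹' Y)} :
    mk f Y s = mk f Y t ↔ NielsenEquiv f Y s t :=
  Quot.eq.trans (by rw [equivalence_nielsenEquiv.eqvGen_eq])

section Operations

/-- Addition of Nielsen classes is disjoint union. -/
abbrev hasAdd : Add (NielsenClass p f Y) :=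
  ⟨Quot.map₂ OrientedSingularManifold.sum (fun s _ _ h => (nielsenEquiv_refl s).sum h)
    fun _ _ s h => h.sum (nielsenEquiv_refl s)⟩

/-- The class of the empty manifold. -/
abbrev hasZero : Zero (NielsenClass p f Y) := ⟨mk f Y (.empty p _)⟩

/-- The negative of a class is given by the opposite orientation. -/
abbrev hasNeg : Neg (NielsenClass p f Y) :=
  ⟨Quot.map OrientedSingularManifold.neg fun _ _ => NielsenEquiv.neg⟩

attribute [local instance] hasAdd hasZero hasNeg

/-- The group of Nielsen classes. -/
abbrev addCommGroup : AddCommGroup (NielsenClass p f Y) where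
  toAddGroup := AddGroup.ofRightAxioms
    (by
      rintro ⟨s⟩ ⟨t⟩ ⟨u⟩
      exact mk_eq_mk.2 (nielsenEquiv_of_diffeomorph (s := s.sum (t.sum u)) (s' := (s.sum t).sum u)
        (Diffeomorph.sumAssoc (𝓡 p) s.M ∞ t.M u.M)
        (fun x => one_pos.trans_eq (signedJacobian_sumAssoc _ _ _ x).symm)
        (by rintro ((x | x) | x) <;> rfl)))
    (by
      rintro ⟨s⟩
      exact mk_eq_mk.2 (nielsenEquiv_of_diffeomorph (s' := s.sum (.empty p _)) (s := s)
        (Diffeomorph.sumEmpty (𝓡 p) s.M ∞)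
        (fun x => one_pos.trans_eq (signedJacobian_sumEmpty _ _ x).symm)
        (by rintro (x | x); exacts [rfl, isEmptyElim x])))
    (by
      rintro ⟨s⟩
      refine mk_eq_mk.2 (nielsenEquiv_iff.2 ?_)
      have h := BordantMaps.add_neg s.orientation
        (OrientedSingularManifold.empty p (f ⁻¹' Y)).orientation
        ((NielsenSpace.continuous_const f Y).comp s.hf)
        (s' := NielsenSpace.const f Y ∘ (OrientedSingularManifold.empty p (f ⁻¹' Y)).f)
      rw [← Sum.comp_elim] at h
      exact h)
  add_comm := by
    rintro ⟨s⟩ ⟨t⟩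
    exact mk_eq_mk.2 (nielsenEquiv_of_diffeomorph (s := t.sum s) (s' := s.sum t)
      (Diffeomorph.sumComm (𝓡 p) s.M ∞ t.M)
      (fun x => one_pos.trans_eq (signedJacobian_sumComm _ _ x).symm)
      (by rintro (x | x) <;> rfl))

end Operations

attribute [local instance] addCommGroup

theorem mk_add_mk (s t : OrientedSingularManifold p (f ⁻¹' Y)) :
    mk f Y s + mk f Y t = mk f Y (s.sum t) :=
  rfl

variable {X' : Type*} [TopologicalSpace X'] {f' : C(X', Z)}

/-- Both sides live on the same oriented manifold with the same map, so the cylinder of the identity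
relates them. -/
theorem map_add (k : C(X, X')) (hk : f'.comp k = f) (a b : NielsenClass p f Y) :
    map Y k hk (a + b) = map Y k hk a + map Y k hk b := by
  rcases a with ⟨s⟩
  rcases b with ⟨t⟩
  exact mk_eq_mk.2 (nielsenEquiv_of_diffeomorph
    (s' := (s.sum t).map (preimageMap Y k hk))
    (s := (s.map (preimageMap Y k hk)).sum (t.map (preimageMap Y k hk)))
    (Diffeomorph.refl (𝓡 p) (s.M ⊕ t.M) ∞)
    (fun x => one_pos.trans_eq (signedJacobian_id (s.orientation.sum t.orientation).sign x).symm)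
    (by rintro (x | x) <;> rfl))

end NielsenClass

end Group

/-! ### Functoriality and deformation retracts. -/

section Functoriality

variable {p : ℕ} {X X' X'' Z : Type*} [TopologicalSpace X] [TopologicalSpace X']
  [TopologicalSpace X''] [TopologicalSpace Z] {f : C(X, Z)} {f' : C(X', Z)} {f'' : C(X'', Z)}
  {Y : Set Z}

namespace NielsenClass

attribute [local instance] addCommGroup

/-- The homomorphism of groups of Nielsen classes induced by a map. -/
def mapHom (k : C(X, X')) (hk : f'.comp k = f) : NielsenClass p f Y →+ NielsenClass p f' Y :=
  .mk' (map Y k hk) (map_add k hk)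

theorem map_map (k : C(X, X')) (hk : f'.comp k = f) (k' : C(X', X'')) (hk' : f''.comp k' = f')
    (l : C(X, X'')) (hl : f''.comp l = f) (h : k'.comp k = l) (a : NielsenClass p f Y) :
    map Y k' hk' (map Y k hk a) = map Y l hl a := by
  subst h
  rcases a with ⟨s⟩
  rfl

/-- The inclusion of a strong deformation retract induces a monomorphism. -/
theorem map_injective (k : C(X, X')) (hk : f'.comp k = f) (r : C(X', X))
    (hr : r.comp k = ContinuousMap.id X)
    (hkr : (k.comp r).HomotopicRel (ContinuousMap.id X') (Set.range k)) :
    Function.Injective (map (p := p) Y k hk) := by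
  rintro ⟨s⟩ ⟨t⟩ hst
  obtain ⟨b, h, l, h₀, h₁, l₀, l₁, H⟩ := mk_eq_mk.1 hst
  subst hk
  have hr' : ∀ x, r (k x) = x := DFunLike.congr_fun hr
  refine mk_eq_mk.2 ⟨b, r.comp h, l, fun x => ?_, fun x => ?_, l₀, l₁, .trans ?_ H⟩
  · exact (congrArg r (h₀ x)).trans (hr' _)
  · exact (congrArg r (h₁ x)).trans (hr' _)
  -- The deformation `L` along `h`, followed by `f'`, joins `f' k r h` to `f' h`. It is stationary
  -- on the boundary, which `h` sends into the range of `k`; `H` then leads on to the map to `Y`.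
  · obtain ⟨L⟩ := hkr
    refine ⟨⟨⟨⟨fun q => f' (L (q.1, h q.2)), by fun_prop⟩, fun w => ?_, fun w => ?_⟩, ?_⟩⟩
    · exact congrArg f' (L.apply_zero (h w))
    · exact congrArg f' (L.apply_one (h w))
    · intro t' w hw
      have hw' : h w ∈ Set.range k := by
        rw [b.boundary_eq] at hw
        rcases hw with ⟨x, rfl⟩ | ⟨x, rfl⟩
        exacts [⟨_, (h₀ x).symm⟩, ⟨_, (h₁ x).symm⟩]
      exact congrArg f' (L.eq_fst t' hw')

end NielsenClass

/-- A self map of the interval gives a map of `I × X` which is homotopic to the identity relative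
to its fixed points. -/
theorem homotopicRel_id_of_interval (ρ : C(unitInterval, unitInterval))
    {k : C(unitInterval × X, unitInterval × X)} (hk : ∀ q, k q = (ρ q.1, q.2))
    {S : Set (unitInterval × X)} (hS : ∀ q ∈ S, k q = q) :
    k.HomotopicRel (ContinuousMap.id _) S := by
  have hmem : ∀ u t : unitInterval, (1 - (u : ℝ)) * ρ t + u * t ∈ unitInterval := by
    intro u t
    exact (convex_Icc (0 : ℝ) 1) (ρ t).2 t.2 (by linarith [u.2.2]) u.2.1 (by ring)
  refine ⟨⟨⟨⟨fun q => (⟨_, hmem q.1 q.2.1⟩, q.2.2), by fun_prop⟩, fun q => ?_, fun q => ?_⟩, ?_⟩⟩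
  · rw [hk]
    exact Prod.ext (Subtype.ext (by simp)) rfl
  · exact Prod.ext (Subtype.ext (by simp)) rfl
  · intro u q hq
    have h := hS q hq
    have h' : ρ q.1 = q.1 := by
      rw [hk] at h
      exact congrArg Prod.fst h
    rw [h]
    refine Prod.ext (Subtype.ext ?_) rfl
    change (1 - (u : ℝ)) * ρ q.1 + u * q.1 = q.1
    rw [h']
    ring

/-- Each slice is a strong deformation retract of the cylinder, by contracting `I` to `t`. -/
theorem injective_map_sliceInclusion {F : C(unitInterval × X, Z)} (t : unitInterval)
    (h : F.comp (sliceInclusion X t) = f) :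
    Function.Injective (NielsenClass.map (p := p) Y (sliceInclusion X t) h) := by
  refine NielsenClass.map_injective _ _ ContinuousMap.snd rfl
    (homotopicRel_id_of_interval (.const _ t) (fun _ => rfl) ?_)
  rintro _ ⟨x, rfl⟩
  rfl

end Functoriality

/-! ### Concatenation of homotopies and essential classes. -/

section Concatenation

variable {p : ℕ} {X Z : Type*} [TopologicalSpace X] [TopologicalSpace Z] {f g h : C(X, Z)}
  {Y : Set Z}

theorem nielsenStart_injective (F : f.Homotopy g) : Function.Injective (nielsenStart p Y F) :=
  injective_map_sliceInclusion _ _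

theorem nielsenEnd_injective (F : f.Homotopy g) : Function.Injective (nielsenEnd p Y F) :=
  injective_map_sliceInclusion _ _

/-- The inclusion of the first half of the cylinder. -/
def lowerHalf (X : Type*) [TopologicalSpace X] : C(unitInterval × X, unitInterval × X) where
  toFun q := (⟨(q.1 : ℝ) / 2, by have := q.1.2.1; positivity, by have := q.1.2.2; linarith⟩, q.2)
  continuous_toFun := by fun_prop

/-- The inclusion of the second half of the cylinder. -/
def upperHalf (X : Type*) [TopologicalSpace X] : C(unitInterval × X, unitInterval × X) where
  toFun q := (⟨((q.1 : ℝ) + 1) / 2, by have := q.1.2.1; positivity, by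
    have := q.1.2.2; linarith⟩, q.2)
  continuous_toFun := by fun_prop

theorem trans_comp_lowerHalf (F : f.Homotopy g) (G : g.Homotopy h) :
    (F.trans G).toContinuousMap.comp (lowerHalf X) = F.toContinuousMap := by
  ext ⟨t, x⟩
  have ht : (t : ℝ) / 2 ≤ 1 / 2 := by linarith [t.2.2]
  refine (ContinuousMap.Homotopy.trans_apply F G _).trans ((dif_pos ht).trans ?_)
  refine congrArg F (Prod.ext (Subtype.ext ?_) rfl)
  change 2 * ((t : ℝ) / 2) = t
  ring

theorem trans_comp_upperHalf (F : f.Homotopy g) (G : g.Homotopy h) :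
    (F.trans G).toContinuousMap.comp (upperHalf X) = G.toContinuousMap := by
  ext ⟨t, x⟩
  refine (ContinuousMap.Homotopy.trans_apply F G _).trans ?_
  by_cases ht : ((t : ℝ) + 1) / 2 ≤ 1 / 2
  · have ht₀ : t = 0 := Subtype.ext (le_antisymm (by simp only [Set.Icc.coe_zero]; linarith) t.2.1)
    subst ht₀
    refine (dif_pos ht).trans ?_
    refine Eq.trans ?_ ((F.apply_one x).trans (G.apply_zero x).symm)
    refine congrArg F (Prod.ext (Subtype.ext ?_) rfl)
    simp [upperHalf]
  · refine (dif_neg ht).trans ?_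
    refine congrArg G (Prod.ext (Subtype.ext ?_) rfl)
    change 2 * (((t : ℝ) + 1) / 2) - 1 = t
    ring

/-- The upper half is a strong deformation retract: `ρ` pushes `[0, 1/2]` to `1/2` and fixes `[1/2,
1]`, and `r` is the same retraction in the coordinate of the half cylinder. -/
theorem injective_map_upperHalf {F G : C(unitInterval × X, Z)} (h : F.comp (upperHalf X) = G) :
    Function.Injective (NielsenClass.map (p := p) Y (upperHalf X) h) := by
  let r : C(unitInterval × X, unitInterval × X) :=
    ⟨fun q => (⟨max (2 * (q.1 : ℝ) - 1) 0, le_max_right _ _,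
      max_le (by linarith [q.1.2.2]) zero_le_one⟩, q.2), by fun_prop⟩
  let ρ : C(unitInterval, unitInterval) :=
    ⟨fun t => ⟨(max (2 * (t : ℝ) - 1) 0 + 1) / 2, by positivity, by
      have := max_le (by linarith [t.2.2] : 2 * (t : ℝ) - 1 ≤ 1) zero_le_one
      linarith⟩, by fun_prop⟩
  have hr : r.comp (upperHalf X) = ContinuousMap.id _ := by
    ext q
    · have := q.1.2.1
      change max (2 * (((q.1 : ℝ) + 1) / 2) - 1) 0 = q.1
      rw [max_eq_left] <;> linarith
    · rfl
  refine NielsenClass.map_injective _ _ r hr (homotopicRel_id_of_interval ρ (fun _ => rfl) ?_)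
  rintro _ ⟨q, rfl⟩
  exact congrArg (upperHalf X) (DFunLike.congr_fun hr q)

/-- The reflection of the cylinder. -/
def cylinderFlip (X : Type*) [TopologicalSpace X] : C(unitInterval × X, unitInterval × X) where
  toFun q := (unitInterval.symm q.1, q.2)
  continuous_toFun := by fun_prop

/-- The reflection of the cylinder is a map over `Z` from `F.symm` to `F` that exchanges the two
ends. -/
theorem nielsenEnd_eq_of_symm {F : f.Homotopy g} {a : NielsenClass p f Y} {b : NielsenClass p g Y}
    (hab : nielsenEnd p Y F.symm a = nielsenStart p Y F.symm b) :
    nielsenEnd p Y F b = nielsenStart p Y F a := by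
  have hF : F.toContinuousMap.comp (cylinderFlip X) = F.symm.toContinuousMap := rfl
  have h := congrArg (NielsenClass.map Y (cylinderFlip X) hF) hab
  unfold nielsenEnd nielsenStart at h ⊢
  rw [NielsenClass.map_map _ _ _ _ (sliceInclusion X 0) _
      (by ext x <;> simp [cylinderFlip, sliceInclusion]),
    NielsenClass.map_map _ _ _ _ (sliceInclusion X 1) _
      (by ext x <;> simp [cylinderFlip, sliceInclusion])] at h
  exact h.symm

/-- The comparison takes place in the classes of `F.trans G`, into which those of `G` inject. The
middle slice is the end of the lower half and the start of the upper half, so `hab` identifies `b`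
there with `a` at the start, and `hac` with `c` at the end. -/
theorem nielsenStart_eq_of_trans {F : f.Homotopy g} {G : g.Homotopy h} {a : NielsenClass p f Y}
    {b : NielsenClass p g Y} {c : NielsenClass p h Y}
    (hab : nielsenEnd p Y F b = nielsenStart p Y F a)
    (hac : nielsenEnd p Y (F.trans G) c = nielsenStart p Y (F.trans G) a) :
    nielsenEnd p Y G c = nielsenStart p Y G b := by
  apply injective_map_upperHalf (trans_comp_upperHalf F G)
  have h₁ : (lowerHalf X).comp (sliceInclusion X 0) = sliceInclusion X 0 := by
    ext x <;> simp [lowerHalf, sliceInclusion]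
  have h₂ : (upperHalf X).comp (sliceInclusion X 1) = sliceInclusion X 1 := by
    ext x <;> simp [upperHalf, sliceInclusion]
  have h₃ : (upperHalf X).comp (sliceInclusion X 0) = (lowerHalf X).comp (sliceInclusion X 1) := by
    ext x <;> simp [lowerHalf, upperHalf, sliceInclusion]
  have hab' := congrArg (NielsenClass.map Y (lowerHalf X) (trans_comp_lowerHalf F G)) hab
  unfold nielsenEnd nielsenStart at *
  have hg : (F.trans G).toContinuousMap.comp ((lowerHalf X).comp (sliceInclusion X 1)) = g := by
    rw [← ContinuousMap.comp_assoc, trans_comp_lowerHalf]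
    ext x
    exact F.apply_one x
  rw [NielsenClass.map_map _ _ _ _ _ hg rfl, NielsenClass.map_map _ _ _ _ _ _ h₁] at hab'
  have hh : (F.trans G).toContinuousMap.comp (sliceInclusion X 1) = h := by
    ext x
    exact (F.trans G).apply_one x
  rw [NielsenClass.map_map _ _ _ _ _ hh h₂, NielsenClass.map_map _ _ _ _ _ hg h₃, hac, hab']

/-- The other condition in `preservedClasses`, to lie in the range of `nielsenStart`, holds
automatically. -/
theorem mem_essentialClasses {a : NielsenClass p f Y} :
    a ∈ essentialClasses p f Y ↔
      ∀ (g : C(X, Z)) (F : f.Homotopy g), nielsenStart p Y F a ∈ Set.range (nielsenEnd p Y F) := by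
  simp [essentialClasses, preservedClasses]

/-- Every homotopy `G` of `g` extends to the homotopy `F.trans G` of `f`, which `a` survives; hence
its partner `b` survives `G`. -/
theorem exists_mem_essentialClasses (F : f.Homotopy g) {a : NielsenClass p f Y}
    (ha : a ∈ essentialClasses p f Y) :
    ∃ b ∈ essentialClasses p g Y, nielsenEnd p Y F b = nielsenStart p Y F a := by
  rw [mem_essentialClasses] at ha
  obtain ⟨b, hb⟩ := ha g F
  refine ⟨b, mem_essentialClasses.2 fun h G => ?_, hb⟩
  obtain ⟨c, hc⟩ := ha h (F.trans G)
  exact ⟨c, nielsenStart_eq_of_trans hb hc⟩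

attribute [local instance] NielsenClass.addCommGroup

/-- The subgroup of topologically essential classes. -/
def essentialSubgroup (p : ℕ) (f : C(X, Z)) (Y : Set Z) : AddSubgroup (NielsenClass p f Y) :=
  (⨅ (g : C(X, Z)) (F : f.Homotopy g),
    (NielsenClass.mapHom (Y := Y) (f := g) (sliceInclusion X 1)
      (by ext x; exact F.apply_one x)).range.comap
        (NielsenClass.mapHom (p := p) (f' := F.toContinuousMap) (sliceInclusion X 0)
          (by ext x; exact F.apply_zero x)))

theorem coe_essentialSubgroup : (essentialSubgroup p f Y : Set _) = essentialClasses p f Y := by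
  ext a
  rw [mem_essentialClasses]
  simp only [essentialSubgroup, AddSubgroup.coe_iInf, Set.mem_iInter]
  rfl

theorem nielsenStart_add (F : f.Homotopy g) (a b : NielsenClass p f Y) :
    nielsenStart p Y F (a + b) = nielsenStart p Y F a + nielsenStart p Y F b :=
  NielsenClass.map_add _ _ _ _

theorem nielsenEnd_add (F : f.Homotopy g) (a b : NielsenClass p g Y) :
    nielsenEnd p Y F (a + b) = nielsenEnd p Y F a + nielsenEnd p Y F b :=
  NielsenClass.map_add _ _ _ _

/-- Injectivity of `nielsenEnd` makes the partner of `a` unique, hence additive in `a`; injectivity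
of `nielsenStart` makes the correspondence injective, and `F.symm` provides preimages. -/
theorem exists_essentialSubgroup_equiv (F : f.Homotopy g) :
    ∃ e : essentialSubgroup p f Y ≃+ essentialSubgroup p g Y, ∀ a : essentialSubgroup p f Y,
      nielsenEnd p Y F (e a : NielsenClass p g Y) = nielsenStart p Y F a := by
  have hmem : ∀ {f : C(X, Z)} {a : NielsenClass p f Y},
      a ∈ essentialSubgroup p f Y ↔ a ∈ essentialClasses p f Y := by
    intro f a
    rw [← coe_essentialSubgroup]
    rfl
  have hex : ∀ a : essentialSubgroup p f Y, ∃ b : essentialSubgroup p g Y,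
      nielsenEnd p Y F (b : NielsenClass p g Y) = nielsenStart p Y F a := by
    intro a
    obtain ⟨b, hb, hab⟩ := exists_mem_essentialClasses F (hmem.1 a.2)
    exact ⟨⟨b, hmem.2 hb⟩, hab⟩
  choose e he using hex
  have hadd : ∀ a b, e (a + b) = e a + e b := by
    intro a b
    apply Subtype.ext
    apply nielsenEnd_injective F
    rw [he, AddSubgroup.coe_add, AddSubgroup.coe_add, nielsenStart_add, nielsenEnd_add, he, he]
  refine ⟨AddEquiv.ofBijective (AddMonoidHom.mk' e hadd) ⟨fun a b hab => ?_, fun b => ?_⟩, he⟩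
  · apply Subtype.ext
    apply nielsenStart_injective F
    rw [← he, ← he]
    exact congrArg (fun c : essentialSubgroup p g Y => nielsenEnd p Y F c) hab
  · obtain ⟨a, ha, hab⟩ := exists_mem_essentialClasses F.symm (hmem.1 b.2)
    refine ⟨⟨a, hmem.2 ha⟩, Subtype.ext (nielsenEnd_injective F ?_)⟩
    exact (he _).trans (nielsenEnd_eq_of_symm hab).symm

theorem exists_essentialSubgroup_monomorphism (F : f.Homotopy g) :
    ∃ φ : essentialSubgroup p f Y →+ NielsenClass p g Y, Function.Injective φ ∧
      ∀ a : essentialSubgroup p f Y, nielsenEnd p Y F (φ a) = nielsenStart p Y F a := by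
  obtain ⟨e, he⟩ := exists_essentialSubgroup_equiv (p := p) (Y := Y) F
  exact ⟨(essentialSubgroup p g Y).subtype.comp e.toAddMonoidHom,
    Subtype.val_injective.comp e.injective, he⟩

end Concatenation

end

theorem mainTheorem2 {X Z : Type*} [TopologicalSpace X] [TopologicalSpace Z]
    (Y : Set Z) (p : ℕ) :
    (∀ f : C(X, Z), Equivalence (NielsenEquiv (p := p) f Y)) ∧
    ∃ grp : ∀ f : C(X, Z), AddCommGroup (NielsenClass p f Y),
      (∀ (f : C(X, Z)) (s t : OrientedSingularManifold p (f ⁻¹' Y)),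
        NielsenClass.mk f Y s + NielsenClass.mk f Y t = NielsenClass.mk f Y (s.sum t)) ∧
      ∃ S : ∀ f : C(X, Z), AddSubgroup (NielsenClass p f Y),
        (∀ f : C(X, Z), (S f : Set (NielsenClass p f Y)) = essentialClasses p f Y) ∧
        ∀ (f g : C(X, Z)) (F : f.Homotopy g),
          (∃ e : S f ≃+ S g, ∀ a : S f,
            nielsenEnd p Y F (e a : NielsenClass p g Y) = nielsenStart p Y F a) ∧
          (∃ φ : S f →+ NielsenClass p g Y, Function.Injective φ ∧
            ∀ a : S f, nielsenEnd p Y F (φ a) = nielsenStart p Y F a) := by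
  exact ⟨fun f => equivalence_nielsenEquiv, fun f => NielsenClass.addCommGroup,
    fun f => NielsenClass.mk_add_mk, fun f => essentialSubgroup p f Y,
    fun f => coe_essentialSubgroup, fun f g F =>
      ⟨exists_essentialSubgroup_equiv F, exists_essentialSubgroup_monomorphism F⟩⟩
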